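/- **Conventions.** Let $\mathbb L$ be the Lazard ring, i.e. the quotient of $\mathbb Z[a_{i,j} : i,j\ge 1]$ by the relations that make $F_{\mathbb L}(u,v)=u+v+\sum_{i,j\ge1}a_{i,j}u^iv^j$ a commutative formal group law. Write $a\boxplus b=F_{\mathbb L}(a,b)$ and let $\overline a=\chi_{\mathbb L}(a)$, where $\chi_{\mathbb L}(u)\in\mathbb L[[u]]$ is the unique series without constant term such that $u\boxplus\chi_{\mathbb L}(u)=0$. For a strict partition $\lambda=(\lambda_1>\dots>\lambda_r>0)$ of length $r\le n$ put $$P^{\mathbb L}_\lambda(x_1,\dots,x_n)=\frac1{(n-r)!}\sum_{w\in S_n}w\Big[\prod_{i=1}^r x_i^{\lambda_i}\prod_{i=1}^r\prod_{j=i+1}^n\frac{x_i\boxplus x_j}{x_i\boxplus\overline x_j}\Big],$$ $$Q^{\mathbb L}_\lambda(x_1,\dots,x_n)=\frac1{(n-r)!}\sum_{w\in S_n}w\Big[\prod_{i=1}^r (x_i\boxplus x_i)x_i^{\lambda_i-1}\prod_{i=1}^r\prod_{j=i+1}^n\frac{x_i\boxplus x_j}{x_i\boxplus\overline x_j}\Big],$$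 computed in the total ring of fractions of $\mathbb L[[x_1,\dots,x_n]]$, where $w\in S_n$ permutes the variables; put $P^{\mathbb L}_\lambda(x_1,\dots,x_n)=Q^{\mathbb L}_\lambda(x_1,\dots,x_n)=0$ if $r>n$. Let $\Gamma^{\mathbb L}(\mathbf x_n)\subset\mathbb L[[x_1,\dots,x_n]]$ be the subring of the symmetric power series $f$ such that (when $n\ge2$) $f(t,\overline t,x_3,\dots,x_n)=f(0,0,x_3,\dots,x_n)$, and let $\Gamma^{\mathbb L}_+(\mathbf x_n)$ be the subring of those $f\in\Gamma^{\mathbb L}(\mathbf x_n)$ for which (when $n\ge1$) $f(t,x_2,\dots,x_n)-f(0,x_2,\dots,x_n)$ is divisible by $t\boxplus t$. Let $\Gamma^{\mathbb L}(\mathbf x)=\varprojlim_n\Gamma^{\mathbb L}(\mathbf x_n)$ and $\Gamma^{\mathbb L}_+(\mathbf x)=\varprojlim_n\Gamma^{\mathbb L}_+(\mathbf x_n)$ along the maps $x_{n+1}\mapsto0$. A family $(b_\lambda)_{\lambda\in I}$ in one of these rings is a *formal $\mathbb L$-basis* of it if, for arbitrary coefficients $c_\lambda\in\mathbb L$, the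 sum $\sum_{\lambda\in I} c_\lambda b_\lambda$ converges coefficientwise (each coefficient being a finite sum; for the inverse limits, for each $n$) to an element of the ring, and every element of the ring is equal to such a sum for exactly one family $(c_\lambda)_{\lambda\in I}$. **Theorem.** (0) For all $n\ge0$ and all strict partitions $\lambda$ of length $\le n$, the fractions $P^{\mathbb L}_\lambda(x_1,\dots,x_n)$ and $Q^{\mathbb L}_\lambda(x_1,\dots,x_n)$ belong to $\mathbb L[[x_1,\dots,x_n]]$. (1) For every $n\ge0$, the $P^{\mathbb L}_\lambda(x_1,\dots,x_n)$, with $\lambda$ running over the strict partitions of length $\le n$, form a formal $\mathbb L$-basis of $\Gamma^{\mathbb L}(\mathbf x_n)$, and the $Q^{\mathbb L}_\lambda(x_1,\dots,x_n)$, for the same $\lambda$, form a formal $\mathbb L$-basis of $\Gamma^{\mathbb L}_+(\mathbf x_n)$. (2) The sequences $P^{\mathbb L}_\lambda(\mathbf x)=(P^{\mathbb L}_\lambda(x_1,\dots,x_n))_n$, with $\lambda$ running over all strict partitions, form a formal $\mathbb L$-basis of $\Gamma^{\mathbb L}(\mathbf x)$, and the sequences $Q^{\mathbb L}_\lambda(\mathbf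 x)=(Q^{\mathbb L}_\lambda(x_1,\dots,x_n))_n$ form a formal $\mathbb L$-basis of $\Gamma^{\mathbb L}_+(\mathbf x)$. -/

import Mathlib

noncomputable section

namespace UniversalSchur

open MvPowerSeries
open scoped MvPowerSeries.WithPiTopology

/-! ### The Lazard ring and the universal formal group law -/

/-- The generic series `u + v + ∑_{i,j ≥ 1} a_{i,j} u^i v^j`, over the polynomial ring on the
symbols `a_{i,j}`; the symbol `a_{i,j}` is the variable with index `(i - 1, j - 1)`. -/
def genericSeries : MvPowerSeries (Fin 2) (MvPolynomial (ℕ × ℕ) ℤ) := fun d =>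
  if d 0 = 0 then (if d 1 = 1 then 1 else 0)
  else if d 1 = 0 then (if d 0 = 1 then 1 else 0)
  else MvPolynomial.X (d 0 - 1, d 1 - 1)

/-- The difference `F(F(u, v), w) - F(u, F(v, w))`. -/
def assocDefect {R : Type*} [CommRing R] (F : MvPowerSeries (Fin 2) R) :
    MvPowerSeries (Fin 3) R :=
  F.subst ![F.subst ![(X 0 : MvPowerSeries (Fin 3) R), X 1], X 2] -
    F.subst ![(X 0 : MvPowerSeries (Fin 3) R), F.subst ![(X 1 : MvPowerSeries (Fin 3) R), X 2]]

/-- The difference `F(u, v) - F(v, u)`. -/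
def commDefect {R : Type*} [CommRing R] (F : MvPowerSeries (Fin 2) R) :
    MvPowerSeries (Fin 2) R :=
  F - F.subst ![(X 1 : MvPowerSeries (Fin 2) R), X 0]

/-- The ideal of relations among the `a_{i,j}` expressing associativity and commutativity. -/
def lazardIdeal : Ideal (MvPolynomial (ℕ × ℕ) ℤ) :=
  Ideal.span (Set.range (fun d => coeff d (assocDefect genericSeries)) ∪
    Set.range (fun d => coeff d (commDefect genericSeries)))

/-- The Lazard ring `𝕃`. -/
def LazardRing : Type := MvPolynomial (ℕ × ℕ) ℤ ⧸ lazardIdeal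

instance : CommRing LazardRing := inferInstanceAs (CommRing (_ ⧸ lazardIdeal))

/-- The coefficient ring `𝕃` is given the discrete topology, so that power series rings over it
carry the topology of coefficientwise stabilisation. -/
instance : TopologicalSpace LazardRing := ⊥

instance : DiscreteTopology LazardRing := ⟨rfl⟩

/-- The quotient map onto the Lazard ring. -/
def lazardMk : MvPolynomial (ℕ × ℕ) ℤ →+* LazardRing := Ideal.Quotient.mk lazardIdeal

/-- The universal series `F_𝕃(u, v)`. -/
def universalSeries : MvPowerSeries (Fin 2) LazardRing := map lazardMk genericSeries

theorem constantCoeff_genericSeries : constantCoeff genericSeries = 0 := by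
  rw [← coeff_zero_eq_constantCoeff_apply]
  simp [coeff_apply, genericSeries]

theorem lazardMk_eq_zero {p : MvPolynomial (ℕ × ℕ) ℤ} (hp : p ∈ lazardIdeal) : lazardMk p = 0 :=
  Ideal.Quotient.eq_zero_iff_mem.mpr hp

theorem map_vec {R S : Type*} [CommRing R] [CommRing S] {σ : Type*} (h : R →+* S)
    (a b : MvPowerSeries σ R) :
    (fun i => map h ((![a, b] : Fin 2 → MvPowerSeries σ R) i)) = ![map h a, map h b] := by
  funext i
  fin_cases i <;> rfl

/-- The universal formal group law `F_𝕃`, as a formal group law over `𝕃`. -/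
def universalFGL : FormalGroup LazardRing where
  toPowerSeries := universalSeries
  zero_constantCoeff := by
    simp [universalSeries, constantCoeff_map, constantCoeff_genericSeries]
  lin_coeff_X := by
    rw [universalSeries, coeff_map]
    simp [coeff_apply, genericSeries]
  lin_coeff_Y := by
    rw [universalSeries, coeff_map]
    simp [coeff_apply, genericSeries]
  assoc := by
    have h : map lazardMk (assocDefect genericSeries) = 0 := by
      ext d
      rw [coeff_map]
      exact lazardMk_eq_zero (Ideal.subset_span (Or.inl ⟨d, rfl⟩))
    rw [assocDefect, map_sub, sub_eq_zero,
      map_subst (HasSubst.cons_subst_zero_left 0 1 2 constantCoeff_genericSeries),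
      map_subst (HasSubst.cons_subst_zero_right 0 1 2 constantCoeff_genericSeries),
      map_vec, map_vec, map_subst HasSubst.X_X, map_subst HasSubst.X_X, map_vec, map_vec] at h
    simpa [universalSeries] using h

instance : universalFGL.IsComm where
  comm := by
    have h : map lazardMk (commDefect genericSeries) = 0 := by
      ext d
      rw [coeff_map]
      exact lazardMk_eq_zero (Ideal.subset_span (Or.inr ⟨d, rfl⟩))
    rw [commDefect, map_sub, sub_eq_zero, map_subst HasSubst.X_X, map_vec] at h
    simpa [universalSeries, universalFGL] using h

/-! ### Formal inverse -/

section FormalInverse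

variable {R : Type*} [CommRing R] (F : FormalGroup R)

theorem hasSubst_pair {σ : Type*} {a b : MvPowerSeries σ R} (ha : constantCoeff a = 0)
    (hb : constantCoeff b = 0) : HasSubst ![a, b] :=
  hasSubst_of_constantCoeff_zero fun i => by fin_cases i <;> simpa

theorem constantCoeff_formalSum {σ : Type*} {a b : MvPowerSeries σ R} (ha : constantCoeff a = 0)
    (hb : constantCoeff b = 0) : constantCoeff (F.toPowerSeries.subst ![a, b]) = 0 :=
  constantCoeff_subst_eq_zero (hasSubst_pair ha hb) (fun i => by fin_cases i <;> simpa)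
    F.zero_constantCoeff

theorem dvd_formalSum_sub {a b b' : PowerSeries R} (ha : constantCoeff a = 0)
    (hb : constantCoeff b = 0) (hb' : constantCoeff b' = 0) {m : ℕ}
    (h : (PowerSeries.X : PowerSeries R) ^ m ∣ b - b') :
    (PowerSeries.X : PowerSeries R) ^ m ∣
      F.toPowerSeries.subst ![a, b] - F.toPowerSeries.subst ![a, b'] := by
  rw [PowerSeries.X_pow_dvd_iff]
  intro k hk
  rw [map_sub, sub_eq_zero, PowerSeries.coeff, coeff_subst (hasSubst_pair ha hb),
    coeff_subst (hasSubst_pair ha hb')]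
  refine finsum_congr fun d => ?_
  congr 1
  have key : (PowerSeries.X : PowerSeries R) ^ m ∣ a ^ d 0 * b ^ d 1 - a ^ d 0 * b' ^ d 1 := by
    rw [← mul_sub]
    exact (h.trans (sub_dvd_pow_sub_pow _ _ _)).mul_left _
  have := (PowerSeries.X_pow_dvd_iff.mp key) k hk
  rw [map_sub, sub_eq_zero] at this
  simpa [Finsupp.prod_fintype, PowerSeries.coeff] using this

theorem dvd_formalSum_neg {a : PowerSeries R} {m : ℕ} (hm : 1 ≤ m)
    (h : (PowerSeries.X : PowerSeries R) ^ m ∣ a) :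
    (PowerSeries.X : PowerSeries R) ^ (m + 1) ∣ F.toPowerSeries.subst ![a, -a] := by
  have ha : constantCoeff a = 0 := by
    have := PowerSeries.X_pow_dvd_iff.mp h 0 (by omega)
    simpa [PowerSeries.constantCoeff] using this
  have hs : HasSubst ![a, -a] := hasSubst_pair ha (by simp [ha])
  set G : MvPowerSeries (Fin 2) R := F.toPowerSeries - X 0 - X 1 with hG
  have e : F.toPowerSeries.subst ![a, -a] = G.subst ![a, -a] := by
    rw [hG, subst_sub hs, subst_sub hs, subst_X hs, subst_X hs]
    simp
  have hGo : ((2 : ℕ) : ℕ∞) ≤ G.order := by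
    refine le_order fun d hd => ?_
    have hd' : d.degree < 2 := by exact_mod_cast hd
    rw [Finsupp.degree_eq_sum, Fin.sum_univ_two] at hd'
    have hd3 : d = 0 ∨ d = Finsupp.single 0 1 ∨ d = Finsupp.single 1 1 := by
      have : (d 0 = 0 ∧ d 1 = 0) ∨ (d 0 = 1 ∧ d 1 = 0) ∨ (d 0 = 0 ∧ d 1 = 1) := by omega
      rcases this with h | h | h
      · left; ext i; fin_cases i <;> simp [h.1, h.2]
      · right; left; ext i; fin_cases i <;> simp [h.1, h.2]
      · right; right; ext i; fin_cases i <;> simp [h.1, h.2]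
    rcases hd3 with rfl | rfl | rfl
    · simp [hG, F.zero_constantCoeff]
    · simp [hG, F.lin_coeff_X, coeff_X, Finsupp.single_left_inj]
    · simp [hG, F.lin_coeff_Y, coeff_X, Finsupp.single_left_inj]
  have hao : ∀ i, ((m : ℕ) : ℕ∞) ≤
      MvPowerSeries.order ((![a, -a] : Fin 2 → MvPowerSeries Unit R) i) := by
    have h1 : ∀ d : Unit →₀ ℕ, d.degree < m → MvPowerSeries.coeff d a = 0 := by
      intro d hd
      have hdd : d = Finsupp.single () (d ()) := by ext; simp
      have h2 : d.degree = d () := by rw [Finsupp.degree_eq_sum]; simp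
      have := PowerSeries.X_pow_dvd_iff.mp h (d ()) (by omega)
      rw [hdd]
      exact this
    intro i
    refine le_order fun d hd => ?_
    have hd' : d.degree < m := by exact_mod_cast hd
    fin_cases i
    · exact h1 d hd'
    · simpa using h1 d hd'
  have hord : ((m + 1 : ℕ) : ℕ∞) ≤ (G.subst ![a, -a]).order := by
    refine le_trans ?_ (le_order_subst hs G)
    have h1 : ((m + 1 : ℕ) : ℕ∞) ≤ ((m * 2 : ℕ) : ℕ∞) := by exact_mod_cast (by omega)
    have h2 : ((m * 2 : ℕ) : ℕ∞) = (m : ℕ∞) * ((2 : ℕ) : ℕ∞) := by push_cast; rfl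
    exact (h1.trans h2.le).trans (mul_le_mul' (le_iInf hao) hGo)
  rw [e, PowerSeries.X_pow_dvd_iff]
  intro k hk
  refine coeff_of_lt_order (lt_of_lt_of_le ?_ hord)
  rw [Finsupp.degree_single]
  exact_mod_cast hk

/-- Successive approximations: the pair `(y, e)` satisfies `u +_F y = e`. -/
def inverseApprox : ℕ → PowerSeries R × PowerSeries R
  | 0 => (0, PowerSeries.X)
  | k + 1 => (F.toPowerSeries.subst ![(inverseApprox k).1, -(inverseApprox k).2],
      F.toPowerSeries.subst ![(inverseApprox k).2, -(inverseApprox k).2])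

theorem inverseApprox_spec (k : ℕ) :
    constantCoeff (inverseApprox F k).1 = 0 ∧ constantCoeff (inverseApprox F k).2 = 0 ∧
    F.toPowerSeries.subst ![(PowerSeries.X : PowerSeries R), (inverseApprox F k).1] =
      (inverseApprox F k).2 ∧
    (PowerSeries.X : PowerSeries R) ^ (k + 1) ∣ (inverseApprox F k).2 := by
  have hX : constantCoeff (PowerSeries.X : PowerSeries R) = 0 := by simp [PowerSeries.X]
  induction k with
  | zero =>
    refine ⟨by simp [inverseApprox], hX, ?_, by simp [inverseApprox]⟩
    exact F.add_zero (by simp [PowerSeries.HasSubst, hX])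
  | succ k ih =>
    obtain ⟨h1, h2, h3, h4⟩ := ih
    have h2' : constantCoeff (-(inverseApprox F k).2) = 0 := by simp [h2]
    refine ⟨constantCoeff_formalSum F h1 h2', constantCoeff_formalSum F h2 h2', ?_,
      dvd_formalSum_neg F (by omega) h4⟩
    simp only [inverseApprox]
    rw [← F.assoc' (by simp [PowerSeries.HasSubst, hX]) (by simp [PowerSeries.HasSubst, h1])
      (by simp [PowerSeries.HasSubst, h2]), h3]

theorem dvd_inverseApprox_sub {k l : ℕ} (h : k ≤ l) :
    (PowerSeries.X : PowerSeries R) ^ (k + 1) ∣ (inverseApprox F l).1 - (inverseApprox F k).1 := by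
  induction l, h using Nat.le_induction with
  | base => simp
  | succ l hl ih =>
    obtain ⟨h1, h2, -, h4⟩ := inverseApprox_spec F l
    have := dvd_formalSum_sub F (a := (inverseApprox F l).1) (b := -(inverseApprox F l).2)
      (b' := 0) h1 (by simp [h2]) (by simp) (m := k + 1)
      (by simpa using (pow_dvd_pow _ (by omega)).trans h4)
    rw [F.add_zero (by simp [PowerSeries.HasSubst, h1])] at this
    have := dvd_add this ih
    simpa [inverseApprox] using this

/-- Every one-dimensional commutative formal group law has a unique formal inverse. -/
theorem existsUnique_formalInverse [F.IsComm] : ∃! χ : PowerSeries R,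
    PowerSeries.constantCoeff χ = 0 ∧ F.toPowerSeries.subst ![PowerSeries.X, χ] = 0 := by
  have hX : constantCoeff (PowerSeries.X : PowerSeries R) = 0 := by simp [PowerSeries.X]
  refine existsUnique_of_exists_of_unique ?_ ?_
  · set χ : PowerSeries R := PowerSeries.mk fun n => PowerSeries.coeff n (inverseApprox F n).1
      with hχ
    have hχ0 : constantCoeff χ = 0 := by
      change PowerSeries.constantCoeff χ = 0
      rw [← PowerSeries.coeff_zero_eq_constantCoeff_apply, hχ, PowerSeries.coeff_mk]
      simp [inverseApprox]
    refine ⟨χ, hχ0, ?_⟩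
    ext n
    obtain ⟨h1, -, h3, h4⟩ := inverseApprox_spec F n
    have hd : (PowerSeries.X : PowerSeries R) ^ (n + 1) ∣ χ - (inverseApprox F n).1 := by
      rw [PowerSeries.X_pow_dvd_iff]
      intro m hm
      have := PowerSeries.X_pow_dvd_iff.mp (dvd_inverseApprox_sub F (Nat.lt_succ_iff.mp hm)) m
        (by omega)
      rw [map_sub, sub_eq_zero] at this
      rw [map_sub, hχ, PowerSeries.coeff_mk, this, sub_self]
    have := dvd_add (dvd_formalSum_sub F hX hχ0 h1 hd) (h3 ▸ h4)
    rw [sub_add_cancel] at this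
    simpa using PowerSeries.X_pow_dvd_iff.mp this n (by omega)
  · rintro χ χ' ⟨h0, h⟩ ⟨h0', h'⟩
    have sX : PowerSeries.HasSubst (PowerSeries.X : PowerSeries R) := by
      simp [PowerSeries.HasSubst, hX]
    have s : PowerSeries.HasSubst χ := by
      rw [PowerSeries.HasSubst]
      exact h0 ▸ IsNilpotent.zero
    have s' : PowerSeries.HasSubst χ' := by
      rw [PowerSeries.HasSubst]
      exact h0' ▸ IsNilpotent.zero
    have := F.assoc' s sX s'
    rw [h', F.add_zero s, F.comm' s sX, h, F.zero_add s'] at this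
    exact this.symm

end FormalInverse

/-- The formal inverse `χ_𝕃(u)`: the unique series over `𝕃` with zero constant term and
`F_𝕃(u, χ_𝕃(u)) = 0`. -/
def universalInverse : PowerSeries LazardRing :=
  (existsUnique_formalInverse universalFGL).choose

theorem constantCoeff_universalInverse : PowerSeries.constantCoeff universalInverse = 0 :=
  (existsUnique_formalInverse universalFGL).choose_spec.1.1

/-- The formal sum `a ⊞ b = F_𝕃(a, b)`. -/
def formalSum {σ : Type*} (a b : MvPowerSeries σ LazardRing) : MvPowerSeries σ LazardRing :=
  universalFGL.toPowerSeries.subst ![a, b]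

/-- The formal inverse `χ_𝕃(a)` of `a`. -/
def formalInv {σ : Type*} (a : MvPowerSeries σ LazardRing) : MvPowerSeries σ LazardRing :=
  universalInverse.subst a

/-! ### The rings of `𝕃`-supersymmetric series in finitely many variables -/

/-- The ring `𝕃⟦x_1, …, x_n⟧`. -/
abbrev Series (n : ℕ) : Type := MvPowerSeries (Fin n) LazardRing

/-- The substitution `x_i ↦ t`, `x_j ↦ χ_𝕃(t)`, the new variable `t` being called `x_i` again. -/
def cancelSubst {n : ℕ} (i j : Fin n) : Fin n → Series n :=
  Function.update X j (formalInv (X i))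

/-- The substitution `x_i ↦ 0`. -/
def zeroSubst {n : ℕ} (i : Fin n) : Fin n → Series n :=
  Function.update X i 0

/-- The substitution `x_i ↦ 0`, `x_j ↦ 0`. -/
def zeroSubst₂ {n : ℕ} (i j : Fin n) : Fin n → Series n :=
  Function.update (zeroSubst i) j 0

theorem hasSubst_cancelSubst {n : ℕ} (i j : Fin n) : HasSubst (cancelSubst i j) := by
  refine hasSubst_of_constantCoeff_zero fun k => ?_
  rcases eq_or_ne k j with rfl | h
  · simp only [cancelSubst, Function.update_self, formalInv, PowerSeries.subst]
    exact constantCoeff_subst_eq_zero (hasSubst_of_constantCoeff_zero fun _ => by simp)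
      (fun _ => by simp) constantCoeff_universalInverse
  · simp [cancelSubst, h]

theorem hasSubst_zeroSubst {n : ℕ} (i : Fin n) : HasSubst (zeroSubst i) := by
  refine hasSubst_of_constantCoeff_zero fun k => ?_
  rcases eq_or_ne k i with rfl | h
  · simp [zeroSubst]
  · simp [zeroSubst, h]

theorem hasSubst_zeroSubst₂ {n : ℕ} (i j : Fin n) : HasSubst (zeroSubst₂ i j) := by
  refine hasSubst_of_constantCoeff_zero fun k => ?_
  rcases eq_or_ne k j with rfl | h
  · simp [zeroSubst₂]
  · rcases eq_or_ne k i with rfl | h'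
    · simp [zeroSubst₂, zeroSubst, h]
    · simp [zeroSubst₂, zeroSubst, h, h']

/-- The ring `Γ^𝕃(x_1, …, x_n)` of `𝕃`-supersymmetric series: the symmetric series `f` such that
substituting `t` and `χ_𝕃(t)` for two of the variables gives the same as substituting `0` and `0`
(by symmetry it does not matter for which two). -/
def Gam (n : ℕ) : Subalgebra LazardRing (Series n) where
  carrier := {f | (∀ w : Equiv.Perm (Fin n), rename w f = f) ∧
    ∀ i j : Fin n, i ≠ j → f.subst (cancelSubst i j) = f.subst (zeroSubst₂ i j)}
  mul_mem' := by
    rintro f g ⟨hf, hf'⟩ ⟨hg, hg'⟩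
    refine ⟨fun w => by rw [map_mul, hf, hg], fun i j h => ?_⟩
    rw [subst_mul (hasSubst_cancelSubst i j), subst_mul (hasSubst_zeroSubst₂ i j), hf' i j h,
      hg' i j h]
  add_mem' := by
    rintro f g ⟨hf, hf'⟩ ⟨hg, hg'⟩
    refine ⟨fun w => by rw [map_add, hf, hg], fun i j h => ?_⟩
    rw [subst_add (hasSubst_cancelSubst i j), subst_add (hasSubst_zeroSubst₂ i j), hf' i j h,
      hg' i j h]
  algebraMap_mem' r := by
    refine ⟨fun w => AlgHom.commutes _ r, fun i j _ => ?_⟩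
    rw [← substAlgHom_apply (hasSubst_cancelSubst i j),
      ← substAlgHom_apply (hasSubst_zeroSubst₂ i j), AlgHom.commutes, AlgHom.commutes]

/-- The subring `Γ^𝕃_+(x_1, …, x_n)` of those `f` in `Γ^𝕃(x_1, …, x_n)` for which
`f(t, x_2, …, x_n) - f(0, x_2, …, x_n)` is divisible by `t ⊞ t` (by symmetry it does not matter
which variable is called `t`). -/
def GamPlus (n : ℕ) : Subalgebra LazardRing (Series n) where
  carrier := {f | f ∈ Gam n ∧
    ∀ i : Fin n, formalSum (X i) (X i) ∣ f - f.subst (zeroSubst i)}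
  mul_mem' := by
    rintro f g ⟨hf, hf'⟩ ⟨hg, hg'⟩
    refine ⟨mul_mem hf hg, fun i => ?_⟩
    rw [subst_mul (hasSubst_zeroSubst i)]
    have := dvd_add ((hg' i).mul_left f) ((hf' i).mul_right (g.subst (zeroSubst i)))
    convert this using 1
    ring
  add_mem' := by
    rintro f g ⟨hf, hf'⟩ ⟨hg, hg'⟩
    refine ⟨add_mem hf hg, fun i => ?_⟩
    rw [subst_add (hasSubst_zeroSubst i), add_sub_add_comm]
    exact dvd_add (hf' i) (hg' i)
  algebraMap_mem' r := by
    refine ⟨(Gam n).algebraMap_mem r, fun i => ?_⟩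
    rw [← substAlgHom_apply (hasSubst_zeroSubst i), AlgHom.commutes, sub_self]
    exact dvd_zero _

/-! ### Passage to the limit -/

/-- The inverse limit of subalgebras `G n` of `𝕃⟦x_1, …, x_n⟧` along the maps
`f(x_1, …, x_{n+1}) ↦ f(x_1, …, x_n, 0)`: the algebra of compatible sequences. -/
def invLimit (G : ∀ n, Subalgebra LazardRing (Series n)) :
    Subalgebra LazardRing (∀ n, Series n) where
  carrier := {f | (∀ n, f n ∈ G n) ∧ ∀ n, killCompl (Fin.castSuccEmb : Fin n ↪ Fin (n + 1))
    (f (n + 1)) = f n}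
  mul_mem' := by
    rintro f g ⟨hf, hf'⟩ ⟨hg, hg'⟩
    exact ⟨fun n => mul_mem (hf n) (hg n), fun n => by
      rw [Pi.mul_apply, map_mul, hf', hg', Pi.mul_apply]⟩
  add_mem' := by
    rintro f g ⟨hf, hf'⟩ ⟨hg, hg'⟩
    exact ⟨fun n => add_mem (hf n) (hg n), fun n => by
      rw [Pi.add_apply, map_add, hf', hg', Pi.add_apply]⟩
  algebraMap_mem' r := ⟨fun n => (G n).algebraMap_mem r, fun n => AlgHom.commutes _ r⟩

/-- The ring `Γ^𝕃(x)` of `𝕃`-supersymmetric functions in `x = (x_1, x_2, …)`. -/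
def GamLimit : Subalgebra LazardRing (∀ n, Series n) := invLimit Gam

/-- The ring `Γ^𝕃_+(x)`. -/
def GamPlusLimit : Subalgebra LazardRing (∀ n, Series n) := invLimit GamPlus

/-! ### The universal Schur `P`- and `Q`-functions -/

/-- Strict partitions `λ_1 > λ_2 > ⋯ > λ_r > 0`. -/
structure StrictPartition where
  /-- The list of parts `[λ_1, …, λ_r]`. -/
  parts : List ℕ
  /-- The parts strictly decrease. -/
  strict : parts.Pairwise (· > ·)
  /-- The parts are positive. -/
  pos : ∀ a ∈ parts, 0 < a

/-- The length `r` of a strict partition. -/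
def StrictPartition.length (l : StrictPartition) : ℕ := l.parts.length

/-- The part `λ_{i+1}`, which is `0` for `i ≥ r`. -/
def StrictPartition.part (l : StrictPartition) (i : ℕ) : ℕ := l.parts.getD i 0

/-- The strict partitions of length at most `n`. -/
abbrev StrictPartitionLE (n : ℕ) : Type := {l : StrictPartition // l.length ≤ n}

/-- The total ring of fractions of `𝕃⟦x_1, …, x_n⟧`. -/
abbrev Fractions (n : ℕ) : Type := FractionRing (Series n)

/-- The power `[[t]]^k = (t ⊞ t) t^{k-1}` for `k ≥ 1`, and `[[t]]^0 = 1`. -/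
def doublePow {n : ℕ} (t : Series n) (k : ℕ) : Series n :=
  if k = 0 then 1 else formalSum t t * t ^ (k - 1)

/-- For power functions `pw t k`, such as `t^k`, the symmetrisation
`1 / (n - r)! * ∑_{w ∈ S_n} w [ ∏_{i ≤ r} pw x_i λ_i * ∏_{i ≤ r} ∏_{i < j ≤ n} (x_i ⊞ x_j) / (x_i ⊞ χ_𝕃(x_j)) ]`,
computed in the total ring of fractions, where `Ring.inverse` inverts non-zero-divisors. -/
def symmetrization (n : ℕ) (pw : Series n → ℕ → Series n) (l : StrictPartition) : Fractions n :=
  Ring.inverse (((n - l.length).factorial : ℕ) : Fractions n) *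
    ∑ w : Equiv.Perm (Fin n),
      ∏ i ∈ Finset.univ.filter (fun i : Fin n => (i : ℕ) < l.length),
        (algebraMap (Series n) (Fractions n) (pw (X (w i)) (l.part i)) *
          ∏ j ∈ Finset.univ.filter (fun j : Fin n => i < j),
            algebraMap (Series n) (Fractions n) (formalSum (X (w i)) (X (w j))) *
              Ring.inverse (algebraMap (Series n) (Fractions n)
                (formalSum (X (w i)) (formalInv (X (w j))))))

/-- The fraction defining `P^𝕃_λ(x_1, …, x_n)`, for `λ` of length at most `n`. -/
def fractionP (n : ℕ) (l : StrictPartition) : Fractions n :=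
  symmetrization n (fun t k => t ^ k) l

/-- The fraction defining `Q^𝕃_λ(x_1, …, x_n)`, for `λ` of length at most `n`. -/
def fractionQ (n : ℕ) (l : StrictPartition) : Fractions n :=
  symmetrization n doublePow l

/-- The power series that equals a given fraction (an arbitrary one if there is none). -/
def toSeries {n : ℕ} (z : Fractions n) : Series n :=
  Function.invFun (algebraMap (Series n) (Fractions n)) z

/-- The universal Schur `P`-function `P^𝕃_λ(x_1, …, x_n)`; it is `0` if `λ` has length `> n`. -/
def schurP (n : ℕ) (l : StrictPartition) : Series n :=
  if l.length ≤ n then toSeries (fractionP n l) else 0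

/-- The universal Schur `Q`-function `Q^𝕃_λ(x_1, …, x_n)`; it is `0` if `λ` has length `> n`. -/
def schurQ (n : ℕ) (l : StrictPartition) : Series n :=
  if l.length ≤ n then toSeries (fractionQ n l) else 0

/-- `P^𝕃_λ(x)`, as the sequence of the `P^𝕃_λ(x_1, …, x_n)`. -/
def schurPLimit (l : StrictPartition) : ∀ n, Series n := fun n => schurP n l

/-- `Q^𝕃_λ(x)`, as the sequence of the `Q^𝕃_λ(x_1, …, x_n)`. -/
def schurQLimit (l : StrictPartition) : ∀ n, Series n := fun n => schurQ n l

/-! ### Formal bases -/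

/-- The family `b` is a formal `𝕃`-basis of `Γ ⊆ A`: its members lie in `Γ`, every formal
`𝕃`-linear combination `∑ c_i b_i` converges to an element of `Γ`, and every element of `Γ` is
such a combination for exactly one family of coefficients. -/
def IsFormalBasis {A ι : Type*} [CommRing A] [Algebra LazardRing A] [TopologicalSpace A]
    (Γ : Subalgebra LazardRing A) (b : ι → A) : Prop :=
  (∀ i, b i ∈ Γ) ∧
  (∀ c : ι → LazardRing, ∃ f ∈ Γ, HasSum (fun i => c i • b i) f) ∧
  (∀ f ∈ Γ, ∃! c : ι → LazardRing, HasSum (fun i => c i • b i) f)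

/-- A formal basis of a subalgebra of `𝕃⟦x_1, …, x_n⟧`; sums converge coefficientwise, that is,
each coefficient of the sum is a finite sum. -/
def IsSeriesBasis {ι : Type*} (n : ℕ) (Γ : Subalgebra LazardRing (Series n))
    (b : ι → Series n) : Prop :=
  IsFormalBasis Γ b

/-- A formal basis of a subalgebra of `∏_n 𝕃⟦x_1, …, x_n⟧`; sums converge coefficientwise for
each `n`. -/
def IsLimitBasis {ι : Type*} (Γ : Subalgebra LazardRing (∀ n, Series n))
    (b : ι → ∀ n, Series n) : Prop :=
  IsFormalBasis Γ b

end UniversalSchur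

end

noncomputable section

namespace UniversalSchur

open MvPowerSeries
open scoped MvPowerSeries.WithPiTopology

/-! ### Symmetric two-cocycles -/

/-! Both families are instances of one construction. For a power series `h` without constant term,
use `h(t) t^(k-1)` as the `k`-th power of `t`: `h = t` gives `P` and `h = t ⊞ t` gives `Q`.
Everything is proved for `schurSeries h n l`, and `h` enters only through `IsHead`.

Integrality. Over the common denominator `∏_{i ≠ j} (x_i ⊞ χ(x_j))` the symmetrisation becomes a
numerator `lazardNum` that is defined by recursion on the parts and depends only on the set of
variables. Up to a unit the denominator is `∏_{i < j} (x_i - x_j)^2`. The numerator is divisible by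
each `(x_a - x_b)^2`, because exchanging `x_a` and `x_b` pairs off the terms that choose one of them
first. The `x_i - x_j` are primes not dividing one another, so the quotient is a series.

Membership. Under `x_j = χ(x_i)` the terms choosing `i` or `j` vanish and the others lose these two
variables (`schurNum_insert_insert`). The same recursion with one variable set to zero
(`schurNum_insert`) gives stability in `n` and, read modulo `x_a ⊞ x_a`, the extra condition for
`Q`.

Basis. Induct on `n` by setting the last variable to zero. What remains is a series `f` of the ring
divisible by every `x_a`. Supersymmetry makes `f` divisible by every `x_i ⊞ x_j`, hence by `E = ∏
h(x_a) ∏_{i<j} (x_i ⊞ x_j)` (`Gam_dvd`), and the Vandermonde product times `f / E` is antisymmetric.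
For `λ` of length exactly `n`, the Vandermonde product times the Schur function is `E` times the
antisymmetrisation of `x^(λ-1) U`, for one series `U` with constant term 1
(`vandermondeProd_mul_schurSeries`). These antisymmetrisations are unitriangular by degree on the
coefficients with strictly decreasing exponents, so they form a formal basis of the antisymmetric
series.

Arithmetic of the Lazard ring. The argument uses that `𝕃` is a domain of characteristic zero and,
for `Q`, that 2 is a non-zero-divisor modulo `t ⊞ t`. The former, and the primality of 2, come from
Lazard's theorem: cocycles show that one generator per degree suffices, and a formal group law with
a logarithm over `ℚ[x_0, x_1, …]` shows that these generators are independent. The latter follows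
since 2 is prime and does not divide `a_{1,1}`. -/

/-- The linearised associativity and commutativity relations satisfied by the coefficients
`a m` of `u ^ m * v ^ (N - m)` in a formal group law, modulo the lower ones. -/
structure IsCocycle {A : Type*} [AddCommGroup A] (N : ℕ) (a : ℕ → A) : Prop where
  rel : ∀ i m, 0 < i → i < m → m < N → m.choose i • a m = (N - i).choose (m - i) • a i
  symm : ∀ i, 0 < i → i < N → a i = a (N - i)

theorem nsmul_eq_of_modEq {A : Type*} [AddCommGroup A] {p : ℕ} {x : A} (hx : p • x = 0) {k l : ℕ}
    (h : k ≡ l [MOD p]) : k • x = l • x := by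
  have e : ∀ k : ℕ, k • x = (k % p) • x := fun k => by
    conv_lhs => rw [← Nat.mod_add_div k p, add_nsmul, mul_comm, mul_nsmul', hx, nsmul_zero,
      add_zero]
  rw [e k, e l, h]

theorem exists_zsmul_of_nsmul_eq {A : Type*} [AddCommGroup A] {p : ℕ} (hp : p.Prime) {x y : A}
    (hx : p • x = 0) {m : ℕ} (hm : ¬ p ∣ m) (h : ∃ c : ℤ, m • x = c • y) :
    ∃ c : ℤ, x = c • y := by
  obtain ⟨c, hc⟩ := h
  have h1 : IsCoprime (m : ℤ) p :=
    Nat.isCoprime_iff_coprime.mpr ((hp.coprime_iff_not_dvd.mpr hm).symm)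
  obtain ⟨u, v, huv⟩ := h1
  refine ⟨u * c, ?_⟩
  calc x = (1 : ℤ) • x - v • (p • x) := by simp [hx]
    _ = (u * m) • x := by rw [← huv, add_zsmul, mul_zsmul x v, natCast_zsmul, add_sub_cancel_right]
    _ = (u * c) • y := by rw [mul_zsmul, natCast_zsmul, hc, ← mul_zsmul]

/-- If `p ∤ m`, the relation `m a_m = C(N-1, m-1) a_1` can be solved for `a m`, so `g = 1` serves
for such `m`. If `p ∤ N`, symmetry replaces a multiple `m` of `p` by `N - m`. If `N = p`, there are
no multiples. If `N = pM` with `M ≥ 2`, then `a 1 = 0`, and by Lucas's congruence `m ↦ a (p m)` is a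
cocycle for `M`, so induction on `N` applies. -/
theorem IsCocycle.exists_generator {p : ℕ} (hp : p.Prime) {A : Type*} [AddCommGroup A] :
    ∀ (N : ℕ) (a : ℕ → A), 2 ≤ N → IsCocycle N a → (∀ m, 0 < m → m < N → p • a m = 0) →
    ∃ g, 0 < g ∧ g < N ∧ ∀ m, 0 < m → m < N → ∃ c : ℤ, a m = c • a g := by
  have := Fact.mk hp
  intro N
  induction N using Nat.strong_induction_on with
  | _ N ih =>
  intro a hN ha hpa
  have base : ∀ m, 0 < m → m < N → ¬ p ∣ m → ∃ c : ℤ, a m = c • a 1 := by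
    intro m h0 hm hpm
    rcases (Nat.succ_le_of_lt h0).eq_or_lt with rfl | h1
    · exact ⟨1, by simp⟩
    · refine exists_zsmul_of_nsmul_eq hp (hpa m h0 hm) hpm ⟨(N - 1).choose (m - 1), ?_⟩
      have := ha.rel 1 m one_pos h1 hm
      rw [Nat.choose_one_right] at this
      rw [this, natCast_zsmul]
  by_cases hpN : p ∣ N
  · obtain ⟨M, rfl⟩ := hpN
    have hp2 := hp.two_le
    rcases (show M = 0 ∨ M = 1 ∨ 2 ≤ M by omega) with rfl | rfl | hM
    · simp at hN
    · refine ⟨1, one_pos, by omega, fun m h0 hm => base m h0 hm fun h => ?_⟩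
      have := Nat.le_of_dvd h0 h
      omega
    · have hpM : p < p * M := by nlinarith
      -- The relation for `i = 1`, `m = p`: its left side is `p • a p = 0`, and `C(pM - 1, p - 1) ≡
      -- 1` modulo `p`.
      have h1 : a 1 = 0 := by
        have h := ha.rel 1 p one_pos (by omega) hpM
        rw [Nat.choose_one_right, hpa p hp.pos hpM] at h
        have hl := Choose.choose_modEq_choose_mod_mul_choose_div_nat (n := p * M - 1)
          (k := p - 1) (p := p)
        have e1 : p * M - 1 = (p - 1) + p * (M - 1) := by
          obtain ⟨M, rfl⟩ := Nat.exists_eq_add_of_le hM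
          obtain ⟨p, rfl⟩ := Nat.exists_eq_add_of_le hp2
          simp only [show 2 + M - 1 = 1 + M by omega, show 2 + p - 1 = 1 + p by omega]
          rw [Nat.sub_eq_iff_eq_add (by nlinarith)]
          ring
        have e2 : (p * M - 1) % p = p - 1 := by
          rw [e1, Nat.add_mul_mod_self_left, Nat.mod_eq_of_lt (by omega)]
        rw [e2, Nat.div_eq_of_lt (show p - 1 < p by omega),
          Nat.mod_eq_of_lt (show p - 1 < p by omega), Nat.choose_self, Nat.choose_zero_right,
          one_mul] at hl
        rw [nsmul_eq_of_modEq (hpa 1 one_pos (by omega)) hl, one_nsmul] at h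
        exact h.symm
      have key : ∀ {k l : ℕ}, (p * k).choose (p * l) ≡ k.choose l [MOD p] := by
        intro k l
        have := Choose.choose_modEq_choose_mod_mul_choose_div_nat (n := p * k)
          (k := p * l) (p := p)
        simpa [hp.pos] using this
      have hlt : ∀ {m}, m < M → p * m < p * M := fun h => (Nat.mul_lt_mul_left hp.pos).mpr h
      have hco : IsCocycle M fun m => a (p * m) := by
        refine ⟨fun i m h0 him hm => ?_, fun i h0 hi => ?_⟩
        · have hi' : p * i < p * m := (Nat.mul_lt_mul_left hp.pos).mpr him
          have := ha.rel (p * i) (p * m) (Nat.mul_pos hp.pos h0) hi' (hlt hm)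
          rw [← Nat.mul_sub, ← Nat.mul_sub,
            nsmul_eq_of_modEq (hpa _ (Nat.mul_pos hp.pos (h0.trans him)) (hlt hm)) key,
            nsmul_eq_of_modEq (hpa _ (Nat.mul_pos hp.pos h0) (hlt (him.trans hm))) key] at this
          exact this
        · have := ha.symm (p * i) (Nat.mul_pos hp.pos h0) (hlt hi)
          rwa [← Nat.mul_sub] at this
      obtain ⟨g, hg0, hg, h⟩ := ih M (by nlinarith) _ hM hco
        (fun m h0 hm => hpa _ (Nat.mul_pos hp.pos h0) (hlt hm))
      refine ⟨p * g, Nat.mul_pos hp.pos hg0, hlt hg, fun m h0 hm => ?_⟩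
      by_cases hpm : p ∣ m
      · obtain ⟨m, rfl⟩ := hpm
        exact h m (Nat.pos_of_mul_pos_left h0) (lt_of_mul_lt_mul_left hm (Nat.zero_le p))
      · obtain ⟨c, hc⟩ := base m h0 hm hpm
        exact ⟨0, by rw [hc, h1]; simp⟩
  · refine ⟨1, one_pos, by omega, fun m h0 hm => ?_⟩
    by_cases hpm : p ∣ m
    · rw [ha.symm m h0 hm]
      refine base _ (by omega) (by omega) fun h => hpN ?_
      have := dvd_add h hpm
      rwa [Nat.sub_add_cancel hm.le] at this
    · exact base m h0 hm hpm

theorem IsCocycle.map {A B : Type*} [AddCommGroup A] [AddCommGroup B] (f : A →+ B) {N : ℕ}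
    {a : ℕ → A} (ha : IsCocycle N a) : IsCocycle N fun m => f (a m) :=
  ⟨fun i m h0 h1 h2 => by rw [← map_nsmul, ha.rel i m h0 h1 h2, map_nsmul],
    fun i h0 h1 => by rw [ha.symm i h0 h1]⟩

theorem IsCocycle.prod {A B : Type*} [AddCommGroup A] [AddCommGroup B] {N : ℕ}
    {a : ℕ → A} {b : ℕ → B} (ha : IsCocycle N a) (hb : IsCocycle N b) :
    IsCocycle N fun m => (a m, b m) :=
  ⟨fun i m h0 h1 h2 => by simp [ha.rel i m h0 h1 h2, hb.rel i m h0 h1 h2],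
    fun i h0 h1 => by rw [ha.symm i h0 h1, hb.symm i h0 h1]⟩

/-! ### The binomial cocycle and the Bézout functional -/

/-- The greatest common divisor of the binomial coefficients `N.choose m` for `0 < m < N`. -/
def chooseGcd (N : ℕ) : ℕ := (Finset.Ioo 0 N).gcd fun m => N.choose m

theorem chooseGcd_dvd {N m : ℕ} (h0 : 0 < m) (h : m < N) : chooseGcd N ∣ N.choose m :=
  Finset.gcd_dvd (Finset.mem_Ioo.mpr ⟨h0, h⟩)

theorem chooseGcd_ne_zero {N : ℕ} (hN : 2 ≤ N) : chooseGcd N ≠ 0 := by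
  intro h
  have := chooseGcd_dvd one_pos (show 1 < N by omega)
  rw [h, zero_dvd_iff, Nat.choose_one_right] at this
  omega

/-- These are the coefficients of `((u + v)^N - u^N - v^N) / chooseGcd N`; the relation is `C(N,m)
C(m,i) = C(N,i) C(N-i,m-i)`. -/
theorem isCocycle_choose (N : ℕ) : IsCocycle N fun m => ((N.choose m / chooseGcd N : ℕ) : ℤ) := by
  refine ⟨fun i m h0 h1 h2 => ?_, fun i h0 h1 => ?_⟩
  · rw [nsmul_eq_mul, nsmul_eq_mul]
    norm_cast
    rw [← Nat.mul_div_assoc _ (chooseGcd_dvd (h0.trans h1) h2),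
      ← Nat.mul_div_assoc _ (chooseGcd_dvd h0 (h1.trans h2)), mul_comm, Nat.choose_mul h1.le,
      mul_comm]
  · simp only [Nat.choose_symm h1.le]

theorem exists_sum_choose (N : ℕ) : ∃ c : ℕ → ℤ,
    ∑ m ∈ Finset.Ioo 0 N, c m * (N.choose m : ℤ) = chooseGcd N := by
  have h : ∀ s : Finset ℕ, ∃ c : ℕ → ℤ,
      ∑ m ∈ s, c m * (N.choose m : ℤ) = (s.gcd fun m => N.choose m : ℕ) := by
    intro s
    induction s using Finset.cons_induction with
    | empty => exact ⟨0, by simp⟩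
    | cons k s hk ih =>
      obtain ⟨c, hc⟩ := ih
      refine ⟨fun m => if m = k then Nat.gcdA (N.choose k) (s.gcd fun m => N.choose m) else
        Nat.gcdB (N.choose k) (s.gcd fun m => N.choose m) * c m, ?_⟩
      have e : ∀ m ∈ s, (if m = k then Nat.gcdA (N.choose k) (s.gcd fun m => N.choose m) else
          Nat.gcdB (N.choose k) (s.gcd fun m => N.choose m) * c m) * (N.choose m : ℤ) =
          Nat.gcdB (N.choose k) (s.gcd fun m => N.choose m) * (c m * (N.choose m : ℤ)) := by
        intro m hm
        rw [if_neg (by rintro rfl; exact hk hm), mul_assoc]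
      rw [Finset.sum_cons, Finset.sum_congr rfl e, ← Finset.mul_sum, hc]
      simp only [if_true, Finset.cons_eq_insert, Finset.gcd_insert]
      rw [show GCDMonoid.gcd (N.choose k) (s.gcd fun m => N.choose m) =
        Nat.gcd (N.choose k) (s.gcd fun m => N.choose m) from rfl, Nat.gcd_eq_gcd_ab]
      ring
  exact h _

/-- Integers `c m`, for `0 < m < N`, with `∑ c m * N.choose m` the greatest common divisor of the
`N.choose m`. -/
def bezoutChoose (N : ℕ) : ℕ → ℤ := (exists_sum_choose N).choose

theorem sum_bezoutChoose (N : ℕ) :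
    ∑ m ∈ Finset.Ioo 0 N, bezoutChoose N m * (N.choose m : ℤ) = chooseGcd N :=
  (exists_sum_choose N).choose_spec

theorem sum_bezoutChoose_div {N : ℕ} (hN : 2 ≤ N) :
    ∑ m ∈ Finset.Ioo 0 N, bezoutChoose N m * ((N.choose m / chooseGcd N : ℕ) : ℤ) = 1 := by
  have h0 : (chooseGcd N : ℤ) ≠ 0 := by exact_mod_cast chooseGcd_ne_zero hN
  refine mul_right_cancel₀ h0 ?_
  rw [one_mul, Finset.sum_mul]
  refine Eq.trans ?_ (sum_bezoutChoose N)
  refine Finset.sum_congr rfl fun m hm => ?_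
  rw [Finset.mem_Ioo] at hm
  rw [mul_assoc]
  congr 1
  exact_mod_cast Nat.div_mul_cancel (chooseGcd_dvd hm.1 hm.2)

/-- Let `H` be the subgroup generated by the values. It satisfies `H = pH` for every prime `p`,
hence `H = TH` for every `T > 0`, while the relations with `a 1` provide a single `T > 0` killing
`H`. So `H = 0`. -/
theorem IsCocycle.eq_zero {A : Type*} [AddCommGroup A] {N : ℕ} (hN : 2 ≤ N) {a : ℕ → A}
    (ha : IsCocycle N a) (h : ∑ m ∈ Finset.Ioo 0 N, bezoutChoose N m • a m = 0) {m : ℕ}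
    (h0 : 0 < m) (hm : m < N) : a m = 0 := by
  -- every element of the subgroup generated by the `a m` is divisible by every prime
  set H : AddSubgroup A := AddSubgroup.closure (a '' Set.Ioo 0 N) with hH
  have hmem : ∀ k, 0 < k → k < N → a k ∈ H := fun k h0 hk =>
    AddSubgroup.subset_closure ⟨k, ⟨h0, hk⟩, rfl⟩
  have hprime : ∀ p : ℕ, p.Prime → H ≤ H.map (nsmulAddMonoidHom p) := by
    intro p hp
    have := Fact.mk hp
    rw [hH, AddSubgroup.closure_le]
    rintro _ ⟨k, ⟨hk0, hk⟩, rfl⟩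
    set K := H.map (nsmulAddMonoidHom (α := A) p) with hK
    rw [SetLike.mem_coe, ← QuotientAddGroup.eq_zero_iff]
    have hpa : ∀ k, 0 < k → k < N → p • (QuotientAddGroup.mk' K (a k)) = 0 := by
      intro k hk0 hk
      rw [← map_nsmul]
      exact (QuotientAddGroup.eq_zero_iff _).mpr ⟨a k, hmem k hk0 hk, rfl⟩
    -- Pairing `a` modulo `pH` with the binomial cocycle modulo `p` makes the same integers `c m`
    -- express both through their values at `g`. The Bézout sum `s` of the `c m` then kills `x`, but
    -- is invertible modulo `p` because the binomial cocycle has Bézout sum 1. Hence `x = 0`.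
    obtain ⟨g, hg0, hg, hgen⟩ := IsCocycle.exists_generator hp N _ hN
      ((ha.map (QuotientAddGroup.mk' K)).prod ((isCocycle_choose N).map (Int.castAddHom (ZMod p))))
      (fun m h0 hm => by rw [Prod.smul_mk, hpa m h0 hm]; simp)
    choose! c hc using hgen
    set x := QuotientAddGroup.mk' K (a g) with hx
    set b : ℤ := ((N.choose g / chooseGcd N : ℕ) : ℤ) with hb
    set s : ℤ := ∑ m ∈ Finset.Ioo 0 N, bezoutChoose N m * c m with hs
    have h1 : s • x = 0 := by
      have := congrArg (QuotientAddGroup.mk' K) h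
      rw [map_zero, map_sum] at this
      rw [← this, hs, Finset.sum_smul]
      refine Finset.sum_congr rfl fun m hm => ?_
      rw [Finset.mem_Ioo] at hm
      rw [map_zsmul, mul_zsmul]
      congr 1
      exact (congrArg Prod.fst (hc m hm.1 hm.2)).symm
    have h2 : ((s * b : ℤ) : ZMod p) = 1 := by
      have := congrArg (Int.cast : ℤ → ZMod p) (sum_bezoutChoose_div hN)
      rw [Int.cast_one] at this
      rw [← this, hs, Finset.sum_mul, Int.cast_sum, Int.cast_sum]
      refine Finset.sum_congr rfl fun m hm => ?_
      rw [Finset.mem_Ioo] at hm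
      have := congrArg Prod.snd (hc m hm.1 hm.2)
      simp only [Int.coe_castAddHom, Prod.smul_mk, zsmul_eq_mul] at this
      rw [Int.cast_mul (bezoutChoose N m) (_ : ℤ), this, Int.cast_mul, Int.cast_mul, mul_assoc]
    have h3 : x = 0 := by
      rw [← Int.cast_one, ZMod.intCast_eq_intCast_iff, Int.modEq_iff_dvd] at h2
      obtain ⟨t, ht⟩ := h2
      have : x = (b * s + t * p) • x := by
        rw [show b * s + t * p = 1 by linarith, one_zsmul]
      rw [this, add_zsmul, mul_zsmul, h1, mul_zsmul, natCast_zsmul x p, hpa g hg0 hg, zsmul_zero,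
        zsmul_zero, add_zero]
    have := congrArg Prod.fst (hc k hk0 hk)
    simpa [← hx, h3] using this
  have hall : ∀ T : ℕ, 0 < T → H ≤ H.map (nsmulAddMonoidHom T) := by
    intro T
    induction T using Nat.recOnMul with
    | zero => simp
    | one =>
      intro _ x hx
      exact ⟨x, hx, by simp⟩
    | prime p hp => exact fun _ => hprime p hp
    | mul S T hS hT =>
      intro hST x hx
      obtain ⟨y, hy, rfl⟩ := hS (Nat.pos_of_mul_pos_right hST) hx
      obtain ⟨z, hz, rfl⟩ := hT (Nat.pos_of_mul_pos_left hST) hy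
      exact ⟨z, hz, by simp [mul_nsmul']⟩
  -- and the subgroup has bounded exponent
  have h1 : ∀ k, 0 < k → k < N → N.factorial • a k = ((N - 1).factorial * N.choose k) • a 1 := by
    intro k hk0 hk
    have e : k • a k = (N - 1).choose (k - 1) • a 1 := by
      rcases (Nat.succ_le_of_lt hk0).eq_or_lt with rfl | h1
      · simp
      · have := ha.rel 1 k one_pos h1 hk
        rwa [Nat.choose_one_right] at this
    obtain ⟨u, hu⟩ := Nat.dvd_factorial hk0 (show k ≤ N - 1 by omega)
    have hN1 : N.factorial = N * u * k := by
      rw [← Nat.mul_factorial_pred (by omega), hu]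
      ring
    have hN2 : N * (N - 1).choose (k - 1) = N.choose k * k := by
      obtain ⟨M, rfl⟩ := Nat.exists_eq_add_of_le' (show 1 ≤ N by omega)
      obtain ⟨k, rfl⟩ := Nat.exists_eq_add_of_le' (show 1 ≤ k by omega)
      exact Nat.add_one_mul_choose_eq M k
    rw [hN1, mul_nsmul', e, ← mul_nsmul', hu]
    congr 1
    linear_combination u * hN2
  -- `N!` times the vanishing Bézout sum, rewritten in terms of `a 1` by `h1`.
  have h2 : ((N - 1).factorial * chooseGcd N) • a 1 = 0 := by
    have := congrArg (fun x => N.factorial • x) h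
    simp only [Finset.smul_sum, nsmul_zero] at this
    rw [← this, ← natCast_zsmul, Nat.cast_mul, ← sum_bezoutChoose N, Finset.mul_sum,
      Finset.sum_smul]
    refine Finset.sum_congr rfl fun k hk => ?_
    rw [Finset.mem_Ioo] at hk
    rw [smul_comm, h1 k hk.1 hk.2, ← natCast_zsmul, ← mul_zsmul]
    congr 1
    push_cast
    ring
  set T := N.factorial * ((N - 1).factorial * chooseGcd N) with hT
  have hT0 : 0 < T := Nat.mul_pos N.factorial_pos
    (Nat.mul_pos (Nat.factorial_pos _) (Nat.pos_of_ne_zero (chooseGcd_ne_zero hN)))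
  have h3 : ∀ x ∈ H, T • x = 0 := by
    intro x hx
    induction hx using AddSubgroup.closure_induction with
    | mem x hx =>
      obtain ⟨k, ⟨hk0, hk⟩, rfl⟩ := hx
      rw [hT, mul_comm, mul_nsmul', h1 k hk0 hk, ← mul_nsmul', show ((N - 1).factorial *
        chooseGcd N * ((N - 1).factorial * N.choose k)) = ((N - 1).factorial * N.choose k) *
        ((N - 1).factorial * chooseGcd N) by ring, mul_nsmul', h2, nsmul_zero]
    | zero => simp
    | add x y _ _ hx hy => rw [nsmul_add, hx, hy, add_zero]
    | neg x _ hx => rw [smul_neg, hx, neg_zero]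
  obtain ⟨y, hy, hy'⟩ := hall T hT0 (hmem m h0 hm)
  rw [← hy']
  exact h3 y hy

/-- Every cocycle is a multiple of the cocycle `N.choose m / chooseGcd N`; in particular its values
are multiples of `∑ m, bezoutChoose N m • a m`. -/
theorem IsCocycle.mem_zmultiples {A : Type*} [AddCommGroup A] {N : ℕ} (hN : 2 ≤ N) {a : ℕ → A}
    (ha : IsCocycle N a) {m : ℕ} (h0 : 0 < m) (hm : m < N) :
    a m ∈ AddSubgroup.zmultiples (∑ m ∈ Finset.Ioo 0 N, bezoutChoose N m • a m) := by
  set K := AddSubgroup.zmultiples (∑ m ∈ Finset.Ioo 0 N, bezoutChoose N m • a m) with hK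
  rw [← QuotientAddGroup.eq_zero_iff]
  refine (ha.map (QuotientAddGroup.mk' K)).eq_zero hN ?_ h0 hm
  simp_rw [← map_zsmul]
  rw [← map_sum]
  exact (QuotientAddGroup.eq_zero_iff _).mpr (AddSubgroup.mem_zmultiples _)

/-! ### Coefficients of powers of a formal group law -/

/-- The exponent of `u ^ i * v ^ j`. -/
def pair (i j : ℕ) : Fin 2 →₀ ℕ := Finsupp.single 0 i + Finsupp.single 1 j

@[simp] theorem pair_zero (i j : ℕ) : pair i j 0 = i := by simp [pair]

@[simp] theorem pair_one (i j : ℕ) : pair i j 1 = j := by simp [pair]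

theorem pair_eta (d : Fin 2 →₀ ℕ) : pair (d 0) (d 1) = d := by
  ext i; fin_cases i <;> simp

@[simp] theorem degree_pair (i j : ℕ) : (pair i j).degree = i + j := by
  simp [pair, map_add]

theorem coeff_X_zero_pow_mul_X_one_pow {R : Type*} [CommRing R] (i j k l : ℕ) :
    coeff (pair i j) ((X 0 : MvPowerSeries (Fin 2) R) ^ k * X 1 ^ l) =
      if k = i ∧ l = j then 1 else 0 := by
  rw [X_pow_eq, X_pow_eq, monomial_mul_monomial, mul_one, coeff_monomial]
  refine if_congr ?_ rfl rfl
  constructor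
  · intro h
    have h0 := DFunLike.congr_fun h 0
    have h1 := DFunLike.congr_fun h 1
    simp at h0 h1
    exact ⟨h0.symm, h1.symm⟩
  · rintro ⟨rfl, rfl⟩
    rfl

section Lowest

variable {R : Type*} [CommRing R] (F : FormalGroup R)

theorem two_le_order_formalGroup_sub :
    2 ≤ (F.toPowerSeries - (X 0 + X 1)).order := by
  refine le_order fun d hd => ?_
  have hd' : d.degree < 2 := by exact_mod_cast hd
  rw [Finsupp.degree_eq_sum, Fin.sum_univ_two] at hd'
  have hd3 : d = 0 ∨ d = Finsupp.single 0 1 ∨ d = Finsupp.single 1 1 := by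
    have : (d 0 = 0 ∧ d 1 = 0) ∨ (d 0 = 1 ∧ d 1 = 0) ∨ (d 0 = 0 ∧ d 1 = 1) := by omega
    rcases this with h | h | h
    · left; ext i; fin_cases i <;> simp [h.1, h.2]
    · right; left; ext i; fin_cases i <;> simp [h.1, h.2]
    · right; right; ext i; fin_cases i <;> simp [h.1, h.2]
  rcases hd3 with rfl | rfl | rfl
  · simp [F.zero_constantCoeff]
  · simp [F.lin_coeff_X, coeff_X, Finsupp.single_left_inj]
  · simp [F.lin_coeff_Y, coeff_X, Finsupp.single_left_inj]

theorem le_order_formalGroup_pow (m : ℕ) : (m : ℕ∞) ≤ (F.toPowerSeries ^ m).order :=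
  le_order_pow_of_constantCoeff_eq_zero m F.zero_constantCoeff

/-- Only the leading form `(u + v)^m` of `F^m` enters the linearised associativity relation; this is
where its binomial coefficients come from. -/
theorem le_order_formalGroup_pow_sub (m : ℕ) :
    ((m + 1 : ℕ) : ℕ∞) ≤ (F.toPowerSeries ^ m - (X 0 + X 1) ^ m).order := by
  induction m with
  | zero => simp
  | succ m ih =>
    have e : F.toPowerSeries ^ (m + 1) - (X 0 + X 1) ^ (m + 1) =
        F.toPowerSeries ^ m * (F.toPowerSeries - (X 0 + X 1)) +
          (F.toPowerSeries ^ m - (X 0 + X 1) ^ m) * (X 0 + X 1) := by ring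
    have h1 : 1 ≤ (X 0 + X 1 : MvPowerSeries (Fin 2) R).order :=
      one_le_order_iff_constCoeff_eq_zero.mpr (by simp)
    rw [e]
    refine le_trans (le_min ?_ ?_) min_order_le_add
    · refine le_trans ?_ le_order_mul
      refine le_trans ?_ (add_le_add (le_order_formalGroup_pow F m) (two_le_order_formalGroup_sub F))
      norm_cast
    · refine le_trans ?_ le_order_mul
      refine le_trans ?_ (add_le_add ih h1)
      norm_cast

theorem coeff_formalGroup_pow_self (i j : ℕ) :
    coeff (pair i j) (F.toPowerSeries ^ (i + j)) = ((i + j).choose i : R) := by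
  have h1 : coeff (pair i j) (F.toPowerSeries ^ (i + j) - (X 0 + X 1) ^ (i + j)) = 0 := by
    refine coeff_of_lt_order (lt_of_lt_of_le ?_ (le_order_formalGroup_pow_sub F (i + j)))
    rw [degree_pair]
    norm_cast
    omega
  rw [map_sub, sub_eq_zero] at h1
  rw [h1, add_pow, map_sum, Finset.sum_eq_single i]
  · rw [Nat.add_sub_cancel_left, ← nsmul_eq_mul', map_nsmul, coeff_X_zero_pow_mul_X_one_pow]
    simp
  · intro k _ hk
    rw [← nsmul_eq_mul', map_nsmul, coeff_X_zero_pow_mul_X_one_pow, if_neg (fun h => hk h.1),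
      smul_zero]
  · intro h
    exact absurd (Finset.mem_range.mpr (by omega)) h

theorem coeff_formalGroup_pow_of_lt {d : Fin 2 →₀ ℕ} {m : ℕ} (h : d.degree < m) :
    coeff d (F.toPowerSeries ^ m) = 0 :=
  coeff_of_lt_order (lt_of_lt_of_le (by exact_mod_cast h) (le_order_formalGroup_pow F m))

theorem coeff_mem_pow {σ : Type*} (S : Subring R) {N : ℕ} {f : MvPowerSeries σ R}
    (hf : ∀ d, d.degree < N → coeff d f ∈ S) (m : ℕ) : ∀ d, d.degree < N → coeff d (f ^ m) ∈ S := by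
  classical
  induction m with
  | zero =>
    intro d _
    rw [pow_zero, coeff_one]
    split_ifs
    · exact S.one_mem
    · exact S.zero_mem
  | succ m ih =>
    intro d hd
    rw [pow_succ, coeff_mul]
    refine S.sum_mem fun p hp => ?_
    rw [Finset.HasAntidiagonal.mem_antidiagonal] at hp
    have : p.1.degree + p.2.degree = d.degree := by rw [← hp, map_add]
    exact S.mul_mem (ih _ (by omega)) (hf _ (by omega))

theorem coeff_rename_mul_X_pow {σ τ : Type*} [Finite σ] (v : σ ↪ τ) {c : τ} (hc : c ∉ Set.range v)
    (P : MvPowerSeries σ R) (d : σ →₀ ℕ) (k l : ℕ) :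
    coeff (d.embDomain v + Finsupp.single c k) (rename v P * X c ^ l) =
      if l = k then coeff d P else 0 := by
  classical
  have h0 : ∀ d : σ →₀ ℕ, d.embDomain v c = 0 := fun d => Finsupp.embDomain_of_notMem_range _ _ _ hc
  rw [X_pow_eq, coeff_mul_monomial]
  split_ifs with h1 h2 h2
  · rw [h2, add_tsub_cancel_right, coeff_embDomain_rename, mul_one]
  · rw [coeff_rename_eq_zero, zero_mul]
    rintro ⟨d', hd'⟩
    have e1 := DFunLike.congr_fun hd' c
    have e2 := h1 c
    rw [← Finsupp.embDomain_eq_mapDomain, h0] at e1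
    simp [h0] at e1 e2
    omega
  · subst h2
    exact absurd le_add_self h1
  · rfl

/-- The coefficients of `F(F(x_a, x_b), x_c)` modulo the lower coefficients of `F`. -/
theorem coeff_formalSum_formalSum_sub_mem (S : Subring R) {i j k N : ℕ} (hN : i + j + k = N)
    (hk : 0 < k) (hS : ∀ d, d.degree < N → coeff d F.toPowerSeries ∈ S)
    (v : Fin 2 ↪ Fin 3) {c : Fin 3} (hc : c ∉ Set.range v) :
    coeff ((pair i j).embDomain v + Finsupp.single c k)
      (F.toPowerSeries.subst ![F.toPowerSeries.subst ![(X (v 0) : MvPowerSeries (Fin 3) R),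
        X (v 1)], X c]) -
      (i + j).choose i * coeff (pair (i + j) k) F.toPowerSeries ∈ S := by
  have e : F.toPowerSeries.subst ![(X (v 0) : MvPowerSeries (Fin 3) R), X (v 1)] =
      rename v F.toPowerSeries := by
    rw [rename_eq_subst]
    congr 1
    funext i
    fin_cases i <;> rfl
  have hs : HasSubst ![rename v F.toPowerSeries, (X c : MvPowerSeries (Fin 3) R)] :=
    hasSubst_pair (by rw [constantCoeff_rename, F.zero_constantCoeff]) (by simp)
  set Q := QuotientAddGroup.mk' S.toAddSubgroup with hQ
  have hQ0 : ∀ {x : R}, x ∈ S → Q x = 0 := fun h => (QuotientAddGroup.eq_zero_iff _).mpr h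
  change _ ∈ S.toAddSubgroup
  rw [← QuotientAddGroup.eq_zero_iff]
  change Q _ = 0
  rw [map_sub, sub_eq_zero, e, coeff_subst hs, map_finsum Q (coeff_subst_finite hs _ _),
    finsum_eq_single _ (pair (i + j) k)]
  · rw [Finsupp.prod_fintype _ _ (by simp), Fin.prod_univ_two]
    simp only [Matrix.cons_val_zero, Matrix.cons_val_one, pair_zero, pair_one]
    rw [← map_pow, coeff_rename_mul_X_pow v hc, if_pos rfl, coeff_formalGroup_pow_self, smul_eq_mul,
      mul_comm]
  · intro d hd
    refine hQ0 ?_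
    rw [Finsupp.prod_fintype _ _ (by simp), Fin.prod_univ_two]
    simp only [Matrix.cons_val_zero, Matrix.cons_val_one]
    rw [← map_pow, coeff_rename_mul_X_pow v hc]
    split_ifs with h
    -- If `d 0 < i + j`, both factors are coefficients of degree below `N` (here `0 < k` is used),
    -- so they lie in `S`. If `d 0 > i + j`, the power `F^(d 0)` has no term of degree `i + j`. The
    -- case of equality is the excluded main term.
    · rcases lt_trichotomy (d 0) (i + j) with h1 | h1 | h1
      · refine S.mul_mem (hS _ ?_) (coeff_mem_pow S hS _ _ ?_)
        · rw [← pair_eta d, degree_pair]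
          omega
        · rw [degree_pair]
          omega
      · exact absurd (by rw [← h1, ← h, pair_eta]) hd
      · rw [coeff_formalGroup_pow_of_lt F (by rwa [degree_pair]), smul_zero]
        exact S.zero_mem
    · rw [smul_zero]
      exact S.zero_mem

theorem coeff_pair_comm [F.IsComm] (i j : ℕ) :
    coeff (pair i j) F.toPowerSeries = coeff (pair j i) F.toPowerSeries := by
  have h := FormalGroup.IsComm.comm (F := F)
  have e : F.toPowerSeries.subst ![(X 1 : MvPowerSeries (Fin 2) R), X 0] =
      rename (Equiv.swap (0 : Fin 2) 1).toEmbedding F.toPowerSeries := by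
    rw [rename_eq_subst]
    congr 1
    funext i
    fin_cases i <;> simp
  rw [e] at h
  rw [← coeff_embDomain_rename (Equiv.swap (0 : Fin 2) 1).toEmbedding, ← h]
  congr 2
  rw [pair, pair, Finsupp.embDomain_eq_mapDomain, Finsupp.mapDomain_add]
  simp [Finsupp.mapDomain_single, add_comm]

/-- Modulo the lower coefficients, the coefficients of a given degree of a commutative formal group
law form a cocycle. -/
theorem isCocycle_coeff [F.IsComm] (S : Subring R) {N : ℕ}
    (hS : ∀ d, d.degree < N → coeff d F.toPowerSeries ∈ S) :
    IsCocycle N fun m =>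
      QuotientAddGroup.mk' S.toAddSubgroup (coeff (pair m (N - m)) F.toPowerSeries) := by
  refine ⟨fun i m h0 h1 h2 => ?_, fun i h0 h1 => ?_⟩
  · obtain ⟨j, rfl⟩ := Nat.exists_eq_add_of_le h1.le
    obtain ⟨k, rfl⟩ := Nat.exists_eq_add_of_le h2.le
    -- By associativity and commutativity `F(F(x_0, x_1), x_2) = F(F(x_1, x_2), x_0)`. Both sides
    -- are nested on the left, so a single computation gives the coefficient of `x_0^i x_1^j x_2^k`
    -- in each.
    set v : Fin 2 ↪ Fin 3 := ⟨![0, 1], by decide⟩ with hv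
    set v' : Fin 2 ↪ Fin 3 := ⟨![1, 2], by decide⟩ with hv'
    have hc : (2 : Fin 3) ∉ Set.range v := by rintro ⟨x, hx⟩; revert hx; fin_cases x <;> decide
    have hc' : (0 : Fin 3) ∉ Set.range v' := by rintro ⟨x, hx⟩; revert hx; fin_cases x <;> decide
    have r1 := coeff_formalSum_formalSum_sub_mem F S (i := i) (j := j) (k := k) rfl
      (by omega) hS v hc
    have r2 := coeff_formalSum_formalSum_sub_mem F S (i := j) (j := k) (k := i)
      (N := i + j + k) (by ring) h0 hS v' hc'
    have ee : (pair i j).embDomain v + Finsupp.single 2 k =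
        (pair j k).embDomain v' + Finsupp.single 0 i := by
      rw [pair, pair, Finsupp.embDomain_eq_mapDomain, Finsupp.embDomain_eq_mapDomain,
        Finsupp.mapDomain_add, Finsupp.mapDomain_add]
      simp only [Finsupp.mapDomain_single]
      change Finsupp.single (0 : Fin 3) i + Finsupp.single 1 j + Finsupp.single 2 k =
        Finsupp.single 1 j + Finsupp.single 2 k + Finsupp.single 0 i
      abel
    have es : F.toPowerSeries.subst ![F.toPowerSeries.subst
          ![(X (v' 0) : MvPowerSeries (Fin 3) R), X (v' 1)], X 0] =
        F.toPowerSeries.subst ![F.toPowerSeries.subst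
          ![(X (v 0) : MvPowerSeries (Fin 3) R), X (v 1)], X 2] := by
      have hX : ∀ s : Fin 3, PowerSeries.HasSubst (X s : MvPowerSeries (Fin 3) R) := fun s => by
        simp [PowerSeries.HasSubst]
      change F.toPowerSeries.subst ![F.toPowerSeries.subst
          ![(X 1 : MvPowerSeries (Fin 3) R), X 2], X 0] =
        F.toPowerSeries.subst ![F.toPowerSeries.subst
          ![(X 0 : MvPowerSeries (Fin 3) R), X 1], X 2]
      rw [F.assoc, F.comm' _ (hX 0)]
      rw [PowerSeries.HasSubst, constantCoeff_formalSum F (by simp) (by simp)]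
      exact IsNilpotent.zero
    rw [ee, ← es] at r1
    have r := S.sub_mem r2 r1
    have r' : ((i + j).choose i * coeff (pair (i + j) k) F.toPowerSeries) -
      ((j + k).choose j * coeff (pair (j + k) i) F.toPowerSeries) ∈ S := by
      convert r using 1
      ring
    have r'' := (QuotientAddGroup.eq_zero_iff (N := S.toAddSubgroup) _).mpr r'
    rw [QuotientAddGroup.mk_sub, sub_eq_zero, ← nsmul_eq_mul, ← nsmul_eq_mul, coeff_pair_comm F (j + k) i]
      at r''
    rw [← map_nsmul, ← map_nsmul]
    have t1 : i + j + k - (i + j) = k := by omega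
    have t2 : i + j + k - i = j + k := by omega
    have t3 : i + j - i = j := by omega
    rw [t1, t2, t3]
    exact r''
  · simp only [Nat.sub_sub_self h1.le]
    rw [coeff_pair_comm]

end Lowest

/-! ### Generators of the Lazard ring -/

/-- The generator of degree `N - 1` of the Lazard ring. -/
def lazardGen {R : Type*} [CommRing R] (F : MvPowerSeries (Fin 2) R) (N : ℕ) : R :=
  ∑ m ∈ Finset.Ioo 0 N, bezoutChoose N m • coeff (pair m (N - m)) F

/-- The presentation of the Lazard ring as a polynomial ring. -/
def lazardPresentation : MvPolynomial ℕ ℤ →+* LazardRing :=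
  (MvPolynomial.aeval fun n => lazardGen universalSeries (n + 2) : _ →ₐ[ℤ] LazardRing).toRingHom

theorem coeff_universalSeries (i j : ℕ) :
    coeff (pair i j) universalSeries = lazardMk (if i = 0 then (if j = 1 then 1 else 0)
      else if j = 0 then (if i = 1 then 1 else 0) else MvPolynomial.X (i - 1, j - 1)) := by
  rw [universalSeries, coeff_map]
  simp [coeff_apply, genericSeries]

/-- Induction on the degree. Modulo the range, the coefficients of degree `N` form a cocycle; its
Bézout sum is the image of a variable, so it is zero in the quotient, and a cocycle with zero Bézout
sum vanishes. -/
theorem coeff_universalSeries_mem (N : ℕ) : ∀ d, d.degree < N →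
    coeff d universalFGL.toPowerSeries ∈ lazardPresentation.range := by
  set S := lazardPresentation.range with hS
  induction N with
  | zero => intro d hd; omega
  | succ N ih =>
    intro d hd
    rcases (Nat.lt_succ_iff.mp hd).lt_or_eq with h | h
    · exact ih d h
    · rw [← pair_eta d, degree_pair] at h
      rw [← pair_eta d]
      generalize d 0 = i at *
      generalize d 1 = j at *
      rcases Nat.eq_zero_or_pos i with rfl | hi
      · change coeff _ universalSeries ∈ _
        rw [coeff_universalSeries, if_pos rfl]
        split_ifs
        · rw [map_one]; exact S.one_mem
        · rw [map_zero]; exact S.zero_mem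
      rcases Nat.eq_zero_or_pos j with rfl | hj
      · change coeff _ universalSeries ∈ _
        rw [coeff_universalSeries, if_neg hi.ne', if_pos rfl]
        split_ifs
        · rw [map_one]; exact S.one_mem
        · rw [map_zero]; exact S.zero_mem
      have := (isCocycle_coeff universalFGL S ih).mem_zmultiples (by omega) hi (by omega)
      simp_rw [← map_zsmul (QuotientAddGroup.mk' S.toAddSubgroup)] at this
      rw [← map_sum] at this
      have hx : QuotientAddGroup.mk' S.toAddSubgroup (∑ m ∈ Finset.Ioo 0 N, bezoutChoose N m •
          coeff (pair m (N - m)) universalFGL.toPowerSeries) = 0 := by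
        refine (QuotientAddGroup.eq_zero_iff _).mpr ?_
        refine ⟨MvPolynomial.X (N - 2), ?_⟩
        simp only [lazardPresentation, AlgHom.toRingHom_eq_coe, RingHom.coe_coe,
          MvPolynomial.aeval_X]
        rw [Nat.sub_add_cancel (by omega)]
        rfl
      rw [hx, AddSubgroup.zmultiples_zero_eq_bot, AddSubgroup.mem_bot] at this
      have := (QuotientAddGroup.eq_zero_iff _).mp this
      rwa [show N - i = j by omega] at this

theorem lazardPresentation_surjective : Function.Surjective lazardPresentation := by
  rw [← RingHom.range_eq_top, eq_top_iff]
  rintro x -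
  obtain ⟨p, rfl⟩ : ∃ p, lazardMk p = x := Ideal.Quotient.mk_surjective x
  induction p using MvPolynomial.induction_on with
  | C a =>
    rw [show lazardMk (MvPolynomial.C a) = ((a : ℤ) : LazardRing) from
      RingHom.congr_fun (RingHom.ext_int (lazardMk.comp MvPolynomial.C) (Int.castRingHom _)) a]
    exact intCast_mem _ a
  | add p q hp hq => rw [map_add]; exact add_mem hp hq
  | mul_X p i hp =>
    rw [map_mul]
    refine mul_mem hp ?_
    have := coeff_universalSeries_mem _ (pair (i.1 + 1) (i.2 + 1)) (Nat.lt_succ_self _)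
    change coeff _ universalSeries ∈ _ at this
    rwa [coeff_universalSeries, if_neg (by omega), if_neg (by omega)] at this

/-! ### Formal group laws with a logarithm -/

section Log

variable {R : Type*} [CommRing R]

/-- The logarithm `t + t ^ 2 * h(t)`. -/
def logSeries (h : PowerSeries R) : PowerSeries R := PowerSeries.X + PowerSeries.X ^ 2 * h

theorem constantCoeff_logSeries (h : PowerSeries R) :
    PowerSeries.constantCoeff (logSeries h) = 0 := by simp [logSeries]

theorem coeff_one_logSeries (h : PowerSeries R) : PowerSeries.coeff 1 (logSeries h) = 1 := by
  rw [logSeries, map_add, PowerSeries.coeff_one_X, PowerSeries.coeff_X_pow_mul']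
  simp

theorem coeff_logSeries (h : PowerSeries R) (n : ℕ) :
    PowerSeries.coeff (n + 2) (logSeries h) = PowerSeries.coeff n h := by
  rw [logSeries, map_add, PowerSeries.coeff_X_pow_mul, PowerSeries.coeff_X, if_neg (by omega),
    zero_add]

/-- The inverse of the logarithm. -/
def expSeries (h : PowerSeries R) : PowerSeries R :=
  PowerSeries.substInvOfIsUnit (logSeries h) (by rw [coeff_one_logSeries]; exact isUnit_one)

theorem constantCoeff_expSeries (h : PowerSeries R) :
    PowerSeries.constantCoeff (expSeries h) = 0 :=
  PowerSeries.constantCoeff_substInvOfIsUnit ..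

theorem coeff_one_expSeries (h : PowerSeries R) : PowerSeries.coeff 1 (expSeries h) = 1 := by
  have hu : ∀ hu : IsUnit (PowerSeries.coeff 1 (logSeries h)), ((hu.unit⁻¹ : Rˣ) : R) = 1 := by
    intro hu
    have : hu.unit = 1 := Units.ext (coeff_one_logSeries h)
    simp [this]
  rw [expSeries, PowerSeries.coeff_one_substInvOfIsUnit]
  exact hu _

theorem hasSubst_of_constantCoeff {σ : Type*} {a : MvPowerSeries σ R} (ha : constantCoeff a = 0) :
    PowerSeries.HasSubst a := PowerSeries.HasSubst.of_constantCoeff_zero ha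

theorem expSeries_subst_logSeries {σ : Type*} (h : PowerSeries R) {a : MvPowerSeries σ R}
    (ha : constantCoeff a = 0) : (expSeries h).subst ((logSeries h).subst a) = a := by
  have := PowerSeries.subst_substInvOfIsUnit_left (logSeries h) (constantCoeff_logSeries h)
    (by rw [coeff_one_logSeries]; exact isUnit_one)
  rw [← PowerSeries.subst_comp_subst_apply (PowerSeries.HasSubst.of_constantCoeff_zero'
    (constantCoeff_logSeries h)) (hasSubst_of_constantCoeff ha), expSeries, this,
    PowerSeries.subst_X (hasSubst_of_constantCoeff ha)]

theorem logSeries_subst_expSeries {σ : Type*} (h : PowerSeries R) {a : MvPowerSeries σ R}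
    (ha : constantCoeff a = 0) : (logSeries h).subst ((expSeries h).subst a) = a := by
  have := PowerSeries.subst_substInvOfIsUnit_right (logSeries h) (constantCoeff_logSeries h)
    (by rw [coeff_one_logSeries]; exact isUnit_one)
  rw [← PowerSeries.subst_comp_subst_apply (PowerSeries.HasSubst.of_constantCoeff_zero'
    (constantCoeff_expSeries h)) (hasSubst_of_constantCoeff ha), expSeries, this,
    PowerSeries.subst_X (hasSubst_of_constantCoeff ha)]

/-- The series `exp(log u + log v)`. -/
def logLaw (h : PowerSeries R) : MvPowerSeries (Fin 2) R :=
  (expSeries h).subst ((logSeries h).subst (X 0 : MvPowerSeries (Fin 2) R) +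
    (logSeries h).subst (X 1 : MvPowerSeries (Fin 2) R))

theorem constantCoeff_logSeries_subst {σ : Type*} (h : PowerSeries R) {a : MvPowerSeries σ R}
    (ha : constantCoeff a = 0) : constantCoeff ((logSeries h).subst a) = 0 :=
  PowerSeries.constantCoeff_subst_eq_zero ha _ (constantCoeff_logSeries h)

theorem logLaw_subst {σ : Type*} (h : PowerSeries R) {a b : MvPowerSeries σ R}
    (ha : constantCoeff a = 0) (hb : constantCoeff b = 0) :
    (logLaw h).subst ![a, b] =
      (expSeries h).subst ((logSeries h).subst a + (logSeries h).subst b) := by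
  have hs := hasSubst_pair ha hb
  have hX : ∀ i : Fin 2, constantCoeff (X i : MvPowerSeries (Fin 2) R) = 0 := by simp
  have hl : ∀ i, ((logSeries h).subst (X i : MvPowerSeries (Fin 2) R)).subst ![a, b] =
      (logSeries h).subst (![a, b] i) := by
    intro i
    rw [PowerSeries.subst, subst_comp_subst_apply (hasSubst_of_constantCoeff (hX i)).const hs,
      subst_X hs]
    rfl
  rw [logLaw, PowerSeries.subst, subst_comp_subst_apply (PowerSeries.HasSubst.const
    (hasSubst_of_constantCoeff _)) hs, subst_add hs, hl, hl]
  · rfl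
  · rw [map_add, constantCoeff_logSeries_subst h (hX 0), constantCoeff_logSeries_subst h (hX 1),
      add_zero]

theorem constantCoeff_logLaw (h : PowerSeries R) : constantCoeff (logLaw h) = 0 := by
  refine PowerSeries.constantCoeff_subst_eq_zero ?_ _ (constantCoeff_expSeries h)
  rw [map_add, constantCoeff_logSeries_subst h (by simp), constantCoeff_logSeries_subst h (by simp),
    add_zero]

theorem logSeries_subst_logLaw {σ : Type*} (h : PowerSeries R) {a b : MvPowerSeries σ R}
    (ha : constantCoeff a = 0) (hb : constantCoeff b = 0) :
    (logSeries h).subst ((logLaw h).subst ![a, b]) =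
      (logSeries h).subst a + (logSeries h).subst b := by
  rw [logLaw_subst h ha hb, logSeries_subst_expSeries]
  rw [map_add, constantCoeff_logSeries_subst h ha, constantCoeff_logSeries_subst h hb, add_zero]

theorem subst_X_X (f : MvPowerSeries (Fin 2) R) :
    f.subst ![(X 0 : MvPowerSeries (Fin 2) R), X 1] = f := by
  have : ![(X 0 : MvPowerSeries (Fin 2) R), X 1] = X := by funext i; fin_cases i <;> rfl
  rw [this, subst_self]
  rfl

/-- If `z ≡ z'` up to degree `N` then `f(z) - f(z') ≡ z - z'` one degree further, for a series
`f = t + ⋯`. -/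
theorem le_order_subst_sub_subst {σ : Type*} {f : PowerSeries R} (hf1 : PowerSeries.coeff 1 f = 1)
    {z z' : MvPowerSeries σ R} (hz : constantCoeff z = 0) (hz' : constantCoeff z' = 0) {N : ℕ}
    (h : (N : ℕ∞) ≤ (z - z').order) :
    ((N + 1 : ℕ) : ℕ∞) ≤ (f.subst z - f.subst z' - (z - z')).order := by
  have hp : ∀ n : ℕ, n ≠ 1 → ((N + 1 : ℕ) : ℕ∞) ≤ (z ^ n - z' ^ n).order := by
    intro n
    induction n with
    | zero => simp
    | succ n ih =>
      intro hn
      rcases Nat.eq_zero_or_pos n with rfl | hn0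
      · exact absurd rfl hn
      have e : z ^ (n + 1) - z' ^ (n + 1) = (z - z') * z ^ n + z' * (z ^ n - z' ^ n) := by ring
      have h1 : ((N + 1 : ℕ) : ℕ∞) ≤ ((z - z') * z ^ n).order := by
        refine le_trans ?_ le_order_mul
        push_cast
        refine add_le_add h ?_
        refine le_trans ?_ (le_order_pow_of_constantCoeff_eq_zero n hz)
        exact_mod_cast hn0
      have hz1 : 1 ≤ z'.order := one_le_order_iff_constCoeff_eq_zero.mpr hz'
      have h2 : ((N + 1 : ℕ) : ℕ∞) ≤ (z' * (z ^ n - z' ^ n)).order := by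
        refine le_trans ?_ le_order_mul
        rcases eq_or_ne n 1 with rfl | hn1
        · rw [pow_one, pow_one]
          refine le_trans ?_ (add_le_add hz1 h)
          push_cast
          rw [add_comm]
        · exact (ih hn1).trans le_add_self
      rw [e]
      exact (le_min h1 h2).trans min_order_le_add
  have e : f.subst z - f.subst z' - (z - z') =
      (f - PowerSeries.X).subst z - (f - PowerSeries.X).subst z' := by
    rw [PowerSeries.subst_sub (hasSubst_of_constantCoeff hz),
      PowerSeries.subst_sub (hasSubst_of_constantCoeff hz'),
      PowerSeries.subst_X (hasSubst_of_constantCoeff hz),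
      PowerSeries.subst_X (hasSubst_of_constantCoeff hz')]
    ring
  rw [e]
  refine le_order fun d hd => ?_
  rw [map_sub, sub_eq_zero, PowerSeries.coeff_subst (hasSubst_of_constantCoeff hz),
    PowerSeries.coeff_subst (hasSubst_of_constantCoeff hz')]
  refine finsum_congr fun n => ?_
  rcases eq_or_ne n 1 with rfl | hn
  · rw [map_sub, hf1, PowerSeries.coeff_one_X, sub_self, zero_smul, zero_smul]
  · congr 1
    rw [← sub_eq_zero, ← map_sub]
    exact coeff_of_lt_order (hd.trans_le (hp n hn))

/-- The formal group law with a given logarithm. -/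
def logFormalGroup (h : PowerSeries R) : FormalGroup R where
  toPowerSeries := logLaw h
  zero_constantCoeff := constantCoeff_logLaw h
  lin_coeff_X := by
    have h1 := le_order_subst_sub_subst (coeff_one_expSeries h) (z := (logSeries h).subst
      (X 0 : MvPowerSeries (Fin 2) R) + (logSeries h).subst (X 1 : MvPowerSeries (Fin 2) R))
      (z' := 0) (N := 1) (by
        rw [map_add, constantCoeff_logSeries_subst h (by simp),
          constantCoeff_logSeries_subst h (by simp), add_zero]) (map_zero _) (by
        rw [sub_zero]
        exact one_le_order_iff_constCoeff_eq_zero.mpr (by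
          rw [map_add, constantCoeff_logSeries_subst h (by simp),
          constantCoeff_logSeries_subst h (by simp), add_zero]))
    have h2 := coeff_of_lt_order (d := Finsupp.single (0 : Fin 2) 1)
      (lt_of_lt_of_le (by simp) h1)
    rw [PowerSeries.subst_zero_of_constantCoeff_zero (constantCoeff_expSeries h), sub_zero,
      sub_zero, map_sub, sub_eq_zero, map_add, PowerSeries.coeff_subst_single,
      PowerSeries.coeff_subst_single] at h2
    rw [logLaw, h2]
    simp [coeff_one_logSeries]
  lin_coeff_Y := by
    have h1 := le_order_subst_sub_subst (coeff_one_expSeries h) (z := (logSeries h).subst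
      (X 0 : MvPowerSeries (Fin 2) R) + (logSeries h).subst (X 1 : MvPowerSeries (Fin 2) R))
      (z' := 0) (N := 1) (by
        rw [map_add, constantCoeff_logSeries_subst h (by simp),
          constantCoeff_logSeries_subst h (by simp), add_zero]) (map_zero _) (by
        rw [sub_zero]
        exact one_le_order_iff_constCoeff_eq_zero.mpr (by
          rw [map_add, constantCoeff_logSeries_subst h (by simp),
          constantCoeff_logSeries_subst h (by simp), add_zero]))
    have h2 := coeff_of_lt_order (d := Finsupp.single (1 : Fin 2) 1)
      (lt_of_lt_of_le (by simp) h1)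
    rw [PowerSeries.subst_zero_of_constantCoeff_zero (constantCoeff_expSeries h), sub_zero,
      sub_zero, map_sub, sub_eq_zero, map_add, PowerSeries.coeff_subst_single,
      PowerSeries.coeff_subst_single] at h2
    rw [logLaw, h2]
    simp [coeff_one_logSeries]
  assoc := by
    have hX : ∀ i : Fin 3, constantCoeff (X i : MvPowerSeries (Fin 3) R) = 0 := by simp
    have hF : ∀ i j : Fin 3, constantCoeff
        ((logLaw h).subst ![(X i : MvPowerSeries (Fin 3) R), X j]) = 0 := fun i j =>
      constantCoeff_subst_eq_zero (hasSubst_pair (hX i) (hX j))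
        (fun k => by fin_cases k <;> simp) (constantCoeff_logLaw h)
    rw [logLaw_subst h (hF 0 1) (hX 2), logLaw_subst h (hX 0) (hF 1 2),
      logSeries_subst_logLaw h (hX 0) (hX 1), logSeries_subst_logLaw h (hX 1) (hX 2), add_assoc]

instance (h : PowerSeries R) : (logFormalGroup h).IsComm where
  comm := by
    change logLaw h = (logLaw h).subst ![X 1, X 0]
    rw [logLaw_subst h (by simp) (by simp), add_comm, logLaw]

/-- How the coefficients of a formal group law change when the coefficient of its logarithm in the
same degree does. -/
theorem coeff_logLaw_sub (h h' : PowerSeries R) {n : ℕ}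
    (hh : ∀ k < n, PowerSeries.coeff k h = PowerSeries.coeff k h') {m : ℕ} (h0 : 0 < m)
    (hm : m < n + 2) :
    coeff (pair m (n + 2 - m)) (logLaw h) - coeff (pair m (n + 2 - m)) (logLaw h') =
      (n + 2).choose m • (PowerSeries.coeff n h' - PowerSeries.coeff n h) := by
  set D := logSeries h - logSeries h' with hD
  have hX : ∀ i : Fin 2, constantCoeff (X i : MvPowerSeries (Fin 2) R) = 0 := by simp
  have hDn : ∀ k < n + 2, PowerSeries.coeff k D = 0 := by
    intro k hk
    rw [hD, map_sub, sub_eq_zero]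
    match k with
    | 0 => simp [logSeries]
    | 1 => rw [coeff_one_logSeries, coeff_one_logSeries]
    | k + 2 => rw [coeff_logSeries, coeff_logSeries, hh k (by omega)]
  have hDo : ((n + 2 : ℕ) : ℕ∞) ≤ D.order := PowerSeries.nat_le_order _ _ hDn
  set z := (logSeries h).subst (X 0 : MvPowerSeries (Fin 2) R) +
    (logSeries h).subst (X 1 : MvPowerSeries (Fin 2) R) with hz
  set z' := (logSeries h).subst (logLaw h') with hz'
  have hl0 := constantCoeff_logLaw h'
  -- `exp z` is the law of `h` and `exp z'` that of `h'`, so in the lowest degree the two laws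
  -- differ by `z - z'`. The first two terms on the right involve a single variable. Hence a mixed
  -- monomial of degree `n + 2` sees only `D(F')`, where `F'` is the law of `h'`: the leading
  -- coefficient of `D` times a binomial coefficient.
  have e : z - z' = D.subst (X 0 : MvPowerSeries (Fin 2) R) +
      D.subst (X 1 : MvPowerSeries (Fin 2) R) - D.subst (logLaw h') := by
    have := logSeries_subst_logLaw h' (hX 0) (hX 1)
    rw [subst_X_X] at this
    rw [hD, PowerSeries.subst_sub (hasSubst_of_constantCoeff (hX 0)),
      PowerSeries.subst_sub (hasSubst_of_constantCoeff (hX 1)),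
      PowerSeries.subst_sub (hasSubst_of_constantCoeff hl0), this]
    ring
  have hord : ((n + 2 : ℕ) : ℕ∞) ≤ (z - z').order := by
    rw [e, sub_eq_add_neg]
    refine le_trans (le_min (le_trans (le_min ?_ ?_) min_order_le_add) ?_) min_order_le_add
    · exact hDo.trans (PowerSeries.le_order_subst_left (hX 0))
    · exact hDo.trans (PowerSeries.le_order_subst_left (hX 1))
    · rw [order_neg]
      exact hDo.trans (PowerSeries.le_order_subst_left hl0)
  have key := le_order_subst_sub_subst (coeff_one_expSeries h) (z := z) (z' := z')
    (by rw [hz, map_add, constantCoeff_logSeries_subst h (hX 0),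
      constantCoeff_logSeries_subst h (hX 1), add_zero])
    (constantCoeff_logSeries_subst h hl0) hord
  rw [expSeries_subst_logSeries h hl0] at key
  have h1 := coeff_of_lt_order (d := pair m (n + 2 - m)) (lt_of_lt_of_le (by
    rw [degree_pair]; norm_cast; omega) key)
  rw [map_sub, sub_eq_zero, map_sub, e, map_sub, map_add] at h1
  have hm' : 0 < n + 2 - m := by omega
  have n0 : pair m (n + 2 - m) ≠ Finsupp.single 0 (pair m (n + 2 - m) 0) := fun h => by
    have := DFunLike.congr_fun h 1
    simp at this
    omega
  have n1 : pair m (n + 2 - m) ≠ Finsupp.single 1 (pair m (n + 2 - m) 1) := fun h => by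
    have := DFunLike.congr_fun h 0
    simp at this
    omega
  rw [PowerSeries.coeff_subst_single, PowerSeries.coeff_subst_single, if_neg n0, if_neg n1,
    PowerSeries.coeff_subst (hasSubst_of_constantCoeff hl0), finsum_eq_single _ (n + 2)] at h1
  · have h2 := coeff_formalGroup_pow_self (logFormalGroup h') m (n + 2 - m)
    rw [Nat.add_sub_cancel' hm.le] at h2
    change coeff _ (logLaw h' ^ (n + 2)) = _ at h2
    change coeff _ (logLaw h) - _ = _ at h1
    rw [h1, h2, hD, map_sub, coeff_logSeries, coeff_logSeries, nsmul_eq_mul, smul_eq_mul]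
    ring
  · intro k hk
    rcases lt_or_gt_of_ne hk with hk | hk
    · rw [hDn k hk, zero_smul]
    · have := coeff_formalGroup_pow_of_lt (logFormalGroup h') (d := pair m (n + 2 - m)) (m := k)
        (by rw [degree_pair]; omega)
      change coeff _ (logLaw h' ^ k) = _ at this
      rw [this, smul_zero]

end Log

/-! ### The universal property and the structure of the Lazard ring -/

section Classify

variable {R : Type*} [CommRing R] (F : FormalGroup R)

theorem coeff_formalGroup_zero_left (n : ℕ) :
    coeff (pair 0 n) F.toPowerSeries = if n = 1 then 1 else 0 := by
  have h := congrArg (PowerSeries.coeff n) F.zeroX_eq_X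
  rw [PowerSeries.coeff_X, FormalGroup.zeroX, PowerSeries.coeff, coeff_subst (hasSubst_pair (by simp)
    (by simp [PowerSeries.X])),
    finsum_eq_single _ (pair 0 n)] at h
  · rw [← h, Finsupp.prod_fintype _ _ (by simp), Fin.prod_univ_two]
    change _ = _ • PowerSeries.coeff (R := R) n _
    simp
  · intro d hd
    rw [Finsupp.prod_fintype _ _ (by simp), Fin.prod_univ_two]
    change _ • PowerSeries.coeff (R := R) n _ = _
    by_cases h0 : d 0 = 0
    · have h1 : d 1 ≠ n := fun h1 => hd (by rw [← pair_eta d, h0, h1])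
      simp [h0, PowerSeries.coeff_X_pow, h1.symm]
    · simp [h0]

theorem coeff_formalGroup_zero_right (n : ℕ) :
    coeff (pair n 0) F.toPowerSeries = if n = 1 then 1 else 0 := by
  have h := congrArg (PowerSeries.coeff n) F.Xzero_eq_X
  rw [PowerSeries.coeff_X, FormalGroup.Xzero, PowerSeries.coeff, coeff_subst (hasSubst_pair
    (by simp [PowerSeries.X]) (by simp)),
    finsum_eq_single _ (pair n 0)] at h
  · rw [← h, Finsupp.prod_fintype _ _ (by simp), Fin.prod_univ_two]
    change _ = _ • PowerSeries.coeff (R := R) n _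
    simp
  · intro d hd
    rw [Finsupp.prod_fintype _ _ (by simp), Fin.prod_univ_two]
    change _ • PowerSeries.coeff (R := R) n _ = _
    by_cases h0 : d 1 = 0
    · have h1 : d 0 ≠ n := fun h1 => hd (by rw [← pair_eta d, h0, h1])
      simp [h0, PowerSeries.coeff_X_pow, h1.symm]
    · simp [h0]

/-- The specialisation of the symbols `a_{i,j}` to the coefficients of a formal group law. -/
def specialize : MvPolynomial (ℕ × ℕ) ℤ →+* R :=
  (MvPolynomial.aeval fun p : ℕ × ℕ => coeff (pair (p.1 + 1) (p.2 + 1)) F.toPowerSeries :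
    _ →ₐ[ℤ] R).toRingHom

theorem map_specialize_genericSeries : map (specialize F) genericSeries = F.toPowerSeries := by
  ext d
  rw [coeff_map, coeff_apply, genericSeries]
  split_ifs with h0 h1 h1 h2
  · rw [← pair_eta d, h0, h1, coeff_formalGroup_zero_left, map_one, if_pos rfl]
  · rw [← pair_eta d, h0, coeff_formalGroup_zero_left, map_zero, if_neg h1]
  · rw [← pair_eta d, h1, h2, coeff_formalGroup_zero_right, map_one, if_pos rfl]
  · rw [← pair_eta d, h1, coeff_formalGroup_zero_right, map_zero, if_neg h2]
  · simp only [specialize, AlgHom.toRingHom_eq_coe, RingHom.coe_coe, MvPolynomial.aeval_X]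
    rw [Nat.sub_add_cancel (by omega), Nat.sub_add_cancel (by omega), pair_eta]

theorem lazardIdeal_le_ker_specialize [F.IsComm] : lazardIdeal ≤ RingHom.ker (specialize F) := by
  have hz := constantCoeff_genericSeries
  rw [lazardIdeal, Ideal.span_le]
  rintro _ (⟨d, rfl⟩ | ⟨d, rfl⟩)
  · change specialize F _ = 0
    rw [← coeff_map, assocDefect, map_sub,
      map_subst (HasSubst.cons_subst_zero_left 0 1 2 hz),
      map_subst (HasSubst.cons_subst_zero_right 0 1 2 hz),
      map_vec, map_vec, map_subst HasSubst.X_X, map_subst HasSubst.X_X, map_vec, map_vec]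
    simp only [map_X, map_specialize_genericSeries]
    rw [F.assoc, sub_self, map_zero]
  · change specialize F _ = 0
    rw [← coeff_map, commDefect, map_sub, map_subst HasSubst.X_X, map_vec]
    simp only [map_X, map_specialize_genericSeries]
    rw [← FormalGroup.IsComm.comm, sub_self, map_zero]

/-- The ring homomorphism from the Lazard ring that classifies a commutative formal group law. -/
def classify [F.IsComm] : LazardRing →+* R :=
  Ideal.Quotient.lift lazardIdeal (specialize F) (lazardIdeal_le_ker_specialize F)

theorem classify_coeff [F.IsComm] (d : Fin 2 →₀ ℕ) :
    classify F (coeff d universalSeries) = coeff d F.toPowerSeries := by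
  rw [← map_specialize_genericSeries, universalSeries, coeff_map, coeff_map]
  exact Ideal.Quotient.lift_mk _ _ _

end Classify

/-! ### Independence of the generators -/

/-- Approximations of a logarithm over `ℚ[x_0, x_1, …]` for which the `n`-th generator of the Lazard
ring specialises to `x_n`. -/
def genericLogApprox : ℕ → PowerSeries (MvPolynomial ℕ ℚ)
  | 0 => 0
  -- Adding `c t^n` to `h` adds `c t^(n+2)` to the logarithm. By `coeff_logLaw_sub` it lowers the
  -- coefficient at `u^m v^(n+2-m)` by `c C(n+2, m)`, hence the generator by `c * chooseGcd (n +
  -- 2)`. The chosen `c` brings the generator to `x_n`.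
  | n + 1 => genericLogApprox n + PowerSeries.monomial n
      ((chooseGcd (n + 2) : ℚ)⁻¹ •
        (lazardGen (logLaw (genericLogApprox n)) (n + 2) - MvPolynomial.X n))

theorem coeff_genericLogApprox_of_le {n k : ℕ} (h : n ≤ k) :
    PowerSeries.coeff k (genericLogApprox n) = 0 := by
  induction n with
  | zero => simp [genericLogApprox]
  | succ n ih =>
    rw [genericLogApprox, map_add, ih (by omega), PowerSeries.coeff_monomial, if_neg (by omega),
      add_zero]

theorem coeff_genericLogApprox_of_lt {n k : ℕ} (h : k < n) :
    PowerSeries.coeff k (genericLogApprox n) = PowerSeries.coeff k (genericLogApprox (k + 1)) := by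
  induction n, h using Nat.le_induction with
  | base => rfl
  | succ n hn ih =>
    rw [genericLogApprox, map_add, ih, PowerSeries.coeff_monomial, if_neg (by omega), add_zero]

/-- A logarithm over `ℚ[x_0, x_1, …]` for which the `n`-th generator of the Lazard ring specialises
to `x_n`. -/
def genericLog : PowerSeries (MvPolynomial ℕ ℚ) :=
  PowerSeries.mk fun n => PowerSeries.coeff n (genericLogApprox (n + 1))

theorem lazardGen_genericLog (n : ℕ) :
    lazardGen (logLaw genericLog) (n + 2) = MvPolynomial.X n := by
  have h : ∀ k < n, PowerSeries.coeff k genericLog = PowerSeries.coeff k (genericLogApprox n) := by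
    intro k hk
    rw [genericLog, PowerSeries.coeff_mk, coeff_genericLogApprox_of_lt hk]
  have hn : PowerSeries.coeff n (genericLogApprox n) - PowerSeries.coeff n genericLog =
      -((chooseGcd (n + 2) : ℚ)⁻¹ •
        (lazardGen (logLaw (genericLogApprox n)) (n + 2) - MvPolynomial.X n)) := by
    rw [genericLog, PowerSeries.coeff_mk, genericLogApprox, map_add,
      coeff_genericLogApprox_of_le le_rfl, PowerSeries.coeff_monomial, if_pos rfl, zero_add,
      zero_sub]
  have hd : (chooseGcd (n + 2) : ℚ) ≠ 0 := by exact_mod_cast chooseGcd_ne_zero (by omega)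
  have key : lazardGen (logLaw genericLog) (n + 2) -
      lazardGen (logLaw (genericLogApprox n)) (n + 2) = (chooseGcd (n + 2) : ℤ) •
      (PowerSeries.coeff n (genericLogApprox n) - PowerSeries.coeff n genericLog) := by
    rw [lazardGen, lazardGen, ← Finset.sum_sub_distrib, ← sum_bezoutChoose, Finset.sum_smul]
    refine Finset.sum_congr rfl fun m hm => ?_
    rw [Finset.mem_Ioo] at hm
    rw [← zsmul_sub, coeff_logLaw_sub _ _ h hm.1 hm.2, mul_zsmul, natCast_zsmul]
  rw [hn, natCast_zsmul, ← Nat.cast_smul_eq_nsmul ℚ, smul_neg, smul_smul, mul_inv_cancel₀ hd,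
    one_smul] at key
  linear_combination key

/-- By the choice of `genericLog` both homomorphisms send each variable to itself. The right side is
the inclusion of `ℤ[x]` in `ℚ[x]`, so the presentation is injective. -/
theorem classify_lazardPresentation (p : MvPolynomial ℕ ℤ) :
    classify (logFormalGroup genericLog) (lazardPresentation p) =
      MvPolynomial.map (Int.castRingHom ℚ) p := by
  have : (classify (logFormalGroup genericLog)).comp lazardPresentation =
      MvPolynomial.map (Int.castRingHom ℚ) := by
    refine MvPolynomial.ringHom_ext' (RingHom.ext_int _ _) fun n => ?_
    have h : lazardPresentation (MvPolynomial.X n) = lazardGen universalSeries (n + 2) := by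
      simp [lazardPresentation]
    rw [RingHom.comp_apply, h, MvPolynomial.map_X, ← lazardGen_genericLog, lazardGen, lazardGen,
      map_sum]
    refine Finset.sum_congr rfl fun m _ => ?_
    rw [map_zsmul, classify_coeff]
    rfl
  exact RingHom.congr_fun this p

theorem lazardPresentation_injective : Function.Injective lazardPresentation := by
  intro p q h
  have := congrArg (classify (logFormalGroup genericLog)) h
  rw [classify_lazardPresentation, classify_lazardPresentation] at this
  exact MvPolynomial.map_injective _ (RingHom.injective_int _) this

/-- **Lazard's theorem**: the Lazard ring is a polynomial ring. -/
def lazardEquiv : MvPolynomial ℕ ℤ ≃+* LazardRing :=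
  RingEquiv.ofBijective lazardPresentation
    ⟨lazardPresentation_injective, lazardPresentation_surjective⟩

instance : IsDomain LazardRing := lazardEquiv.symm.toMulEquiv.isDomain _

instance : CharZero LazardRing :=
  charZero_of_injective_ringHom (f := (lazardEquiv : MvPolynomial ℕ ℤ →+* LazardRing))
    lazardEquiv.injective

theorem prime_two_lazardRing : Prime (2 : LazardRing) := by
  have h : Prime (MvPolynomial.C 2 : MvPolynomial ℕ ℤ) :=
    (MvPolynomial.prime_C_iff _).mpr Int.prime_two
  have := (MulEquiv.prime_iff lazardEquiv.toMulEquiv).mpr h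
  convert this
  exact (map_ofNat lazardEquiv 2).symm

/-- The multiplicative group over `𝔽_2` is a specialisation of `F_𝕃` in which 2 becomes zero while
the coefficient of `uv` does not. -/
theorem not_two_dvd_coeff : ¬ (2 : LazardRing) ∣ coeff (pair 1 1) universalSeries := by
  rintro ⟨y, hy⟩
  have h := congrArg (classify (FormalGroup.𝔾ₘ : FormalGroup (ZMod 2))) hy
  rw [classify_coeff, map_mul, map_ofNat, show (2 : ZMod 2) = 0 from rfl, zero_mul] at h
  have h2 := coeff_X_zero_pow_mul_X_one_pow (R := ZMod 2) 1 1 1 1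
  have h3 := coeff_X_zero_pow_mul_X_one_pow (R := ZMod 2) 1 1 1 0
  have h4 := coeff_X_zero_pow_mul_X_one_pow (R := ZMod 2) 1 1 0 1
  simp at h2 h3 h4
  simp [h2, h3, h4] at h

/-! ### Arithmetic of the universal formal group law -/

section Arithmetic

variable {σ τ : Type*}

theorem hasSubst_of_constCoeff {a : MvPowerSeries σ LazardRing} (ha : constantCoeff a = 0) :
    PowerSeries.HasSubst a := PowerSeries.HasSubst.of_constantCoeff_zero ha

theorem constantCoeff_formalSum_eq_zero {a b : MvPowerSeries σ LazardRing}
    (ha : constantCoeff a = 0) (hb : constantCoeff b = 0) : constantCoeff (formalSum a b) = 0 :=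
  constantCoeff_formalSum universalFGL ha hb

theorem constantCoeff_formalInv {a : MvPowerSeries σ LazardRing} (ha : constantCoeff a = 0) :
    constantCoeff (formalInv a) = 0 :=
  PowerSeries.constantCoeff_subst_eq_zero ha _ constantCoeff_universalInverse

theorem formalSum_subst {a b : MvPowerSeries σ LazardRing} (ha : constantCoeff a = 0)
    (hb : constantCoeff b = 0) {s : σ → MvPowerSeries τ LazardRing} (hs : HasSubst s) :
    (formalSum a b).subst s = formalSum (a.subst s) (b.subst s) := by
  rw [formalSum, subst_comp_subst_apply (hasSubst_pair ha hb) hs, formalSum]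
  congr 1
  funext i
  fin_cases i <;> rfl

theorem formalInv_subst {a : MvPowerSeries σ LazardRing} (ha : constantCoeff a = 0)
    {s : σ → MvPowerSeries τ LazardRing} (hs : HasSubst s) :
    (formalInv a).subst s = formalInv (a.subst s) := by
  rw [formalInv, PowerSeries.subst,
    subst_comp_subst_apply (hasSubst_of_constCoeff ha).const hs, formalInv]
  rfl

theorem formalSum_zero {a : MvPowerSeries σ LazardRing} (ha : constantCoeff a = 0) :
    formalSum a 0 = a := universalFGL.add_zero (hasSubst_of_constCoeff ha)

theorem zero_formalSum {a : MvPowerSeries σ LazardRing} (ha : constantCoeff a = 0) :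
    formalSum 0 a = a := universalFGL.zero_add (hasSubst_of_constCoeff ha)

theorem formalSum_comm {a b : MvPowerSeries σ LazardRing} (ha : constantCoeff a = 0)
    (hb : constantCoeff b = 0) : formalSum a b = formalSum b a :=
  universalFGL.comm' (hasSubst_of_constCoeff ha) (hasSubst_of_constCoeff hb)

theorem formalSum_assoc {a b c : MvPowerSeries σ LazardRing} (ha : constantCoeff a = 0)
    (hb : constantCoeff b = 0) (hc : constantCoeff c = 0) :
    formalSum (formalSum a b) c = formalSum a (formalSum b c) :=
  universalFGL.assoc' (hasSubst_of_constCoeff ha) (hasSubst_of_constCoeff hb)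
    (hasSubst_of_constCoeff hc)

theorem formalSum_formalInv {a : MvPowerSeries σ LazardRing} (ha : constantCoeff a = 0) :
    formalSum a (formalInv a) = 0 := by
  have h := (existsUnique_formalInverse universalFGL).choose_spec.1.2
  have h0 := constantCoeff_universalInverse
  have hX : constantCoeff (PowerSeries.X : PowerSeries LazardRing) = 0 := by simp [PowerSeries.X]
  have h1 := congrArg (PowerSeries.subst a) h
  change MvPowerSeries.subst (fun _ => a) (universalFGL.toPowerSeries.subst
    ![PowerSeries.X, universalInverse]) = PowerSeries.subst a 0 at h1
  rw [← PowerSeries.coe_substAlgHom (hasSubst_of_constCoeff ha), map_zero,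
    subst_comp_subst_apply (hasSubst_pair hX h0) (hasSubst_of_constCoeff ha).const] at h1
  rw [formalSum, ← h1]
  congr 1
  funext i
  fin_cases i
  · exact (PowerSeries.subst_X (hasSubst_of_constCoeff ha)).symm
  · rfl

theorem formalInv_zero : formalInv (0 : MvPowerSeries σ LazardRing) = 0 :=
  PowerSeries.subst_zero_of_constantCoeff_zero constantCoeff_universalInverse

theorem formalInv_formalInv {a : MvPowerSeries σ LazardRing} (ha : constantCoeff a = 0) :
    formalInv (formalInv a) = a := by
  have h1 := constantCoeff_formalInv ha
  have h2 := constantCoeff_formalInv h1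
  have := formalSum_assoc ha h1 h2
  rw [formalSum_formalInv ha, formalSum_formalInv h1, formalSum_zero ha, zero_formalSum h2] at this
  exact this

/-! ### Linear coefficients -/

/-- The coefficient of `x_k`. -/
abbrev lin (k : σ) : MvPowerSeries σ LazardRing →ₗ[LazardRing] LazardRing :=
  coeff (Finsupp.single k 1)

theorem lin_X [DecidableEq σ] (k i : σ) :
    lin k (X i : MvPowerSeries σ LazardRing) = if k = i then 1 else 0 := by
  rw [lin, coeff_X]
  refine if_congr ?_ rfl rfl
  rw [Finsupp.single_left_inj one_ne_zero]

theorem lin_mul (k : σ) {a : MvPowerSeries σ LazardRing} (ha : constantCoeff a = 0)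
    (b : MvPowerSeries σ LazardRing) : lin k (a * b) = lin k a * constantCoeff b := by
  classical
  rw [lin, coeff_mul, Finset.sum_eq_single (Finsupp.single k 1, 0)]
  · rw [coeff_zero_eq_constantCoeff_apply]
  · rintro ⟨p, q⟩ hpq hne
    rw [Finset.HasAntidiagonal.mem_antidiagonal] at hpq
    have hdeg := congrArg Finsupp.degree hpq
    rw [map_add, Finsupp.degree_single] at hdeg
    change p.degree + q.degree = 1 at hdeg
    rcases Nat.eq_zero_or_pos p.degree with h | h
    · rw [Finsupp.degree_eq_zero_iff] at h
      change coeff p a * _ = 0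
      rw [h, coeff_zero_eq_constantCoeff_apply, ha, zero_mul]
    · have h : q.degree = 0 := by omega
      rw [Finsupp.degree_eq_zero_iff] at h
      change p + q = _ at hpq
      rw [h, add_zero] at hpq
      exact absurd (by rw [hpq, h]) hne
  · intro h
    exact absurd (by simp) h

theorem lin_formalSum (k : σ) {a b : MvPowerSeries σ LazardRing} (ha : constantCoeff a = 0)
    (hb : constantCoeff b = 0) : lin k (formalSum a b) = lin k a + lin k b := by
  have hs := hasSubst_pair ha hb
  have h := le_order_subst hs (universalFGL.toPowerSeries - (X 0 + X 1))
  have h1 : (1 : ℕ∞) ≤ ⨅ i, (![a, b] i).order := by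
    refine le_iInf fun i => one_le_order_iff_constCoeff_eq_zero.mpr ?_
    fin_cases i
    · exact ha
    · exact hb
  have h2 := (mul_le_mul' h1 (two_le_order_formalGroup_sub universalFGL)).trans h
  rw [one_mul, subst_sub hs, subst_add hs, subst_X hs, subst_X hs] at h2
  have h3 := coeff_of_lt_order (d := Finsupp.single k 1) (lt_of_lt_of_le (by simp) h2)
  rw [map_sub, sub_eq_zero, map_add] at h3
  exact h3

theorem lin_formalInv (k : σ) {a : MvPowerSeries σ LazardRing} (ha : constantCoeff a = 0) :
    lin k (formalInv a) = -lin k a := by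
  have := lin_formalSum k ha (constantCoeff_formalInv ha)
  rw [formalSum_formalInv ha, map_zero] at this
  linear_combination -this

/-- If `q = p v`, the linear part of `q` is `v(0)` times that of `p`, so the two linear parts have
vanishing 2 × 2 minors. This criterion tells apart all the factors used below. -/
theorem not_dvd_of_lin {p q : MvPowerSeries σ LazardRing} (hp : constantCoeff p = 0) (k l : σ)
    (h : lin k p * lin l q ≠ lin l p * lin k q) : ¬ p ∣ q := by
  rintro ⟨v, rfl⟩
  rw [lin_mul _ hp, lin_mul _ hp] at h
  exact h (by ring)

/-! ### Specialising one variable -/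

variable [DecidableEq σ]

theorem prod_update_zero_pow (b : σ) (d : σ →₀ ℕ) :
    (d.prod fun s e => Function.update (X : σ → MvPowerSeries σ LazardRing) b 0 s ^ e) =
      if d b = 0 then monomial d 1 else 0 := by
  split_ifs with hdb
  · rw [monomial_one_eq]
    refine Finset.prod_congr rfl fun s hs => ?_
    have : s ≠ b := by
      rintro rfl
      exact (Finsupp.mem_support_iff.mp hs) hdb
    simp [this]
  · refine Finset.prod_eq_zero (Finsupp.mem_support_iff.mpr hdb) ?_
    simp [hdb]

variable [Finite σ]

theorem hasSubst_update {b : σ} {c : MvPowerSeries σ LazardRing} (hc : constantCoeff c = 0) :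
    HasSubst (Function.update (X : σ → MvPowerSeries σ LazardRing) b c) := by
  refine hasSubst_of_constantCoeff_zero fun k => ?_
  rcases eq_or_ne k b with rfl | h
  · simpa
  · simp [h]

theorem subst_update_comp {b : σ} {c : MvPowerSeries σ LazardRing} (hc : constantCoeff c = 0)
    {s : σ → MvPowerSeries τ LazardRing} (hs : HasSubst s) (f : MvPowerSeries σ LazardRing) :
    (f.subst (Function.update X b c)).subst s = f.subst (Function.update s b (c.subst s)) := by
  rw [subst_comp_subst_apply (hasSubst_update hc) hs]
  congr 1
  funext k
  rcases eq_or_ne k b with rfl | h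
  · simp
  · simp [h, subst_X hs]

theorem coeff_subst_update_zero (b : σ) (f : MvPowerSeries σ LazardRing) (m : σ →₀ ℕ) :
    coeff m (f.subst (Function.update (X : σ → MvPowerSeries σ LazardRing) b 0)) =
      if m b = 0 then coeff m f else 0 := by
  rw [coeff_subst (hasSubst_update (map_zero _)), finsum_eq_single _ m]
  · rw [prod_update_zero_pow]
    split_ifs <;> simp
  · intro d hd
    rw [prod_update_zero_pow]
    split_ifs
    · rw [coeff_monomial_ne hd.symm, smul_zero]
    · rw [map_zero, smul_zero]

theorem X_dvd_iff_subst {b : σ} {f : MvPowerSeries σ LazardRing} :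
    X b ∣ f ↔ f.subst (Function.update (X : σ → MvPowerSeries σ LazardRing) b 0) = 0 := by
  rw [X_dvd_iff, MvPowerSeries.ext_iff]
  refine forall_congr' fun m => ?_
  rw [coeff_subst_update_zero, map_zero]
  split_ifs with h <;> simp [h]

/-- The series that do not involve `x_b`. -/
def Omits (b : σ) (c : MvPowerSeries σ LazardRing) : Prop :=
  c.subst (Function.update (X : σ → MvPowerSeries σ LazardRing) b 0) = c

theorem Omits.subst_update {b : σ} {c : MvPowerSeries σ LazardRing} (h : Omits b c)
    {s : σ → MvPowerSeries τ LazardRing} (hs : HasSubst s) {t : MvPowerSeries τ LazardRing}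
    (ht : HasSubst (Function.update s b t)) : c.subst (Function.update s b t) = c.subst s := by
  have hz : constantCoeff (0 : MvPowerSeries σ LazardRing) = 0 := map_zero _
  have e1 := subst_update_comp (b := b) hz hs c
  have e2 := subst_update_comp (b := b) hz ht c
  rw [← coe_substAlgHom hs, map_zero, coe_substAlgHom, h] at e1
  rw [← coe_substAlgHom ht, map_zero, coe_substAlgHom, h, Function.update_idem] at e2
  rw [e1, e2]

theorem omits_X {b i : σ} (h : i ≠ b) : Omits b (X i : MvPowerSeries σ LazardRing) := by
  rw [Omits, subst_X (hasSubst_update (map_zero _)), Function.update_of_ne h]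

theorem omits_zero {b : σ} : Omits b (0 : MvPowerSeries σ LazardRing) := by
  rw [Omits, ← coe_substAlgHom (hasSubst_update (map_zero _)), map_zero]

theorem Omits.formalInv {b : σ} {c : MvPowerSeries σ LazardRing} (hc : constantCoeff c = 0)
    (h : Omits b c) : Omits b (formalInv c) := by
  rw [Omits, formalInv_subst hc (hasSubst_update (map_zero _)), h]

/-- The automorphism `x_b ↦ x_b + c`, whose inverse is `x_b ↦ x_b - c`, carries `x_b - c` to `x_b`
and reduces the claim to `X_dvd_iff_subst`. -/
theorem X_sub_dvd_iff_subst {b : σ} {c f : MvPowerSeries σ LazardRing} (hc : constantCoeff c = 0)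
    (hb : Omits b c) :
    X b - c ∣ f ↔ f.subst (Function.update (X : σ → MvPowerSeries σ LazardRing) b c) = 0 := by
  have hs := hasSubst_update (b := b) hc
  have hX : HasSubst (X : σ → MvPowerSeries σ LazardRing) := HasSubst.X
  have hcs : ∀ {t : MvPowerSeries σ LazardRing}, constantCoeff t = 0 →
      c.subst (Function.update X b t) = c := by
    intro t ht
    rw [hb.subst_update hX (hasSubst_update ht), subst_self]
    rfl
  constructor
  · rintro ⟨g, rfl⟩
    rw [subst_mul hs, subst_sub hs, subst_X hs, hcs hc, Function.update_self, sub_self, zero_mul]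
  · intro h
    have hp : constantCoeff (X b + c) = 0 := by simp [hc]
    have hm : constantCoeff (X b - c) = 0 := by simp [hc]
    have hz : constantCoeff (0 : MvPowerSeries σ LazardRing) = 0 := map_zero _
    have h1 : X b ∣ f.subst (Function.update X b (X b + c)) := by
      rw [X_dvd_iff_subst, subst_update_comp hp (hasSubst_update hz),
        subst_add (hasSubst_update hz), subst_X (hasSubst_update hz), hcs hz, Function.update_self,
        zero_add, Function.update_idem, h]
    obtain ⟨g, hg⟩ := h1
    have h2 := congrArg (subst (Function.update X b (X b - c))) hg
    rw [subst_update_comp hp (hasSubst_update hm), subst_add (hasSubst_update hm),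
      subst_X (hasSubst_update hm), hcs hm, Function.update_self, sub_add_cancel,
      Function.update_idem, Function.update_eq_self, subst_self, subst_mul (hasSubst_update hm),
      subst_X (hasSubst_update hm), Function.update_self] at h2
    exact ⟨_, h2⟩

/-- Divisibility by `x_b - c` is the vanishing of a substitution into a power series ring over a
domain, so it is a prime condition. -/
theorem prime_X_sub {b : σ} {c : MvPowerSeries σ LazardRing} (hc : constantCoeff c = 0)
    (hb : Omits b c) : Prime (X b - c) := by
  refine ⟨fun h => ?_, fun h => ?_, fun f g h => ?_⟩
  · rw [sub_eq_zero] at h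
    have h1 := X_dvd_iff_subst.mp (dvd_refl (X b : MvPowerSeries σ LazardRing))
    rw [h, hb, ← h] at h1
    have h2 := lin_X b b (σ := σ)
    rw [h1, map_zero, if_pos rfl] at h2
    exact zero_ne_one h2
  · have := h.map (constantCoeff (σ := σ) (R := LazardRing))
    rw [map_sub, hc, constantCoeff_X, sub_zero] at this
    exact not_isUnit_zero this
  · rw [X_sub_dvd_iff_subst hc hb, subst_mul (hasSubst_update hc), mul_eq_zero] at h
    rwa [X_sub_dvd_iff_subst hc hb, X_sub_dvd_iff_subst hc hb]

/-- The cofactor has constant term `lin b f = 1`, so it is a unit. This applies to `x_i ⊞ χ(x_j)`,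
which vanishes at `x_i = x_j`, and to `x_i ⊞ x_j`, which vanishes at `x_j = χ(x_i)`. -/
theorem associated_X_sub {b : σ} {c f : MvPowerSeries σ LazardRing} (hc : constantCoeff c = 0)
    (hb : Omits b c) (hf : f.subst (Function.update X b c) = 0) (h1 : lin b f = 1) :
    Associated (X b - c) f := by
  obtain ⟨v, rfl⟩ := (X_sub_dvd_iff_subst hc hb).mpr hf
  have hlc : lin b c = 0 := by
    rw [← hb, lin, coeff_subst_update_zero, if_neg (by simp)]
  rw [lin_mul _ (by simp [hc]), map_sub, hlc, lin_X, if_pos rfl, sub_zero, one_mul] at h1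
  have hu : IsUnit v := by
    rw [MvPowerSeries.isUnit_iff_constantCoeff, h1]
    exact isUnit_one
  exact associated_mul_unit_right _ _ hu

end Arithmetic

/-- Primality of the `p i` lets the powers be split off one after another; unique factorisation in
`A` is not needed. -/
theorem prod_pow_dvd_of_prime {A ι : Type*} [CommRing A] [IsDomain A] [DecidableEq ι]
    {p : ι → A} (e : ι → ℕ) {f : A} (s : Finset ι) (hp : ∀ i ∈ s, Prime (p i))
    (hpp : ∀ i ∈ s, ∀ j ∈ s, i ≠ j → ¬ p i ∣ p j) (h : ∀ i ∈ s, p i ^ e i ∣ f) :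
    ∏ i ∈ s, p i ^ e i ∣ f := by
  induction s using Finset.induction_on with
  | empty => simp
  | insert a s ha ih =>
    obtain ⟨g, rfl⟩ := ih (fun i hi => hp i (Finset.mem_insert_of_mem hi))
      (fun i hi j hj => hpp i (Finset.mem_insert_of_mem hi) j (Finset.mem_insert_of_mem hj))
      (fun i hi => h i (Finset.mem_insert_of_mem hi))
    have hpa := hp a (Finset.mem_insert_self a s)
    have hn : ¬ p a ∣ ∏ i ∈ s, p i ^ e i := by
      intro hd
      obtain ⟨i, hi, hd⟩ := (hpa.dvd_finsetProd_iff _).mp hd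
      exact hpp a (Finset.mem_insert_self a s) i (Finset.mem_insert_of_mem hi)
        (by rintro rfl; exact ha hi) (hpa.dvd_of_dvd_pow hd)
    have := hpa.pow_dvd_of_dvd_mul_left (e a) hn (h a (Finset.mem_insert_self a s))
    rw [Finset.prod_insert ha, mul_comm]
    exact mul_dvd_mul_left _ this

theorem continuous_subst_lazard {σ τ : Type*} {s : σ → MvPowerSeries τ LazardRing}
    (hs : HasSubst s) : Continuous (subst s : MvPowerSeries σ LazardRing → _) := by
  let : UniformSpace LazardRing := ⊥
  exact continuous_subst hs

/-! ### Symmetrisation over a common denominator -/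

section Numerators

variable {ι κ C C' : Type*} [DecidableEq ι] [DecidableEq κ] [CommRing C] [CommRing C']

/-- The common denominator `∏_{i ≠ j} den i j` for the variables in `S`. -/
def schurDen (den : ι → ι → C) (S : Finset ι) : C := ∏ i ∈ S, ∏ j ∈ S.erase i, den i j

/-- The numerator over `schurDen` of the sum, over the injective sequences `i_1, …, i_r` in `S`, of
`∏_a q i_a λ_a * ∏_j num i_a j / den i_a j`, where `j` runs over `S` without `i_1, …, i_a`. -/
def schurNum (q : ι → ℕ → C) (num den : ι → ι → C) : List ℕ → Finset ι → C
  | [], S => schurDen den S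
  -- Passing from `S` to `S.erase i`, the denominator loses the factors `den i j * den j i`;
  -- cancelling the `den i j` below `num i j` leaves `num i j * den j i`.
  | k :: l, S => ∑ i ∈ S, q i k * (∏ j ∈ S.erase i, num i j * den j i) *
      schurNum q num den l (S.erase i)

theorem schurDen_insert (den : ι → ι → C) {a : ι} {S : Finset ι} (ha : a ∉ S) :
    schurDen den (insert a S) = (∏ j ∈ S, den a j * den j a) * schurDen den S := by
  rw [schurDen, Finset.prod_insert ha, Finset.erase_insert ha, Finset.prod_mul_distrib, mul_assoc]
  congr 1
  rw [schurDen, ← Finset.prod_mul_distrib]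
  refine Finset.prod_congr rfl fun i hi => ?_
  have : a ≠ i := by rintro rfl; exact ha hi
  rw [Finset.erase_insert_of_ne this, Finset.prod_insert (fun h => ha (Finset.mem_of_mem_erase h))]

theorem map_schurDen (f : C →+* C') (den : ι → ι → C) (S : Finset ι) :
    f (schurDen den S) = schurDen (fun i j => f (den i j)) S := by
  simp only [schurDen, map_prod]

theorem map_schurNum (f : C →+* C') (q : ι → ℕ → C) (num den : ι → ι → C) (l : List ℕ) :
    ∀ S : Finset ι, f (schurNum q num den l S) =
      schurNum (fun i k => f (q i k)) (fun i j => f (num i j)) (fun i j => f (den i j)) l S := by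
  induction l with
  | nil => exact map_schurDen f den
  | cons k l ih =>
    intro S
    simp only [schurNum, map_sum, map_mul, map_prod, ih]

theorem schurDen_congr {den den' : ι → ι → C} {S : Finset ι}
    (h : ∀ i ∈ S, ∀ j ∈ S, den i j = den' i j) : schurDen den S = schurDen den' S :=
  Finset.prod_congr rfl fun i hi => Finset.prod_congr rfl fun j hj =>
    h i hi j (Finset.mem_of_mem_erase hj)

theorem schurNum_congr {q q' : ι → ℕ → C} {num num' den den' : ι → ι → C} (l : List ℕ) :
    ∀ S : Finset ι, (∀ i ∈ S, ∀ k ∈ l, q i k = q' i k) →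
    (∀ i ∈ S, ∀ j ∈ S, num i j = num' i j) → (∀ i ∈ S, ∀ j ∈ S, den i j = den' i j) →
    schurNum q num den l S = schurNum q' num' den' l S := by
  induction l with
  | nil => exact fun S _ _ h => schurDen_congr h
  | cons k l ih =>
    intro S hq hn hd
    refine Finset.sum_congr rfl fun i hi => ?_
    rw [hq i hi k List.mem_cons_self, ih (S.erase i)
      (fun i' hi' k hk => hq i' (Finset.mem_of_mem_erase hi') k (List.mem_cons_of_mem _ hk))
      (fun i' hi' j hj => hn i' (Finset.mem_of_mem_erase hi') j (Finset.mem_of_mem_erase hj))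
      (fun i' hi' j hj => hd i' (Finset.mem_of_mem_erase hi') j (Finset.mem_of_mem_erase hj)),
      Finset.prod_congr rfl fun j hj => ?_]
    rw [hn i hi j (Finset.mem_of_mem_erase hj), hd j (Finset.mem_of_mem_erase hj) i hi]

theorem schurDen_map (v : κ ↪ ι) (den : ι → ι → C) (S : Finset κ) :
    schurDen den (S.map v) = schurDen (fun i j => den (v i) (v j)) S := by
  simp only [schurDen, Finset.prod_map, ← Finset.map_erase]

theorem schurNum_map (v : κ ↪ ι) (q : ι → ℕ → C) (num den : ι → ι → C) (l : List ℕ) :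
    ∀ S : Finset κ, schurNum q num den l (S.map v) =
      schurNum (fun i => q (v i)) (fun i j => num (v i) (v j)) (fun i j => den (v i) (v j)) l S := by
  induction l with
  | nil => exact schurDen_map v den
  | cons k l ih =>
    intro S
    simp only [schurNum, Finset.sum_map, ← Finset.map_erase, Finset.prod_map, ih]

/-- Models the substitution `x_a = 0`, and also reduction modulo `x_a ⊞ x_a`. The terms choosing `a`
vanish with `q a`; in the others the factor `num i a / den i a` is 1. -/
theorem schurNum_insert (q : ι → ℕ → C) (num den : ι → ι → C) {a : ι} (l : List ℕ) :
    ∀ S : Finset ι, a ∉ S → (∀ k ∈ l, q a k = 0) → (∀ i ∈ S, num i a = den i a) →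
    schurNum q num den l (insert a S) =
      (∏ j ∈ S, den a j * den j a) * schurNum q num den l S := by
  induction l with
  | nil => exact fun S ha _ _ => schurDen_insert den ha
  | cons k l ih =>
    intro S ha hq hn
    rw [schurNum, Finset.sum_insert ha, hq k List.mem_cons_self, zero_mul, zero_mul, zero_add,
      schurNum, Finset.mul_sum]
    refine Finset.sum_congr rfl fun i hi => ?_
    have hai : a ≠ i := by rintro rfl; exact ha hi
    have ha' : a ∉ S.erase i := fun h => ha (Finset.mem_of_mem_erase h)
    rw [Finset.erase_insert_of_ne hai, Finset.prod_insert ha', ih _ ha'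
      (fun k hk => hq k (List.mem_cons_of_mem _ hk))
      (fun j hj => hn j (Finset.mem_of_mem_erase hj)), hn i hi, ← Finset.mul_prod_erase S _ hi]
    ring

/-- Models the substitution `x_b = χ(x_a)`. A term choosing `a` or `b` while both remain contains
`num a b` or `num b a`, which is zero; for any other chosen `i` the numerators at `a` and `b` cancel
against the denominators. -/
theorem schurNum_insert_insert (q : ι → ℕ → C) (num den : ι → ι → C) {a b : ι} (hab : a ≠ b)
    (h1 : num a b = 0) (h2 : num b a = 0) (l : List ℕ) :
    ∀ S : Finset ι, a ∉ S → b ∉ S → (∀ i ∈ S, num i a * num i b = den i a * den i b) →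
    schurNum q num den l (insert a (insert b S)) =
      (∏ j ∈ insert b S, den a j * den j a) * (∏ j ∈ S, den b j * den j b) *
        schurNum q num den l S := by
  induction l with
  | nil =>
    intro S ha hb _
    rw [schurNum, schurNum, schurDen_insert den (by simp [hab, ha]), schurDen_insert den hb,
      mul_assoc]
  | cons k l ih =>
    intro S ha hb hn
    have hab' : a ∉ insert b S := by simp [hab, ha]
    have za : ∏ j ∈ (insert a (insert b S)).erase a, num a j * den j a = 0 := by
      rw [Finset.erase_insert hab', Finset.prod_insert hb, h1, zero_mul, zero_mul]
    have zb : ∏ j ∈ (insert a (insert b S)).erase b, num b j * den j b = 0 := by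
      rw [Finset.erase_insert_of_ne hab, Finset.erase_insert hb, Finset.prod_insert ha, h2,
        zero_mul, zero_mul]
    rw [schurNum, Finset.sum_insert hab', Finset.sum_insert hb, za, zb, schurNum, Finset.mul_sum]
    simp only [mul_zero, zero_mul, zero_add]
    refine Finset.sum_congr rfl fun i hi => ?_
    have hai : a ≠ i := by rintro rfl; exact ha hi
    have hbi : b ≠ i := by rintro rfl; exact hb hi
    have ha' : a ∉ S.erase i := fun h => ha (Finset.mem_of_mem_erase h)
    have hb' : b ∉ S.erase i := fun h => hb (Finset.mem_of_mem_erase h)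
    rw [Finset.erase_insert_of_ne hai, Finset.erase_insert_of_ne hbi,
      Finset.prod_insert (by simp [hab, ha']), Finset.prod_insert hb', ih _ ha' hb'
      (fun j hj => hn j (Finset.mem_of_mem_erase hj)), Finset.prod_insert hb,
      Finset.prod_insert hb', ← Finset.mul_prod_erase S _ hi,
      ← Finset.mul_prod_erase S (fun j => den b j * den j b) hi]
    linear_combination q i k * den a i * den b i * (∏ j ∈ S.erase i, num i j * den j i) *
      (den a b * den b a) * (∏ x ∈ S.erase i, den a x * den x a) *
      (∏ j ∈ S.erase i, den b j * den j b) * schurNum q num den l (S.erase i) * hn i hi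

theorem schurNum_eq_zero (q : ι → ℕ → C) (num den : ι → ι → C) (l : List ℕ) :
    ∀ S : Finset ι, S.card < l.length → schurNum q num den l S = 0 := by
  induction l with
  | nil => intro S h; simp at h
  | cons k l ih =>
    intro S h
    refine Finset.sum_eq_zero fun i hi => ?_
    rw [ih _ (by rw [Finset.card_erase_of_mem hi]; simp at h; have := Finset.card_pos.mpr ⟨i, hi⟩; omega),
      mul_zero]

end Numerators

/-- A permutation of `n + 1` letters splits into its value at 0 and a permutation of the others,
which matches the recursion in `schurNum`. Both `n` and the number of parts drop by one, so the
factorial stays the same; it arises at the empty list, where all permutations contribute 1. -/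
theorem factorial_mul_schurNum {ι K : Type*} [DecidableEq ι] [Field K] (q : ι → ℕ → K)
    (num den : ι → ι → K) (l : List ℕ) : ∀ (n : ℕ) (v : Fin n ↪ ι), l.length ≤ n →
    (∀ i j, i ≠ j → den (v i) (v j) ≠ 0) →
    (((n - l.length).factorial : ℕ) : K) * schurNum q num den l (Finset.univ.map v) =
      schurDen den (Finset.univ.map v) * ∑ w : Equiv.Perm (Fin n), ∏ i : Fin n,
        if (i : ℕ) < l.length then q (v (w i)) (l.getD i 0) * ∏ j : Fin n,
          if i < j then num (v (w i)) (v (w j)) * (den (v (w i)) (v (w j)))⁻¹ else 1 else 1 := by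
  induction l with
  | nil =>
    intro n v _ _
    simp [schurNum, Fintype.card_perm, mul_comm]
  | cons k l ih =>
    intro n v hn hd
    obtain ⟨n, rfl⟩ : ∃ m, n = m + 1 := ⟨n - 1, by simp at hn; omega⟩
    have hn' : l.length ≤ n := by simpa using hn
    -- The enumeration of the variables other than `v p`, in the order that
    -- `Equiv.Perm.decomposeFin` induces.
    set v' : Fin (n + 1) → (Fin n ↪ ι) := fun p =>
      ((Fin.succEmb n).trans (Equiv.swap 0 p).toEmbedding).trans v with hv'
    have hv'a : ∀ p j, v' p j = v (Equiv.swap 0 p j.succ) := fun p j => rfl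
    have hne : ∀ (p : Fin (n + 1)) (j : Fin n), Equiv.swap 0 p j.succ ≠ p := by
      intro p j h
      have h2 := congrArg (Equiv.swap 0 p) h
      rw [Equiv.swap_apply_self, Equiv.swap_apply_right] at h2
      exact Fin.succ_ne_zero j h2
    have hv'S : ∀ p, Finset.univ.map (v' p) = (Finset.univ.map v).erase (v p) := by
      intro p
      rw [← Finset.map_erase]
      have : v' p = ((Fin.succEmb n).trans (Equiv.swap 0 p).toEmbedding).trans v := rfl
      rw [this, ← Finset.map_map]
      congr 1
      refine Finset.eq_of_subset_of_card_le ?_ ?_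
      · intro x hx
        rw [Finset.mem_map] at hx
        obtain ⟨j, -, rfl⟩ := hx
        exact Finset.mem_erase.mpr ⟨hne p j, Finset.mem_univ _⟩
      · rw [Finset.card_erase_of_mem (Finset.mem_univ _)]
        simp
    rw [← (Equiv.Perm.decomposeFin (n := n)).symm.sum_comp, Fintype.sum_prod_type, schurNum,
      Finset.sum_map, Finset.mul_sum, Finset.mul_sum]
    refine Finset.sum_congr rfl fun p _ => ?_
    have hS : v p ∉ (Finset.univ.map v).erase (v p) := Finset.notMem_erase _ _
    have hden : schurDen den (Finset.univ.map v) =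
        (∏ j : Fin n, den (v p) (v' p j) * den (v' p j) (v p)) *
          schurDen den (Finset.univ.map (v' p)) := by
      conv_lhs => rw [← Finset.insert_erase (Finset.mem_map_of_mem v (Finset.mem_univ p)),
        schurDen_insert den hS, ← hv'S, Finset.prod_map]
    have key : ∀ e : Equiv.Perm (Fin n),
        (∏ i : Fin (n + 1), if (i : ℕ) < (k :: l).length then
          q (v (Equiv.Perm.decomposeFin.symm (p, e) i)) ((k :: l).getD i 0) * ∏ j : Fin (n + 1),
          if i < j then num (v (Equiv.Perm.decomposeFin.symm (p, e) i))
            (v (Equiv.Perm.decomposeFin.symm (p, e) j)) *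
            (den (v (Equiv.Perm.decomposeFin.symm (p, e) i))
              (v (Equiv.Perm.decomposeFin.symm (p, e) j)))⁻¹ else 1 else 1) =
        q (v p) k * (∏ j : Fin n, num (v p) (v' p j) * (den (v p) (v' p j))⁻¹) *
        ∏ i : Fin n, if (i : ℕ) < l.length then q (v' p (e i)) (l.getD i 0) * ∏ j : Fin n,
          if i < j then num (v' p (e i)) (v' p (e j)) * (den (v' p (e i)) (v' p (e j)))⁻¹ else 1
          else 1 := by
      intro e
      rw [Fin.prod_univ_succ]
      congr 1
      · rw [if_pos (by simp), Fin.prod_univ_succ, if_neg (lt_irrefl _), one_mul,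
          Equiv.Perm.decomposeFin_symm_apply_zero]
        congr 1
        rw [← Equiv.prod_comp e fun j => num (v p) (v' p j) * (den (v p) (v' p j))⁻¹]
        refine Finset.prod_congr rfl fun j _ => ?_
        rw [if_pos (Fin.succ_pos j), Equiv.Perm.decomposeFin_symm_apply_succ, hv'a]
      · refine Finset.prod_congr rfl fun i _ => ?_
        rw [Equiv.Perm.decomposeFin_symm_apply_succ, ← hv'a, Fin.prod_univ_succ,
          if_neg (by simp : ¬ i.succ < 0), one_mul]
        simp only [Fin.val_succ, List.length_cons, add_lt_add_iff_right, List.getD_cons_succ,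
          Fin.succ_lt_succ_iff, Equiv.Perm.decomposeFin_symm_apply_succ, ← hv'a]
    simp only [key]
    rw [← Finset.mul_sum]
    have hih := ih n (v' p) hn' fun i j hij => hd _ _ fun h =>
      hij (Fin.succ_injective _ ((Equiv.swap 0 p).injective h))
    have hpp : ∀ j : Fin n, den (v p) (v' p j) ≠ 0 := fun j => hd _ _ (hne p j).symm
    have hprod : (∏ j : Fin n, den (v p) (v' p j) * den (v' p j) (v p)) *
        (∏ j : Fin n, num (v p) (v' p j) * (den (v p) (v' p j))⁻¹) =
        ∏ j ∈ (Finset.univ.map v).erase (v p), num (v p) j * den j (v p) := by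
      rw [← hv'S, Finset.prod_map, ← Finset.prod_mul_distrib]
      refine Finset.prod_congr rfl fun j _ => ?_
      field_simp [hpp j]
    rw [hden, ← hprod, ← hv'S, List.length_cons, Nat.add_sub_add_right]
    linear_combination (q (v p) k * (∏ j : Fin n, den (v p) (v' p j) * den (v' p j) (v p)) *
        (∏ j : Fin n, num (v p) (v' p j) * (den (v p) (v' p j))⁻¹)) * hih

/-! ### The universal Schur functions are power series -/

instance {n : ℕ} : IsDomain (Series n) := NoZeroDivisors.to_isDomain _

/-- The series `x_i ⊞ x_j`. -/
def fnum {n : ℕ} (i j : Fin n) : Series n := formalSum (X i) (X j)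

/-- The series `x_i ⊞ χ(x_j)`. -/
def fden {n : ℕ} (i j : Fin n) : Series n := formalSum (X i) (formalInv (X j))

/-- The power function `k ↦ h(t) t^{k-1}` given by a power series `h`. -/
def headPow (h : PowerSeries LazardRing) {n : ℕ} (t : Series n) (k : ℕ) : Series n :=
  if k = 0 then 1 else h.subst t * t ^ (k - 1)

/-- The series `t ⊞ t`. -/
def doubleSeries : PowerSeries LazardRing := formalSum PowerSeries.X PowerSeries.X

section

variable {n m : ℕ}

theorem constantCoeff_X_eq_zero (i : Fin n) : constantCoeff (X i : Series n) = 0 := by simp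

theorem constantCoeff_formalInv_X (i : Fin n) : constantCoeff (formalInv (X i : Series n)) = 0 :=
  constantCoeff_formalInv (constantCoeff_X_eq_zero i)

theorem constantCoeff_fnum (i j : Fin n) : constantCoeff (fnum i j) = 0 :=
  constantCoeff_formalSum_eq_zero (constantCoeff_X_eq_zero i) (constantCoeff_X_eq_zero j)

theorem constantCoeff_fden (i j : Fin n) : constantCoeff (fden i j) = 0 :=
  constantCoeff_formalSum_eq_zero (constantCoeff_X_eq_zero i) (constantCoeff_formalInv_X j)

theorem fnum_comm (i j : Fin n) : fnum i j = fnum j i :=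
  formalSum_comm (constantCoeff_X_eq_zero i) (constantCoeff_X_eq_zero j)

theorem lin_fnum (k i j : Fin n) :
    lin k (fnum i j) = (if k = i then 1 else 0) + if k = j then 1 else 0 := by
  rw [fnum, lin_formalSum _ (constantCoeff_X_eq_zero i) (constantCoeff_X_eq_zero j), lin_X, lin_X]

theorem lin_fden (k i j : Fin n) :
    lin k (fden i j) = (if k = i then 1 else 0) - if k = j then 1 else 0 := by
  rw [fden, lin_formalSum _ (constantCoeff_X_eq_zero i) (constantCoeff_formalInv_X j), lin_X,
    lin_formalInv _ (constantCoeff_X_eq_zero j), lin_X, sub_eq_add_neg]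

theorem fnum_subst {s : Fin n → Series m} (hs : HasSubst s) (i j : Fin n) :
    (fnum i j).subst s = formalSum (s i) (s j) := by
  rw [fnum, formalSum_subst (constantCoeff_X_eq_zero i) (constantCoeff_X_eq_zero j) hs,
    subst_X hs, subst_X hs]

theorem fden_subst {s : Fin n → Series m} (hs : HasSubst s) (i j : Fin n) :
    (fden i j).subst s = formalSum (s i) (formalInv (s j)) := by
  rw [fden, formalSum_subst (constantCoeff_X_eq_zero i) (constantCoeff_formalInv_X j) hs,
    formalInv_subst (constantCoeff_X_eq_zero j) hs, subst_X hs, subst_X hs]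

theorem powerSeries_subst_subst (h : PowerSeries LazardRing) {s : Fin n → Series m}
    (hs : HasSubst s) (i : Fin n) : (h.subst (X i : Series n)).subst s = h.subst (s i) := by
  rw [PowerSeries.subst, subst_comp_subst_apply
    (hasSubst_of_constCoeff (constantCoeff_X_eq_zero i)).const hs, subst_X hs]
  rfl

theorem headPow_subst (h : PowerSeries LazardRing) {s : Fin n → Series m} (hs : HasSubst s)
    (i : Fin n) (k : ℕ) : (headPow h (X i : Series n) k).subst s = headPow h (s i) k := by
  rw [headPow, headPow]
  split_ifs
  · rw [← coe_substAlgHom hs, map_one]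
  · rw [subst_mul hs, subst_pow hs, subst_X hs, powerSeries_subst_subst h hs]

theorem headPow_X {t : Series n} (ht : constantCoeff t = 0) (k : ℕ) :
    headPow PowerSeries.X t k = t ^ k := by
  rw [headPow, PowerSeries.subst_X (hasSubst_of_constCoeff ht)]
  split_ifs with hk
  · rw [hk, pow_zero]
  · rw [← pow_succ', Nat.sub_add_cancel (Nat.pos_of_ne_zero hk)]

theorem doubleSeries_subst {t : Series n} (ht : constantCoeff t = 0) :
    doubleSeries.subst t = formalSum t t := by
  have hX : constantCoeff (PowerSeries.X : PowerSeries LazardRing) = 0 := by simp [PowerSeries.X]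
  rw [PowerSeries.subst, doubleSeries, formalSum_subst hX hX (hasSubst_of_constCoeff ht).const]
  have : MvPowerSeries.subst (fun _ : Unit => t) (PowerSeries.X : PowerSeries LazardRing) = t :=
    PowerSeries.subst_X (hasSubst_of_constCoeff ht)
  rw [this]

theorem headPow_doubleSeries {t : Series n} (ht : constantCoeff t = 0) (k : ℕ) :
    headPow doubleSeries t k = doublePow t k := by
  rw [headPow, doublePow, doubleSeries_subst ht]

theorem hasSubst_X_comp (v : Fin n → Fin m) : HasSubst (X ∘ v : Fin n → Series m) :=
  hasSubst_of_constantCoeff_zero fun i => by simp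

/-- The denominator of the universal Schur functions in the variables `x_i`, `i ∈ S`. -/
def lazardDen (S : Finset (Fin n)) : Series n := schurDen fden S

/-- The numerator of the universal Schur functions in the variables `x_i`, `i ∈ S`. -/
def lazardNum (h : PowerSeries LazardRing) (l : List ℕ) (S : Finset (Fin n)) : Series n :=
  schurNum (fun i => headPow h (X i)) fnum fden l S

theorem lazardDen_subst_X (v : Fin n ↪ Fin m) (S : Finset (Fin n)) :
    (lazardDen S).subst (X ∘ v : Fin n → Series m) = lazardDen (S.map v) := by
  have hs := hasSubst_X_comp v
  rw [lazardDen, lazardDen, schurDen_map, ← coe_substAlgHom hs]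
  refine (map_schurDen (substAlgHom (R := LazardRing) hs).toRingHom _ _).trans ?_
  congr 1
  funext i j
  exact (substAlgHom_apply hs _).trans (fden_subst hs i j)

theorem lazardNum_subst_X (h : PowerSeries LazardRing) (l : List ℕ) (v : Fin n ↪ Fin m)
    (S : Finset (Fin n)) :
    (lazardNum h l S).subst (X ∘ v : Fin n → Series m) = lazardNum h l (S.map v) := by
  have hs := hasSubst_X_comp v
  rw [lazardNum, lazardNum, schurNum_map, ← coe_substAlgHom hs]
  refine (map_schurNum (substAlgHom (R := LazardRing) hs).toRingHom _ _ _ _ _).trans ?_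
  congr 1
  · funext i k
    exact (substAlgHom_apply hs _).trans (headPow_subst h hs i k)
  · funext i j
    exact (substAlgHom_apply hs _).trans (fnum_subst hs i j)
  · funext i j
    exact (substAlgHom_apply hs _).trans (fden_subst hs i j)

theorem associated_fden {i j : Fin n} (hij : i ≠ j) : Associated (X i - X j) (fden i j) := by
  refine associated_X_sub (constantCoeff_X_eq_zero j) (omits_X hij.symm) ?_ ?_
  · rw [fden_subst (hasSubst_update (constantCoeff_X_eq_zero j)), Function.update_self,
      Function.update_of_ne hij.symm, formalSum_formalInv (constantCoeff_X_eq_zero j)]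
  · rw [lin_fden, if_pos rfl, if_neg hij, sub_zero]

theorem prime_X_sub_X {i j : Fin n} (hij : i ≠ j) : Prime (X i - X j : Series n) :=
  prime_X_sub (constantCoeff_X_eq_zero j) (omits_X hij.symm)

theorem fden_ne_zero {i j : Fin n} (hij : i ≠ j) : fden i j ≠ 0 :=
  ((associated_fden hij).prime (prime_X_sub_X hij)).ne_zero

theorem associated_fnum {i j : Fin n} (hij : i ≠ j) :
    Associated (X j - formalInv (X i)) (fnum i j) := by
  have h0 := constantCoeff_formalInv_X i
  refine associated_X_sub h0 ((omits_X hij).formalInv (constantCoeff_X_eq_zero i)) ?_ ?_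
  · rw [fnum_subst (hasSubst_update h0), Function.update_self,
      Function.update_of_ne hij, formalSum_formalInv (constantCoeff_X_eq_zero i)]
  · rw [lin_fnum, if_neg hij.symm, if_pos rfl, zero_add]

theorem prime_fnum {i j : Fin n} (hij : i ≠ j) : Prime (fnum i j) :=
  (associated_fnum hij).prime (prime_X_sub (constantCoeff_formalInv_X i)
    ((omits_X hij).formalInv (constantCoeff_X_eq_zero i)))

theorem fnum_dvd_iff {i j : Fin n} (hij : i ≠ j) {f : Series n} :
    fnum i j ∣ f ↔ f.subst (cancelSubst i j) = 0 := by
  rw [← (associated_fnum hij).dvd_iff_dvd_left, X_sub_dvd_iff_subst (constantCoeff_formalInv_X i)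
    ((omits_X hij).formalInv (constantCoeff_X_eq_zero i))]
  rfl

theorem lazardDen_ne_zero (S : Finset (Fin n)) : lazardDen S ≠ 0 :=
  Finset.prod_ne_zero_iff.mpr fun _ _ => Finset.prod_ne_zero_iff.mpr fun _ hj =>
    fden_ne_zero (Finset.ne_of_mem_erase hj).symm

theorem X_sub_X_dvd_fden {i j : Fin n} (hij : i ≠ j) : (X i - X j : Series n) ∣ fden i j :=
  (associated_fden hij).dvd

theorem X_sub_X_dvd_fden' {i j : Fin n} (hij : i ≠ j) : (X i - X j : Series n) ∣ fden j i := by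
  rw [← neg_sub, neg_dvd]
  exact X_sub_X_dvd_fden hij.symm

theorem X_sub_X_dvd_sub_swap {a b : Fin n} (hab : a ≠ b) (f : Series n) :
    (X a - X b : Series n) ∣ f - f.subst (X ∘ Equiv.swap a b : Fin n → Series n) := by
  have hb := constantCoeff_X_eq_zero b
  have hs : HasSubst (X ∘ Equiv.swap a b : Fin n → Series n) := hasSubst_X_comp _
  rw [X_sub_dvd_iff_subst hb (omits_X hab.symm), subst_sub (hasSubst_update hb), sub_eq_zero,
    subst_comp_subst_apply hs (hasSubst_update hb)]
  congr 1
  funext k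
  rw [Function.comp_apply, subst_X (hasSubst_update hb)]
  rcases eq_or_ne k a with rfl | hka
  · rw [Equiv.swap_apply_left, Function.update_self, Function.update_of_ne hab.symm]
  · rcases eq_or_ne k b with rfl | hkb
    · rw [Equiv.swap_apply_right, Function.update_self, Function.update_of_ne hka]
    · rw [Equiv.swap_apply_of_ne_of_ne hka hkb]

/-- Terms choosing neither `a` nor `b` are covered by induction. The term choosing `a` contains `x_b
⊞ χ(x_a)`, so it is `(x_a - x_b) Y`. Its image under the transposition is the term choosing `b`, so
the two add up to `(x_a - x_b)(Y - Y^σ)`, and `Y - Y^σ` vanishes at `x_a = x_b`. -/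
theorem X_sub_X_sq_dvd_lazardNum (h : PowerSeries LazardRing) {a b : Fin n} (hab : a ≠ b)
    (l : List ℕ) : ∀ S : Finset (Fin n), a ∈ S → b ∈ S →
    (X a - X b : Series n) ^ 2 ∣ lazardNum h l S := by
  induction l with
  | nil =>
    intro S ha hb
    have hb' : b ∈ S.erase a := Finset.mem_erase.mpr ⟨hab.symm, hb⟩
    rw [← Finset.insert_erase ha]
    change _ ∣ schurDen fden _
    rw [schurDen_insert _ (Finset.notMem_erase a S), ← Finset.mul_prod_erase _ _ hb', sq]
    exact (mul_dvd_mul (X_sub_X_dvd_fden hab) (X_sub_X_dvd_fden' hab)).mul_right _ |>.mul_right _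
  | cons k l ih =>
    intro S ha hb
    have hb' : b ∈ S.erase a := Finset.mem_erase.mpr ⟨hab.symm, hb⟩
    set T : Fin n → Series n := fun i => headPow h (X i) k *
      (∏ j ∈ S.erase i, fnum i j * fden j i) * lazardNum h l (S.erase i) with hT
    have hs : HasSubst (X ∘ Equiv.swap a b : Fin n → Series n) := hasSubst_X_comp _
    have e : lazardNum h (k :: l) S = (T a + T b) + ∑ i ∈ (S.erase a).erase b, T i := by
      rw [add_assoc, Finset.add_sum_erase _ _ hb', Finset.add_sum_erase _ _ ha]
      rfl
    have hσ : (S.erase a).map (Equiv.swap a b).toEmbedding = S.erase b := by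
      ext x
      simp only [Finset.mem_map_equiv, Equiv.symm_swap, Finset.mem_erase]
      rcases eq_or_ne x a with rfl | hxa
      · simp [hab, hab.symm, ha, hb]
      rcases eq_or_ne x b with rfl | hxb
      · simp
      · simp [Equiv.swap_apply_of_ne_of_ne hxa hxb, hxa, hxb]
    have hswap : (T a).subst (X ∘ Equiv.swap a b : Fin n → Series n) = T b := by
      rw [hT]
      simp only
      rw [subst_mul hs, subst_mul hs, headPow_subst h hs]
      have := lazardNum_subst_X h l (Equiv.swap a b).toEmbedding (S.erase a)
      rw [Equiv.coe_toEmbedding] at this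
      rw [this, hσ, Function.comp_apply, Equiv.swap_apply_left]
      congr 2
      rw [← hσ, Finset.prod_map, ← coe_substAlgHom hs, map_prod]
      refine Finset.prod_congr rfl fun j _ => ?_
      rw [map_mul, substAlgHom_apply, substAlgHom_apply, fnum_subst hs, fden_subst hs]
      simp [fnum, fden]
    obtain ⟨Y, hY⟩ : (X a - X b : Series n) ∣ T a := by
      refine Dvd.dvd.mul_right (Dvd.dvd.mul_left ?_ _) _
      rw [← Finset.mul_prod_erase _ _ hb']
      exact ((X_sub_X_dvd_fden' hab).mul_left _).mul_right _
    have hTb : T b = (X b - X a) * Y.subst (X ∘ Equiv.swap a b : Fin n → Series n) := by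
      rw [← hswap, hY, subst_mul hs, subst_sub hs, subst_X hs, subst_X hs]
      simp
    rw [e]
    refine dvd_add ?_ (Finset.dvd_sum fun i hi => ?_)
    · have : T a + T b = (X a - X b) * (Y - Y.subst (X ∘ Equiv.swap a b : Fin n → Series n)) := by
        rw [hTb, hY]
        ring
      rw [this, sq]
      exact mul_dvd_mul_left _ (X_sub_X_dvd_sub_swap hab Y)
    · simp only [Finset.mem_erase] at hi
      exact (ih _ (Finset.mem_erase.mpr ⟨hi.2.1.symm, ha⟩)
        (Finset.mem_erase.mpr ⟨hi.1.symm, hb⟩)).mul_left _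

theorem not_X_sub_X_dvd_X_sub_X {a b c d : Fin n} (h1 : a < b) (h2 : c < d)
    (h : (a, b) ≠ (c, d)) : ¬ (X a - X b : Series n) ∣ X c - X d := by
  have h0 : constantCoeff (X a - X b : Series n) = 0 := by simp
  by_cases hc : c = a ∨ c = b
  · have hd : ¬ (d = a ∨ d = b) := by
      rintro hd
      rcases hc with rfl | rfl <;> rcases hd with rfl | rfl
      · exact lt_irrefl _ h2
      · exact h rfl
      · exact lt_asymm h1 h2
      · exact lt_irrefl _ h2
    refine not_dvd_of_lin h0 a d ?_
    push Not at hd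
    simp [lin_X, h1.ne, h2.ne', hd.1, hd.2]
  · push Not at hc
    refine not_dvd_of_lin h0 a c ?_
    simp [lin_X, h1.ne, h2.ne, hc.1, hc.2]

theorem prod_erase_eq_prod_lt (f : Fin n → Fin n → Series n) :
    ∏ i, ∏ j ∈ Finset.univ.erase i, f i j =
      ∏ p ∈ Finset.univ.filter (fun p : Fin n × Fin n => p.1 < p.2), f p.1 p.2 * f p.2 p.1 := by
  have e : ∏ i, ∏ j ∈ Finset.univ.erase i, f i j =
      ∏ p ∈ Finset.univ.filter (fun p : Fin n × Fin n => p.1 ≠ p.2), f p.1 p.2 := by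
    rw [Finset.prod_finset_product (Finset.univ.filter (fun p : Fin n × Fin n => p.1 ≠ p.2))
      Finset.univ (fun i => Finset.univ.erase i)]
    intro p
    simp [eq_comm]
  have e2 : Finset.univ.filter (fun p : Fin n × Fin n => p.1 ≠ p.2) =
      Finset.univ.filter (fun p : Fin n × Fin n => p.1 < p.2) ∪
        (Finset.univ.filter (fun p : Fin n × Fin n => p.1 < p.2)).map
          (Equiv.prodComm _ _).toEmbedding := by
    ext p
    simp [Finset.mem_map_equiv, lt_or_lt_iff_ne]
  rw [e, e2, Finset.prod_union, Finset.prod_map, ← Finset.prod_mul_distrib]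
  · rfl
  · rw [Finset.disjoint_left]
    intro p hp hp'
    simp [Finset.mem_map_equiv] at hp hp'
    exact lt_asymm hp hp'

theorem lazardDen_univ_associated : Associated (lazardDen (Finset.univ : Finset (Fin n)))
    (∏ p ∈ Finset.univ.filter (fun p : Fin n × Fin n => p.1 < p.2),
      (X p.1 - X p.2 : Series n) ^ 2) := by
  rw [lazardDen, schurDen, prod_erase_eq_prod_lt]
  refine Associated.prod _ _ _ fun p hp => ?_
  have hp : p.1 < p.2 := by simpa using hp
  rw [sq]
  refine (associated_fden hp.ne).symm.mul_mul ?_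
  refine (associated_fden hp.ne').symm.trans ?_
  rw [← neg_sub]
  exact Associated.neg_left (Associated.refl _)

theorem lazardDen_dvd_lazardNum (h : PowerSeries LazardRing) (l : List ℕ) :
    lazardDen (Finset.univ : Finset (Fin n)) ∣ lazardNum h l Finset.univ := by
  rw [lazardDen_univ_associated.dvd_iff_dvd_left]
  refine prod_pow_dvd_of_prime (fun _ => 2) _ (fun p hp => ?_) (fun p hp p' hp' hne => ?_)
    (fun p hp => ?_)
  · exact prime_X_sub_X (by simpa using hp : p.1 < p.2).ne
  · exact not_X_sub_X_dvd_X_sub_X (by simpa using hp) (by simpa using hp') hne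
  · exact X_sub_X_sq_dvd_lazardNum h (by simpa using hp : p.1 < p.2).ne l _ (Finset.mem_univ _)
      (Finset.mem_univ _)

/-- The universal Schur function as a power series. -/
def schurSeries (h : PowerSeries LazardRing) (n : ℕ) (l : List ℕ) : Series n :=
  (lazardDen_dvd_lazardNum (n := n) h l).choose

theorem lazardDen_mul_schurSeries (h : PowerSeries LazardRing) (n : ℕ) (l : List ℕ) :
    lazardDen Finset.univ * schurSeries h n l = lazardNum h l Finset.univ :=
  (lazardDen_dvd_lazardNum (n := n) h l).choose_spec.symm

theorem schurSeries_eq_zero (h : PowerSeries LazardRing) {l : List ℕ} (hl : n < l.length) :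
    schurSeries h n l = 0 := by
  have := lazardDen_mul_schurSeries h n l
  rw [lazardNum, schurNum_eq_zero _ _ _ _ _ (by simpa using hl)] at this
  exact (mul_eq_zero.mp this).resolve_left (lazardDen_ne_zero _)

instance : CharZero (Series n) := charZero_of_injective_ringHom (f := (C : LazardRing →+* Series n))
  (C_injective)

theorem factorial_mul_algebraMap_schurSeries (h : PowerSeries LazardRing) {l : List ℕ}
    (hl : l.length ≤ n) :
    (((n - l.length).factorial : ℕ) : Fractions n) *
      algebraMap (Series n) (Fractions n) (schurSeries h n l) =
    ∑ w : Equiv.Perm (Fin n), ∏ i : Fin n, if (i : ℕ) < l.length then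
      algebraMap (Series n) (Fractions n) (headPow h (X (w i)) (l.getD i 0)) * ∏ j : Fin n,
        if i < j then algebraMap (Series n) (Fractions n) (fnum (w i) (w j)) *
          (algebraMap (Series n) (Fractions n) (fden (w i) (w j)))⁻¹ else 1 else 1 := by
  have hinj := IsFractionRing.injective (Series n) (Fractions n)
  have key := factorial_mul_schurNum
    (fun i k => algebraMap (Series n) (Fractions n) (headPow h (X i) k))
    (fun i j => algebraMap (Series n) (Fractions n) (fnum i j))
    (fun i j => algebraMap (Series n) (Fractions n) (fden i j)) l n
    (Function.Embedding.refl _) hl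
    (fun i j hij => (map_ne_zero_iff _ hinj).mpr (fden_ne_zero hij))
  simp only [Finset.map_refl, Function.Embedding.refl_apply] at key
  have e1 := map_schurNum (algebraMap (Series n) (Fractions n)) (fun i => headPow h (X i)) fnum fden
    l Finset.univ
  have e2 := map_schurDen (algebraMap (Series n) (Fractions n)) fden (Finset.univ : Finset (Fin n))
  rw [← e1, ← e2] at key
  have h0 : algebraMap (Series n) (Fractions n) (schurDen fden Finset.univ) ≠ 0 :=
    (map_ne_zero_iff _ hinj).mpr (lazardDen_ne_zero _)
  refine mul_left_cancel₀ h0 (Eq.trans ?_ key)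
  have := congrArg (algebraMap (Series n) (Fractions n)) (lazardDen_mul_schurSeries h n l)
  rw [map_mul] at this
  change algebraMap (Series n) (Fractions n) (schurDen fden Finset.univ) * _ =
    algebraMap (Series n) (Fractions n) (schurNum _ fnum fden l Finset.univ) at this
  rw [← this]
  ring

theorem algebraMap_schurSeries (h : PowerSeries LazardRing) {pw : Series n → ℕ → Series n}
    (hpw : ∀ i k, pw (X i) k = headPow h (X i) k) (l : StrictPartition) (hl : l.length ≤ n) :
    algebraMap (Series n) (Fractions n) (schurSeries h n l.parts) = symmetrization n pw l := by
  have : CharZero (Fractions n) := charZero_of_injective_algebraMap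
    (IsFractionRing.injective (Series n) (Fractions n))
  have hf : (((n - l.length).factorial : ℕ) : Fractions n) ≠ 0 := by
    exact_mod_cast Nat.factorial_ne_zero _
  refine mul_left_cancel₀ hf ?_
  rw [symmetrization, Ring.inverse_eq_inv, mul_inv_cancel_left₀ hf]
  refine (factorial_mul_algebraMap_schurSeries h hl).trans ?_
  refine Finset.sum_congr rfl fun w _ => ?_
  rw [Finset.prod_filter]
  refine Finset.prod_congr rfl fun i _ => ?_
  refine if_congr Iff.rfl ?_ rfl
  rw [Finset.prod_filter, hpw]
  simp only [Ring.inverse_eq_inv]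
  rfl

theorem toSeries_algebraMap (f : Series n) : toSeries (algebraMap (Series n) (Fractions n) f) = f :=
  Function.leftInverse_invFun (IsFractionRing.injective (Series n) (Fractions n)) f

theorem schurP_eq (n : ℕ) (l : StrictPartition) :
    schurP n l = schurSeries PowerSeries.X n l.parts := by
  rw [schurP]
  split_ifs with hl
  · rw [fractionP, ← algebraMap_schurSeries PowerSeries.X
      (fun i k => (headPow_X (constantCoeff_X_eq_zero i) k).symm) l hl, toSeries_algebraMap]
  · rw [schurSeries_eq_zero _ (not_le.mp hl)]

theorem schurQ_eq (n : ℕ) (l : StrictPartition) :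
    schurQ n l = schurSeries doubleSeries n l.parts := by
  rw [schurQ]
  split_ifs with hl
  · rw [fractionQ, ← algebraMap_schurSeries doubleSeries
      (fun i k => (headPow_doubleSeries (constantCoeff_X_eq_zero i) k).symm) l hl,
      toSeries_algebraMap]
  · rw [schurSeries_eq_zero _ (not_le.mp hl)]

end

/-! ### Specialisations of the universal Schur functions -/

section

variable {n m : ℕ}

theorem headPow_zero {h : PowerSeries LazardRing} (h0 : PowerSeries.constantCoeff h = 0) {k : ℕ}
    (hk : 0 < k) : headPow h (0 : Series n) k = 0 := by
  rw [headPow, if_neg hk.ne', PowerSeries.subst_zero_of_constantCoeff_zero h0, zero_mul]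

theorem lazardNum_subst (h : PowerSeries LazardRing) (l : List ℕ) {s : Fin n → Series m}
    (hs : HasSubst s) (S : Finset (Fin n)) :
    (lazardNum h l S).subst s = schurNum (fun i => headPow h (s i))
      (fun i j => formalSum (s i) (s j)) (fun i j => formalSum (s i) (formalInv (s j))) l S := by
  rw [lazardNum, ← coe_substAlgHom hs]
  refine (map_schurNum (substAlgHom (R := LazardRing) hs).toRingHom _ _ _ _ _).trans ?_
  congr 1
  · funext i k
    exact (substAlgHom_apply hs _).trans (headPow_subst h hs i k)
  · funext i j
    exact (substAlgHom_apply hs _).trans (fnum_subst hs i j)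
  · funext i j
    exact (substAlgHom_apply hs _).trans (fden_subst hs i j)

theorem lazardDen_eq_lazardNum (h : PowerSeries LazardRing) (S : Finset (Fin n)) :
    lazardDen S = lazardNum h [] S := rfl

/-- Numerator and denominator depend only on the set of variables, so a permutation of all of them
fixes both. -/
theorem rename_schurSeries (h : PowerSeries LazardRing) (l : List ℕ) (w : Equiv.Perm (Fin n)) :
    rename w (schurSeries h n l) = schurSeries h n l := by
  have hs := hasSubst_X_comp w
  have e := congrArg (subst (X ∘ w : Fin n → Series n)) (lazardDen_mul_schurSeries h n l)
  have e1 := lazardDen_subst_X w.toEmbedding Finset.univ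
  have e2 := lazardNum_subst_X h l w.toEmbedding Finset.univ
  rw [Finset.map_univ_equiv, Equiv.coe_toEmbedding] at e1 e2
  rw [subst_mul hs, e1, e2, ← lazardDen_mul_schurSeries] at e
  rw [rename_eq_subst]
  exact mul_left_cancel₀ (lazardDen_ne_zero _) e

theorem lazardNum_subst_of_eq (h : PowerSeries LazardRing) (l : List ℕ) {s : Fin n → Series n}
    (hs : HasSubst s) {S : Finset (Fin n)} (hS : ∀ i ∈ S, s i = X i) :
    (lazardNum h l S).subst s = lazardNum h l S := by
  rw [lazardNum_subst h l hs]
  refine schurNum_congr l S (fun i hi k _ => ?_) (fun i hi j hj => ?_) (fun i hi j hj => ?_)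
  · rw [hS i hi]
  · rw [hS i hi, hS j hj, fnum]
  · rw [hS i hi, hS j hj, fden]

theorem insert_insert_erase_erase {i j : Fin n} (hij : i ≠ j) :
    insert i (insert j ((Finset.univ.erase i).erase j)) = Finset.univ := by
  rw [Finset.insert_erase (Finset.mem_erase.mpr ⟨hij.symm, Finset.mem_univ _⟩),
    Finset.insert_erase (Finset.mem_univ _)]

/-- The factor `K` does not depend on `l`, so it cancels between numerator and denominator, the
latter being the case `l = []`. It is nonzero because the substituted variables have
`x_i`-coefficients 1, -1 and 0, which differ in characteristic zero; so the linear part of each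
factor of `K` is nonzero. -/
theorem lazardNum_subst_cancelSubst (h : PowerSeries LazardRing) {i j : Fin n} (hij : i ≠ j) :
    ∃ K : Series n, K ≠ 0 ∧ ∀ l, (lazardNum h l Finset.univ).subst (cancelSubst i j) =
      K * lazardNum h l ((Finset.univ.erase i).erase j) := by
  have hs := hasSubst_cancelSubst i j
  have hi : cancelSubst i j i = X i := Function.update_of_ne hij _ _
  have hj : cancelSubst i j j = formalInv (X i) := Function.update_self _ _ _
  have hk : ∀ k ∈ (Finset.univ.erase i).erase j, cancelSubst i j k = X k := fun k hk =>
    Function.update_of_ne (Finset.mem_erase.mp hk).1 _ _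
  have hc : ∀ k, constantCoeff (cancelSubst i j k) = 0 := fun k => by
    rcases eq_or_ne k j with rfl | hkj
    · rw [hj, constantCoeff_formalInv_X]
    · rw [cancelSubst, Function.update_of_ne hkj, constantCoeff_X]
  set den : Fin n → Fin n → Series n := fun p q =>
    formalSum (cancelSubst i j p) (formalInv (cancelSubst i j q)) with hden
  have hlin : ∀ p q, lin i (cancelSubst i j p) ≠ lin i (cancelSubst i j q) → den p q ≠ 0 := by
    intro p q hpq h0
    have := congrArg (lin i) h0
    rw [hden] at this
    simp only at this
    rw [lin_formalSum _ (hc p) (constantCoeff_formalInv (hc q)), lin_formalInv _ (hc q), map_zero]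
      at this
    exact hpq (by linear_combination this)
  have li : lin i (cancelSubst i j i) = 1 := by rw [hi, lin_X, if_pos rfl]
  have lj : lin i (cancelSubst i j j) = -1 := by
    rw [hj, lin_formalInv _ (constantCoeff_X_eq_zero i), lin_X, if_pos rfl]
  have lk : ∀ k ∈ (Finset.univ.erase i).erase j, lin i (cancelSubst i j k) = 0 := fun k hk' => by
    rw [hk k hk', lin_X, if_neg]
    rintro rfl
    simp at hk'
  have h11 : (1 : LazardRing) ≠ -1 := fun h => by
    have : (2 : LazardRing) = 0 := by linear_combination h
    exact two_ne_zero this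
  refine ⟨(∏ k ∈ insert j ((Finset.univ.erase i).erase j), den i k * den k i) *
      ∏ k ∈ (Finset.univ.erase i).erase j, den j k * den k j, ?_, fun l => ?_⟩
  · refine mul_ne_zero (Finset.prod_ne_zero_iff.mpr fun k hk' => ?_)
      (Finset.prod_ne_zero_iff.mpr fun k hk' => ?_)
    · rcases Finset.mem_insert.mp hk' with rfl | hk'
      · exact mul_ne_zero (hlin _ _ (by rw [li, lj]; exact h11))
          (hlin _ _ (by rw [li, lj]; exact h11.symm))
      · exact mul_ne_zero (hlin _ _ (by rw [li, lk k hk']; exact one_ne_zero))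
          (hlin _ _ (by rw [li, lk k hk']; exact one_ne_zero.symm))
    · exact mul_ne_zero (hlin _ _ (by rw [lj, lk k hk']; simp))
        (hlin _ _ (by rw [lj, lk k hk']; simp))
  · have h1 := constantCoeff_X_eq_zero (n := n) i
    have h2 := constantCoeff_formalInv h1
    rw [lazardNum_subst h l hs, ← insert_insert_erase_erase hij,
      schurNum_insert_insert _ _ _ hij]
    · rw [insert_insert_erase_erase hij, hden, ← lazardNum_subst h l hs,
        lazardNum_subst_of_eq h l hs hk]
    · rw [hi, hj, formalSum_formalInv h1]
    · rw [hi, hj, formalSum_comm h2 h1, formalSum_formalInv h1]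
    · simp
    · simp
    · intro k _
      rw [hi, hj, formalInv_formalInv h1, mul_comm]

/-- After `x_j = χ(x_i)` the function is the quotient of a numerator and a denominator in the other
variables. Therefore it does not change when `x_i` is set to zero, and `χ(0) = 0`. -/
theorem schurSeries_mem_Gam (h : PowerSeries LazardRing) (l : List ℕ) :
    schurSeries h n l ∈ Gam n := by
  refine ⟨rename_schurSeries h l, fun i j hij => ?_⟩
  have hs := hasSubst_cancelSubst i j
  set S := (Finset.univ.erase i).erase j with hS
  obtain ⟨K, hK, hKl⟩ := lazardNum_subst_cancelSubst h hij
  have e := congrArg (subst (cancelSubst i j)) (lazardDen_mul_schurSeries h n l)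
  rw [subst_mul hs, lazardDen_eq_lazardNum h, hKl, hKl, mul_assoc] at e
  replace e := mul_left_cancel₀ hK e
  have hz := hasSubst_zeroSubst i
  have hzS : ∀ k ∈ S, zeroSubst i k = X k := fun k hk =>
    Function.update_of_ne (Finset.mem_erase.mp (Finset.mem_erase.mp hk).2).1 _ _
  have e' := congrArg (subst (zeroSubst i)) e
  rw [subst_mul hz, lazardNum_subst_of_eq h _ hz hzS, lazardNum_subst_of_eq h _ hz hzS, ← e] at e'
  replace e' := mul_left_cancel₀ (lazardDen_ne_zero _) e'
  rw [← e', cancelSubst, subst_update_comp (constantCoeff_formalInv_X i) hz,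
    formalInv_subst (constantCoeff_X_eq_zero i) hz, subst_X hz]
  congr 1
  rw [zeroSubst₂, zeroSubst, Function.update_self, formalInv_zero]

/-- Positivity of the parts makes the terms choosing `a` vanish. As in the cancellation lemma, `K`
is independent of `l` and nonzero, so it drops out of the quotient. -/
theorem lazardNum_subst_zeroSubst {h : PowerSeries LazardRing}
    (h0 : PowerSeries.constantCoeff h = 0) (a : Fin n) :
    ∃ K : Series n, K ≠ 0 ∧ ∀ l : List ℕ, (∀ k ∈ l, 0 < k) →
      (lazardNum h l Finset.univ).subst (zeroSubst a) =
        K * lazardNum h l (Finset.univ.erase a) := by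
  have hz := hasSubst_zeroSubst a
  have ha : zeroSubst a a = 0 := Function.update_self _ _ _
  have hk : ∀ k ∈ Finset.univ.erase a, zeroSubst a k = X k := fun k hk =>
    Function.update_of_ne (Finset.mem_erase.mp hk).1 _ _
  refine ⟨∏ k ∈ Finset.univ.erase a, formalSum (zeroSubst a a) (formalInv (zeroSubst a k)) *
    formalSum (zeroSubst a k) (formalInv (zeroSubst a a)),
    Finset.prod_ne_zero_iff.mpr fun k hk' => ?_, fun l hl => ?_⟩
  · rw [ha, hk k hk', formalInv_zero, formalSum_zero (constantCoeff_X_eq_zero k),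
      zero_formalSum (constantCoeff_formalInv_X k)]
    refine mul_ne_zero (fun h => ?_) (fun h => ?_)
    · have := congrArg (lin k) h
      rw [lin_formalInv _ (constantCoeff_X_eq_zero k), lin_X, if_pos rfl, map_zero] at this
      exact neg_ne_zero.mpr one_ne_zero this
    · have := congrArg (lin k) h
      rw [lin_X, if_pos rfl, map_zero] at this
      exact one_ne_zero this
  · rw [lazardNum_subst h l hz, ← Finset.insert_erase (Finset.mem_univ a), schurNum_insert]
    · rw [Finset.insert_erase (Finset.mem_univ a), ← lazardNum_subst h l hz,
        lazardNum_subst_of_eq h l hz hk]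
    · simp
    · intro k hk'
      rw [ha]
      exact headPow_zero h0 (hl k hk')
    · intro k _
      rw [ha, formalInv_zero]

theorem lazardDen_mul_schurSeries_subst_zeroSubst {h : PowerSeries LazardRing}
    (h0 : PowerSeries.constantCoeff h = 0) (a : Fin n) {l : List ℕ} (hl : ∀ k ∈ l, 0 < k) :
    lazardDen (Finset.univ.erase a) * (schurSeries h n l).subst (zeroSubst a) =
      lazardNum h l (Finset.univ.erase a) := by
  obtain ⟨K, hK, hKl⟩ := lazardNum_subst_zeroSubst h0 a
  have e := congrArg (subst (zeroSubst a)) (lazardDen_mul_schurSeries h n l)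
  rw [subst_mul (hasSubst_zeroSubst a), lazardDen_eq_lazardNum h, hKl l hl, hKl [] (by simp),
    mul_assoc] at e
  exact mul_left_cancel₀ hK e

theorem rename_killCompl_castSuccEmb (f : Series (n + 1)) :
    rename Fin.castSuccEmb (killCompl (Fin.castSuccEmb : Fin n ↪ Fin (n + 1)) f) =
      f.subst (zeroSubst (Fin.last n)) := by
  ext d
  rw [zeroSubst, coeff_subst_update_zero]
  by_cases hd : d ∈ Set.range (Finsupp.embDomain (Fin.castSuccEmb : Fin n ↪ Fin (n + 1)))
  · obtain ⟨x, rfl⟩ := hd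
    rw [coeff_embDomain_rename, coeff_killCompl, if_pos]
    exact Finsupp.embDomain_of_notMem_range _ _ _ (by simp)
  · rw [if_neg, coeff_rename_eq_zero]
    · rintro ⟨x, hx⟩
      exact hd ⟨x, by rw [Finsupp.embDomain_eq_mapDomain]; exact hx⟩
    · intro h0
      refine hd ⟨d.comapDomain Fin.castSuccEmb Fin.castSuccEmb.injective.injOn, ?_⟩
      refine Finsupp.embDomain_comapDomain fun i hi => ?_
      rcases Fin.eq_castSucc_or_eq_last i with ⟨j, rfl⟩ | rfl
      · exact ⟨j, rfl⟩
      · exact absurd h0 (Finsupp.mem_support_iff.mp hi)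

/-- Stability in the number of variables: the identity at `x_{n+1} = 0` lives in the image of `n`
variables, and `rename` is injective. -/
theorem killCompl_schurSeries {h : PowerSeries LazardRing}
    (h0 : PowerSeries.constantCoeff h = 0) {l : List ℕ} (hl : ∀ k ∈ l, 0 < k) :
    killCompl (Fin.castSuccEmb : Fin n ↪ Fin (n + 1)) (schurSeries h (n + 1) l) =
      schurSeries h n l := by
  have e := lazardDen_mul_schurSeries_subst_zeroSubst h0 (Fin.last n) hl
  have hu : Finset.univ.erase (Fin.last n) = Finset.univ.map Fin.castSuccEmb := by
    ext i
    rcases Fin.eq_castSucc_or_eq_last i with ⟨j, rfl⟩ | rfl <;> simp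
  rw [← rename_killCompl_castSuccEmb, hu, ← lazardDen_subst_X, ← lazardNum_subst_X,
    ← rename_eq_subst, ← rename_eq_subst, ← map_mul] at e
  have e' := rename_injective _ e
  rw [← lazardDen_mul_schurSeries] at e'
  exact mul_left_cancel₀ (lazardDen_ne_zero _) e'

/-- In three variables, `y ⊞ χ(z)` divides `(x ⊞ y) - (x ⊞ z)`, since the difference vanishes at `y
= z`. Now put `x = x_i`, `y = x_a`, `z = χ(x_a)`. -/
theorem doubleSeries_dvd_fnum_sub_fden (i a : Fin n) :
    formalSum (X a) (X a) ∣ fnum i a - fden i a := by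
  have key : fden (1 : Fin 3) 2 ∣ fnum 0 1 - fnum 0 2 := by
    have h12 : (1 : Fin 3) ≠ 2 := by decide
    have h2 := constantCoeff_X_eq_zero (2 : Fin 3)
    have hu := hasSubst_update (b := (1 : Fin 3)) h2
    rw [← (associated_fden h12).dvd_iff_dvd_left, X_sub_dvd_iff_subst h2 (omits_X h12.symm),
      subst_sub hu, fnum_subst hu, fnum_subst hu, Function.update_self,
      Function.update_of_ne h12.symm, sub_self]
  have ha := constantCoeff_X_eq_zero a
  set s : Fin 3 → Series n := ![X i, X a, formalInv (X a)] with hs_def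
  have hs : HasSubst s := hasSubst_of_constantCoeff_zero fun k => by
    fin_cases k
    · exact constantCoeff_X_eq_zero i
    · exact ha
    · exact constantCoeff_formalInv_X a
  have := map_dvd (substAlgHom (R := LazardRing) hs) key
  rw [map_sub, substAlgHom_apply, substAlgHom_apply, substAlgHom_apply, fden_subst hs,
    fnum_subst hs, fnum_subst hs] at this
  have h1 : s 1 = X a := rfl
  have h2 : s 2 = formalInv (X a) := rfl
  have h3 : s 0 = X i := rfl
  rw [h1, h2, h3, formalInv_formalInv ha] at this
  exact this

/-- Here `c` need not be prime: a prime power dividing `c v` with `p ∤ c` already divides `v`, so it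
can be cancelled from the equation. -/
theorem dvd_of_dvd_prod_pow_mul {A ι : Type*} [CommRing A] [IsDomain A] {p : ι → A} (e : ι → ℕ)
    {c f : A} (s : Finset ι) (hp : ∀ i ∈ s, Prime (p i)) (hc : ∀ i ∈ s, ¬ p i ∣ c)
    (h : c ∣ (∏ i ∈ s, p i ^ e i) * f) : c ∣ f := by
  classical
  induction s using Finset.induction_on with
  | empty => simpa using h
  | insert a s ha ih =>
    refine ih (fun i hi => hp i (Finset.mem_insert_of_mem hi))
      (fun i hi => hc i (Finset.mem_insert_of_mem hi)) ?_
    rw [Finset.prod_insert ha, mul_assoc] at h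
    have hpa := hp a (Finset.mem_insert_self a s)
    obtain ⟨v, hv⟩ := h
    obtain ⟨v', rfl⟩ := hpa.pow_dvd_of_dvd_mul_left (e a) (hc a (Finset.mem_insert_self a s))
      ⟨_, hv.symm⟩
    refine ⟨v', mul_left_cancel₀ (pow_ne_zero (e a) hpa.ne_zero) ?_⟩
    rw [hv]
    ring

theorem not_X_sub_X_dvd_double {i j : Fin n} (hij : i ≠ j) (a : Fin n) :
    ¬ (X i - X j : Series n) ∣ formalSum (X a) (X a) := by
  have ha := constantCoeff_X_eq_zero a
  have h0 : constantCoeff (X i - X j : Series n) = 0 := by simp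
  obtain ⟨k, hk, hka⟩ : ∃ k, lin k (X i - X j : Series n) ≠ 0 ∧ k ≠ a := by
    rcases eq_or_ne i a with rfl | hia
    · exact ⟨j, by simp [lin_X, hij.symm], hij.symm⟩
    · exact ⟨i, by simp [lin_X, hij], hia⟩
  refine not_dvd_of_lin h0 k a ?_
  rw [lin_formalSum _ ha ha, lin_formalSum _ ha ha, lin_X, lin_X, if_pos rfl, if_neg hka, add_zero,
    mul_zero]
  exact mul_ne_zero hk (by norm_num)

theorem constantCoeff_doubleSeries : PowerSeries.constantCoeff doubleSeries = 0 := by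
  have hX : constantCoeff (PowerSeries.X : PowerSeries LazardRing) = 0 := by simp [PowerSeries.X]
  exact constantCoeff_formalSum_eq_zero hX hX

/-- Modulo `c = x_a ⊞ x_a` the numerator behaves as at `x_a = 0`: the positive power functions of
`x_a` vanish and `x_i ⊞ x_a ≡ x_i ⊞ χ(x_a)`. So `c` divides the denominator times `f - f(x_a = 0)`,
and the primes `x_i - x_j` of the denominator do not divide `c`. -/
theorem schurSeries_mem_GamPlus {l : List ℕ} (hl : ∀ k ∈ l, 0 < k) :
    schurSeries doubleSeries n l ∈ GamPlus n := by
  refine ⟨schurSeries_mem_Gam _ l, fun a => ?_⟩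
  set f := schurSeries doubleSeries n l
  set c : Series n := formalSum (X a) (X a) with hc
  have ha := constantCoeff_X_eq_zero a
  refine dvd_of_dvd_prod_pow_mul (p := fun p : Fin n × Fin n => (X p.1 - X p.2 : Series n))
    (fun _ => 2) (Finset.univ.filter (fun p : Fin n × Fin n => p.1 < p.2))
    (fun p hp => prime_X_sub_X (by simpa using hp : p.1 < p.2).ne)
    (fun p hp => not_X_sub_X_dvd_double (by simpa using hp : p.1 < p.2).ne a) ?_
  rw [← (lazardDen_univ_associated.mul_right _).dvd_iff_dvd_right]
  have hD : lazardDen Finset.univ = (∏ j ∈ Finset.univ.erase a, fden a j * fden j a) *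
      lazardDen (Finset.univ.erase a) := by
    rw [← Finset.insert_erase (Finset.mem_univ a), lazardDen, schurDen_insert _ (by simp),
      Finset.insert_erase (Finset.mem_univ a)]
    rfl
  have e1 := lazardDen_mul_schurSeries doubleSeries n l
  have e2 := lazardDen_mul_schurSeries_subst_zeroSubst constantCoeff_doubleSeries a hl
  rw [mul_sub, e1, hD, mul_assoc, e2, ← Ideal.mem_span_singleton, ← Ideal.Quotient.eq]
  set π := Ideal.Quotient.mk (Ideal.span {c})
  rw [map_mul, map_prod]
  simp only [map_mul]
  rw [lazardNum, map_schurNum π, lazardNum, map_schurNum π, ← Finset.insert_erase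
    (Finset.mem_univ a), schurNum_insert]
  · rw [Finset.insert_erase (Finset.mem_univ a)]
  · simp
  · intro k hk
    rw [Ideal.Quotient.eq_zero_iff_mem, Ideal.mem_span_singleton, headPow, if_neg (hl k hk).ne',
      doubleSeries_subst ha]
    exact Dvd.intro _ rfl
  · intro i _
    rw [Ideal.Quotient.eq, Ideal.mem_span_singleton]
    exact doubleSeries_dvd_fnum_sub_fden i a

/-! ### Orders -/

theorem order_fden {i j : Fin n} (hij : i ≠ j) : (fden i j).order = 1 := by
  refine le_antisymm ?_ (one_le_order_iff_constCoeff_eq_zero.mpr (constantCoeff_fden i j))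
  have : lin i (fden i j) ≠ 0 := by
    rw [lin_fden, if_pos rfl, if_neg hij, sub_zero]
    exact one_ne_zero
  simpa using order_le this

theorem one_le_order_fnum (i j : Fin n) : 1 ≤ (fnum i j).order :=
  one_le_order_iff_constCoeff_eq_zero.mpr (constantCoeff_fnum i j)

theorem le_order_headPow {h : PowerSeries LazardRing} (h0 : PowerSeries.constantCoeff h = 0)
    {t : Series n} (ht : constantCoeff t = 0) (k : ℕ) : (k : ℕ∞) ≤ (headPow h t k).order := by
  rw [headPow]
  split_ifs with hk
  · simp [hk]
  · have h1 : 1 ≤ (h.subst t).order := one_le_order_iff_constCoeff_eq_zero.mpr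
      (PowerSeries.constantCoeff_subst_eq_zero ht _ h0)
    have h2 := le_order_pow_of_constantCoeff_eq_zero (k - 1) ht
    refine le_trans ?_ ((add_le_add h1 h2).trans le_order_mul)
    exact_mod_cast (by omega : k ≤ 1 + (k - 1))

theorem le_order_sum {ι : Type*} {s : Finset ι} {f : ι → Series n} {d : ℕ∞}
    (h : ∀ i ∈ s, d ≤ (f i).order) : d ≤ (∑ i ∈ s, f i).order := by
  refine le_order fun e he => ?_
  rw [map_sum]
  exact Finset.sum_eq_zero fun i hi => coeff_of_lt_order (he.trans_le (h i hi))

theorem order_lazardDen (S : Finset (Fin n)) :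
    (lazardDen S).order = ((S.card * (S.card - 1) : ℕ) : ℕ∞) := by
  rw [lazardDen, schurDen, order_prod]
  have : ∀ i ∈ S, (∏ j ∈ S.erase i, fden i j).order = ((S.card - 1 : ℕ) : ℕ∞) := by
    intro i hi
    rw [order_prod, Finset.sum_congr rfl fun j hj => order_fden (Finset.ne_of_mem_erase hj).symm]
    simp [Finset.card_erase_of_mem hi]
  rw [Finset.sum_congr rfl this]
  simp

/-- Choosing one of `c + 1` variables contributes `k` from the power function and `2c` from the
remaining factors, and `c (c - 1) + 2c = (c + 1) c`. Subtracting the order of the denominator shows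
that the Schur function of `λ` has order at least `|λ|`, which makes all formal sums converge. -/
theorem le_order_lazardNum {h : PowerSeries LazardRing} (h0 : PowerSeries.constantCoeff h = 0)
    (l : List ℕ) : ∀ S : Finset (Fin n),
    ((S.card * (S.card - 1) + l.sum : ℕ) : ℕ∞) ≤ (lazardNum h l S).order := by
  induction l with
  | nil => exact fun S => (order_lazardDen S).ge
  | cons k l ih =>
    intro S
    refine le_order_sum fun i hi => ?_
    obtain ⟨c, hc⟩ : ∃ c, S.card = c + 1 := ⟨S.card - 1, by
      have := Finset.card_pos.mpr ⟨i, hi⟩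
      omega⟩
    have hce : (S.erase i).card = c := by rw [Finset.card_erase_of_mem hi, hc]; rfl
    have h1 := le_order_headPow h0 (constantCoeff_X_eq_zero i) k
    have h2 : ((c * 2 : ℕ) : ℕ∞) ≤ (∏ j ∈ S.erase i, fnum i j * fden j i).order := by
      rw [order_prod]
      refine le_trans ?_ (Finset.card_nsmul_le_sum _ _ 2 fun j hj => ?_)
      · rw [hce]
        simp
      · rw [order_mul, order_fden (Finset.ne_of_mem_erase hj)]
        exact (add_le_add (one_le_order_fnum i j) le_rfl).trans' one_add_one_eq_two.ge
    have h3 := ih (S.erase i)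
    rw [hce] at h3
    change _ ≤ (headPow h (X i) k * (∏ j ∈ S.erase i, fnum i j * fden j i) *
      lazardNum h l (S.erase i)).order
    rw [order_mul, order_mul]
    refine le_trans ?_ (add_le_add (add_le_add h1 h2) h3)
    rw [hc, List.sum_cons]
    have : (c + 1) * (c + 1 - 1) = c * 2 + c * (c - 1) := by
      cases c with
      | zero => rfl
      | succ c => simp only [Nat.add_sub_cancel]; ring
    rw [this]
    exact_mod_cast (by omega)

theorem le_order_schurSeries {h : PowerSeries LazardRing} (h0 : PowerSeries.constantCoeff h = 0)
    (n : ℕ) (l : List ℕ) : (l.sum : ℕ∞) ≤ (schurSeries h n l).order := by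
  have e := le_order_lazardNum h0 l (Finset.univ : Finset (Fin n))
  rw [← lazardDen_mul_schurSeries, order_mul, order_lazardDen, Nat.cast_add] at e
  exact (ENat.add_le_add_iff_left (ENat.natCast_ne_top _)).mp e

end

/-! ### Convergent sums -/

section

variable {ι : Type*} {n : ℕ}

theorem summable_of_le_order {deg : ι → ℕ} (hfin : ∀ d, {i | deg i ≤ d}.Finite)
    {b : ι → Series n} (hb : ∀ i, (deg i : ℕ∞) ≤ (b i).order) (c : ι → LazardRing) :
    Summable fun i => c i • b i := by
  rw [WithPiTopology.summable_iff_summable_coeff]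
  intro d
  refine summable_of_hasFiniteSupport ((hfin d.degree).subset fun i hi => ?_)
  by_contra h
  refine hi ?_
  have : (d.degree : ℕ∞) < deg i := by exact_mod_cast not_le.mp h
  exact coeff_of_lt_order (this.trans_le ((hb i).trans le_order_smul))

theorem coeff_of_hasSum {f : ι → Series n} {g : Series n} (h : HasSum f g) (d : Fin n →₀ ℕ)
    (s : Finset ι) (hs : ∀ i ∉ s, coeff d (f i) = 0) : coeff d g = ∑ i ∈ s, coeff d (f i) :=
  (WithPiTopology.hasSum_iff_hasSum_coeff.mp h d).unique (hasSum_sum_of_ne_finset_zero hs)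

/-- A strict partition is determined by its set of parts, here a subset of `{0, …, d}`. -/
theorem sum_le_finite (d : ℕ) : {l : StrictPartition | l.parts.sum ≤ d}.Finite := by
  have hinj : Function.Injective fun l : StrictPartition => l.parts.toFinset := by
    rintro ⟨l, hl, hl'⟩ ⟨m, hm, hm'⟩ h
    have : l = m := hl.eq_of_mem_iff hm fun a => by
      simpa using congrArg (a ∈ ·) h
    subst this
    rfl
  refine Set.Finite.of_finite_image (f := fun l : StrictPartition => l.parts.toFinset) ?_
    hinj.injOn
  refine ((Finset.range (d + 1)).powerset.finite_toSet).subset ?_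
  rintro _ ⟨l, hl, rfl⟩
  simp only [Finset.coe_powerset, Set.mem_preimage, Set.mem_powerset_iff]
  intro a ha
  have ha : a ∈ l.parts := by simpa using ha
  have h1 : a ≤ l.parts.sum := List.single_le_sum (by simp) a ha
  have h2 : l.parts.sum ≤ d := hl
  simp only [Finset.coe_range, Set.mem_Iio]
  omega

theorem hasSum_subst {m : ℕ} {f : ι → Series n} {g : Series n} (h : HasSum f g)
    {s : Fin n → Series m} (hs : HasSubst s) :
    HasSum (fun i => (f i).subst s) (g.subst s) := by
  have := h.map (substAlgHom (R := LazardRing) hs) (by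
    rw [coe_substAlgHom]
    exact continuous_subst_lazard hs)
  rwa [coe_substAlgHom] at this

theorem hasSum_killCompl {f : ι → Series (n + 1)} {g : Series (n + 1)} (h : HasSum f g) :
    HasSum (fun i => killCompl (Fin.castSuccEmb : Fin n ↪ Fin (n + 1)) (f i))
      (killCompl Fin.castSuccEmb g) := by
  rw [WithPiTopology.hasSum_iff_hasSum_coeff] at h ⊢
  intro d
  simpa only [coeff_killCompl] using h (d.embDomain Fin.castSuccEmb)

theorem Gam_closed {f : ι → Series n} {g : Series n} (hf : ∀ i, f i ∈ Gam n) (h : HasSum f g) :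
    g ∈ Gam n := by
  refine ⟨fun w => ?_, fun i j hij => ?_⟩
  · have h1 := hasSum_subst h (hasSubst_X_comp w)
    rw [← rename_eq_subst] at h1
    refine h1.unique (h.congr_fun fun i => ?_)
    rw [← rename_eq_subst]
    exact (hf i).1 w
  · refine (hasSum_subst h (hasSubst_cancelSubst i j)).unique
      ((hasSum_subst h (hasSubst_zeroSubst₂ i j)).congr_fun fun k => ?_)
    exact (hf k).2 i j hij

theorem le_order_subst_zeroSubst (a : Fin n) (f : Series n) :
    f.order ≤ (f.subst (zeroSubst a)).order := by
  refine le_order fun d hd => ?_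
  rw [zeroSubst, coeff_subst_update_zero, coeff_of_lt_order hd, ite_self]

theorem order_double (a : Fin n) : (formalSum (X a : Series n) (X a)).order = 1 := by
  have ha := constantCoeff_X_eq_zero a
  refine le_antisymm ?_ (one_le_order_iff_constCoeff_eq_zero.mpr
    (constantCoeff_formalSum_eq_zero ha ha))
  have : lin a (formalSum (X a : Series n) (X a)) ≠ 0 := by
    rw [lin_formalSum _ ha ha, lin_X, if_pos rfl]
    norm_num
  simpa using order_le this

/-- Divisibility passes to the infinite sum because the quotients can be summed as well: `x_a ⊞ x_a`
has order 1, so each quotient loses at most one degree. -/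
theorem GamPlus_closed {deg : ι → ℕ} (hfin : ∀ d, {i | deg i ≤ d}.Finite) {b : ι → Series n}
    (hb : ∀ i, (deg i : ℕ∞) ≤ (b i).order) (hG : ∀ i, b i ∈ GamPlus n) {c : ι → LazardRing}
    {g : Series n} (h : HasSum (fun i => c i • b i) g) : g ∈ GamPlus n := by
  refine ⟨Gam_closed (fun i => (Gam n).smul_mem (hG i).1 _) h, fun a => ?_⟩
  choose q hq using fun i => (hG i).2 a
  have hqo : ∀ i, ((deg i - 1 : ℕ) : ℕ∞) ≤ (q i).order := by
    intro i
    have h1 : (deg i : ℕ∞) ≤ (b i - (b i).subst (zeroSubst a)).order := by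
      rw [sub_eq_add_neg]
      refine (le_min (hb i) ?_).trans min_order_le_add
      rw [order_neg]
      exact (hb i).trans (le_order_subst_zeroSubst a _)
    rw [hq i, order_mul, order_double] at h1
    have : ((deg i - 1 : ℕ) : ℕ∞) + 1 ≤ (q i).order + 1 ∨ deg i = 0 := by
      rcases Nat.eq_zero_or_pos (deg i) with h0 | h0
      · exact Or.inr h0
      · left
        rw [add_comm (q i).order]
        refine le_trans ?_ h1
        exact_mod_cast (by omega)
    rcases this with h2 | h2
    · exact (ENat.add_le_add_iff_right ENat.one_ne_top).mp h2
    · simp [h2]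
  have hfin' : ∀ d, {i | deg i - 1 ≤ d}.Finite := fun d =>
    (hfin (d + 1)).subset fun i hi => by
      simp only [Set.mem_ofPred_eq] at hi ⊢
      omega
  obtain ⟨q', hq'⟩ := summable_of_le_order hfin' hqo c
  refine ⟨q', (h.sub (hasSum_subst h (hasSubst_zeroSubst a))).unique
    ((hq'.mul_left (formalSum (X a) (X a))).congr_fun fun i => ?_)⟩
  rw [subst_smul (hasSubst_zeroSubst a), ← smul_sub, hq i, mul_smul_comm]

end

/-! ### Setting the last variable to zero -/

section

variable {n : ℕ}

theorem zero_subst {m : ℕ} {s : Fin n → Series m} (hs : HasSubst s) :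
    (0 : Series n).subst s = 0 := by
  rw [← coe_substAlgHom hs, map_zero]

theorem zeroSubst_self (i : Fin n) : zeroSubst i i = 0 := Function.update_self _ _ _

theorem zeroSubst_of_ne {i k : Fin n} (h : k ≠ i) : zeroSubst i k = X k :=
  Function.update_of_ne h _ _

theorem cancelSubst_self (i j : Fin n) : cancelSubst i j j = formalInv (X i) :=
  Function.update_self _ _ _

theorem cancelSubst_of_ne (i : Fin n) {j k : Fin n} (h : k ≠ j) : cancelSubst i j k = X k :=
  Function.update_of_ne h _ _

theorem zeroSubst₂_left (i j : Fin n) : zeroSubst₂ i j i = 0 := by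
  rcases eq_or_ne i j with rfl | h
  · exact Function.update_self _ _ _
  · rw [zeroSubst₂, Function.update_of_ne h, zeroSubst_self]

theorem zeroSubst₂_right (i j : Fin n) : zeroSubst₂ i j j = 0 := Function.update_self _ _ _

theorem zeroSubst₂_of_ne {i j k : Fin n} (hi : k ≠ i) (hj : k ≠ j) : zeroSubst₂ i j k = X k := by
  rw [zeroSubst₂, Function.update_of_ne hj, zeroSubst_of_ne hi]

theorem rename_castSuccEmb_subst_cancelSubst (g : Series n) (i j : Fin n) :
    rename Fin.castSuccEmb (g.subst (cancelSubst i j)) =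
      (rename Fin.castSuccEmb g).subst (cancelSubst i.castSucc j.castSucc) := by
  have h1 := hasSubst_cancelSubst i j
  have h2 := hasSubst_cancelSubst i.castSucc j.castSucc
  have h3 := hasSubst_X_comp (Fin.castSuccEmb : Fin n ↪ Fin (n + 1))
  rw [rename_eq_subst, rename_eq_subst, subst_comp_subst_apply h1 h3,
    subst_comp_subst_apply h3 h2]
  congr 1
  funext k
  rw [Function.comp_apply, subst_X h2, cancelSubst, cancelSubst, Fin.coe_castSuccEmb]
  rcases eq_or_ne k j with rfl | hkj
  · rw [Function.update_self, Function.update_self,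
      formalInv_subst (constantCoeff_X_eq_zero i) (Fin.coe_castSuccEmb ▸ h3),
      subst_X (Fin.coe_castSuccEmb ▸ h3)]
    rfl
  · rw [Function.update_of_ne hkj, Function.update_of_ne (by simpa using hkj),
      subst_X (Fin.coe_castSuccEmb ▸ h3)]
    rfl

theorem rename_castSuccEmb_subst_zeroSubst₂ (g : Series n) (i j : Fin n) :
    rename Fin.castSuccEmb (g.subst (zeroSubst₂ i j)) =
      (rename Fin.castSuccEmb g).subst (zeroSubst₂ i.castSucc j.castSucc) := by
  have h1 := hasSubst_zeroSubst₂ i j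
  have h2 := hasSubst_zeroSubst₂ i.castSucc j.castSucc
  have h3 := hasSubst_X_comp (Fin.castSuccEmb : Fin n ↪ Fin (n + 1))
  rw [rename_eq_subst, rename_eq_subst, subst_comp_subst_apply h1 h3,
    subst_comp_subst_apply h3 h2]
  congr 1
  funext k
  rw [Function.comp_apply, subst_X h2, Fin.coe_castSuccEmb]
  rw [Fin.coe_castSuccEmb] at h3
  rcases eq_or_ne k j with rfl | hkj
  · rw [zeroSubst₂_right, zeroSubst₂_right, zero_subst h3]
  rcases eq_or_ne k i with rfl | hki
  · rw [zeroSubst₂_left, zeroSubst₂_left, zero_subst h3]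
  · rw [zeroSubst₂_of_ne hki hkj, zeroSubst₂_of_ne (by simpa using hki) (by simpa using hkj),
      subst_X h3]
    rfl

/-- Checked after re-embedding into `n + 1` variables, where `killCompl` becomes `x_{n+1} ↦ 0`. That
substitution commutes with permutations fixing the last index and with both substitutions in the
earlier variables. -/
theorem killCompl_mem_Gam {f : Series (n + 1)} (hf : f ∈ Gam (n + 1)) :
    killCompl (Fin.castSuccEmb : Fin n ↪ Fin (n + 1)) f ∈ Gam n := by
  have hz := hasSubst_zeroSubst (Fin.last n)
  refine ⟨fun w => rename_injective Fin.castSuccEmb ?_, fun i j hij =>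
    rename_injective Fin.castSuccEmb ?_⟩
  · set w' := w.viaEmbedding (Fin.castSuccEmb : Fin n ↪ Fin (n + 1)) with hw'
    have hw1 : ∀ i : Fin n, w' i.castSucc = (w i).castSucc :=
      fun i => w.viaEmbedding_apply Fin.castSuccEmb i
    have hw2 : w' (Fin.last n) = Fin.last n :=
      w.viaEmbedding_apply_of_notMem Fin.castSuccEmb _ (by simp)
    have e1 : rename Fin.castSuccEmb (rename w (killCompl Fin.castSuccEmb f)) =
        rename w' (rename Fin.castSuccEmb (killCompl Fin.castSuccEmb f)) := by
      rw [rename_rename, rename_rename]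
      have : (Fin.castSuccEmb : Fin n ↪ Fin (n + 1)) ∘ w = w' ∘ Fin.castSuccEmb :=
        funext fun i => (hw1 i).symm
      simp only [this]
    rw [e1, rename_killCompl_castSuccEmb]
    have h3 := hasSubst_X_comp w'
    have e2 := hf.1 w'
    rw [rename_eq_subst] at e2 ⊢
    conv_rhs => rw [← e2]
    rw [subst_comp_subst_apply hz h3, subst_comp_subst_apply h3 hz]
    congr 1
    funext k
    rw [Function.comp_apply, subst_X hz, zeroSubst, ← coe_substAlgHom h3]
    rcases Fin.eq_castSucc_or_eq_last k with ⟨k, rfl⟩ | rfl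
    · rw [Function.update_of_ne (Fin.castSucc_ne_last k), hw1,
        Function.update_of_ne (Fin.castSucc_ne_last _), substAlgHom_apply, subst_X h3,
        Function.comp_apply, hw1]
    · rw [hw2, Function.update_self, map_zero]
  · rw [rename_castSuccEmb_subst_cancelSubst, rename_castSuccEmb_subst_zeroSubst₂,
      rename_killCompl_castSuccEmb]
    have hij' : i.castSucc ≠ j.castSucc := by simpa using hij
    have h1 := hasSubst_cancelSubst i.castSucc j.castSucc
    have h2 := hasSubst_zeroSubst₂ i.castSucc j.castSucc
    have e := congrArg (subst (zeroSubst (Fin.last n))) (hf.2 _ _ hij')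
    rw [subst_comp_subst_apply h1 hz, subst_comp_subst_apply h2 hz] at e
    rw [subst_comp_subst_apply hz h1, subst_comp_subst_apply hz h2]
    have e1 : (fun k => (zeroSubst (Fin.last n) k).subst (cancelSubst i.castSucc j.castSucc)) =
        fun k => (cancelSubst i.castSucc j.castSucc k).subst (zeroSubst (Fin.last n)) := by
      funext k
      rcases eq_or_ne k (Fin.last n) with rfl | hk
      · rw [cancelSubst_of_ne _ (Fin.castSucc_ne_last j).symm, subst_X hz, zeroSubst_self,
          zero_subst h1]
      · rw [zeroSubst_of_ne hk, subst_X h1]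
        rcases eq_or_ne k j.castSucc with rfl | hkj
        · rw [cancelSubst_self, formalInv_subst (constantCoeff_X_eq_zero _) hz, subst_X hz,
            zeroSubst_of_ne (Fin.castSucc_ne_last i)]
        · rw [cancelSubst_of_ne _ hkj, subst_X hz, zeroSubst_of_ne hk]
    have e2 : (fun k => (zeroSubst (Fin.last n) k).subst (zeroSubst₂ i.castSucc j.castSucc)) =
        fun k => (zeroSubst₂ i.castSucc j.castSucc k).subst (zeroSubst (Fin.last n)) := by
      funext k
      rcases eq_or_ne k (Fin.last n) with rfl | hk
      · rw [zeroSubst₂_of_ne (Fin.castSucc_ne_last i).symm (Fin.castSucc_ne_last j).symm,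
          subst_X hz, zeroSubst_self, zero_subst h2]
      · rw [zeroSubst_of_ne hk, subst_X h2]
        rcases eq_or_ne k j.castSucc with rfl | hkj
        · rw [zeroSubst₂_right, zero_subst hz]
        rcases eq_or_ne k i.castSucc with rfl | hki
        · rw [zeroSubst₂_left, zero_subst hz]
        · rw [zeroSubst₂_of_ne hki hkj, subst_X hz, zeroSubst_of_ne hk]
    rw [e1, e2, e]

theorem killCompl_mem_GamPlus {f : Series (n + 1)} (hf : f ∈ GamPlus (n + 1)) :
    killCompl (Fin.castSuccEmb : Fin n ↪ Fin (n + 1)) f ∈ GamPlus n := by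
  refine ⟨killCompl_mem_Gam hf.1, fun i => ?_⟩
  have h3 := hasSubst_X_comp (Fin.castSuccEmb : Fin n ↪ Fin (n + 1))
  have hi := constantCoeff_X_eq_zero i
  have e1 : formalSum (X i.castSucc) (X i.castSucc) =
      rename Fin.castSuccEmb (formalSum (X i) (X i) : Series n) := by
    rw [rename_eq_subst, formalSum_subst hi hi h3, subst_X h3]
    rfl
  have e2 : killCompl Fin.castSuccEmb (f.subst (zeroSubst i.castSucc)) =
      (killCompl Fin.castSuccEmb f).subst (zeroSubst i) := by
    ext d
    rw [coeff_killCompl, zeroSubst, coeff_subst_update_zero, zeroSubst, coeff_subst_update_zero,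
      coeff_killCompl]
    refine if_congr ?_ rfl rfl
    rw [← Fin.coe_castSuccEmb, Finsupp.embDomain_apply_self]
  have := map_dvd (killCompl (R := LazardRing) Fin.castSuccEmb) (hf.2 i.castSucc)
  rwa [e1, killCompl_rename_app, map_sub, e2] at this

end

/-! ### Divisibility of series that vanish when one variable is zero -/

section

variable {n : ℕ}

/-- Iterating the step gives `g = c (∑_{k<K} x_b^k y_k) + x_b^K g_K` for every `K`; the sums
converge `x_b`-adically to the quotient. -/
theorem dvd_of_forall_step {b : Fin n} {c : Series n} (P : Series n → Prop)
    (step : ∀ g, P g → ∃ y g', g = c * y + X b * g' ∧ P g') {g : Series n} (hg : P g) : c ∣ g := by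
  choose! y g' h1 h2 using step
  set G : ℕ → Series n := fun k => g'^[k] g with hG
  have hP : ∀ k, P (G k) := by
    intro k
    induction k with
    | zero => exact hg
    | succ k ih =>
      rw [hG]
      simp only [Function.iterate_succ_apply']
      exact h2 _ ih
  set Y : ℕ → Series n := fun K => ∑ k ∈ Finset.range K, X b ^ k * y (G k) with hY
  have e : ∀ K, g = c * Y K + X b ^ K * G K := by
    intro K
    induction K with
    | zero => simp [hY, hG]
    | succ K ih =>
      have e1 : G (K + 1) = g' (G K) := Function.iterate_succ_apply' _ _ _
      have e2 : Y (K + 1) = Y K + X b ^ K * y (G K) := Finset.sum_range_succ _ _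
      rw [e1, e2]
      conv_lhs => rw [ih, h1 _ (hP K)]
      ring
  have hdvd : ∀ M K, M ≤ K → X b ^ M ∣ Y K - Y M := by
    intro M K hMK
    rw [hY]
    simp only
    rw [← Finset.sum_Ico_eq_sub _ hMK]
    exact Finset.dvd_sum fun k hk => (pow_dvd_pow _ (Finset.mem_Ico.mp hk).1).mul_right _
  -- From index `d b + 1` on, the partial sums agree modulo `x_b^(d b + 1)`, so their coefficient at
  -- `d` is final.
  set Z : Series n := fun d => coeff d (Y (d b + 1)) with hZ
  have hdvd' : ∀ K, X b ^ K ∣ Y K - Z := by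
    intro K
    rw [X_pow_dvd_iff]
    intro d hd
    have := X_pow_dvd_iff.mp (hdvd (d b + 1) K hd) d (Nat.lt_succ_self _)
    rw [map_sub] at this ⊢
    exact this
  refine ⟨Z, ?_⟩
  rw [← sub_eq_zero]
  ext d
  have : X b ^ (d b + 1) ∣ g - c * Z := by
    have e1 : g - c * Z = c * (Y (d b + 1) - Z) + X b ^ (d b + 1) * G (d b + 1) := by
      conv_lhs => rw [e (d b + 1)]
      ring
    rw [e1]
    exact dvd_add ((hdvd' _).mul_left _) (Dvd.intro _ rfl)
  exact X_pow_dvd_iff.mp this d (Nat.lt_succ_self _)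

/-! ### Divisibility by the heads `h(x_a)` -/

/-- The conditions on a power series `h` under which the power functions `h(t) t^{k-1}` give bases:
`h` has no constant term, its linear coefficient is nonzero, and the latter is a non-zero-divisor
modulo `h(x_a)`. -/
structure IsHead (h : PowerSeries LazardRing) : Prop where
  constantCoeff : PowerSeries.constantCoeff h = 0
  coeff_one : PowerSeries.coeff 1 h ≠ 0
  dvd_of_dvd_mul : ∀ (n : ℕ) (a : Fin n) (y : Series n),
    h.subst (X a : Series n) ∣ C (PowerSeries.coeff 1 h) * y → h.subst (X a : Series n) ∣ y

theorem exists_head_eq {h : PowerSeries LazardRing} (H : IsHead h) (a : Fin n) :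
    ∃ w : Series n, h.subst (X a : Series n) = X a * w ∧
      w.subst (zeroSubst a) = C (PowerSeries.coeff 1 h) := by
  obtain ⟨w, hw⟩ := PowerSeries.X_dvd_iff.mpr H.constantCoeff
  have hX := hasSubst_of_constCoeff (constantCoeff_X_eq_zero a)
  refine ⟨w.subst (X a), ?_, ?_⟩
  · rw [hw, PowerSeries.subst_mul hX, PowerSeries.subst_X hX]
  · rw [powerSeries_subst_subst w (hasSubst_zeroSubst a), zeroSubst_self,
      PowerSeries.subst_zero_eq_C_constantCoeff, map_C, hw, ← zero_add 1,
      PowerSeries.coeff_succ_X_mul]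
    rw [PowerSeries.coeff_zero_eq_constantCoeff_apply]
    rfl

theorem omits_head {h : PowerSeries LazardRing} {a b : Fin n} (hab : a ≠ b) :
    Omits b (h.subst (X a : Series n)) := by
  rw [Omits, powerSeries_subst_subst h (hasSubst_update (map_zero _)), Function.update_of_ne hab]

theorem lin_head {h : PowerSeries LazardRing} (H : IsHead h) (k a : Fin n) :
    lin k (h.subst (X a : Series n)) = if k = a then PowerSeries.coeff 1 h else 0 := by
  obtain ⟨w, hw, hw0⟩ := exists_head_eq H a
  rw [hw, lin_mul _ (constantCoeff_X_eq_zero a), lin_X]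
  split_ifs
  · have := coeff_subst_update_zero a w 0
    rw [← zeroSubst, hw0, if_pos (by simp)] at this
    rw [one_mul, ← coeff_zero_eq_constantCoeff_apply, ← this, coeff_zero_C]
  · rw [zero_mul]

theorem head_ne_zero {h : PowerSeries LazardRing} (H : IsHead h) (a : Fin n) :
    h.subst (X a : Series n) ≠ 0 := by
  intro h0
  have := lin_head H a a
  rw [h0, if_pos rfl, lin, map_zero] at this
  exact H.coeff_one this.symm

theorem prime_X (a : Fin n) : Prime (X a : Series n) := by
  simpa using prime_X_sub (map_zero _) (omits_zero (b := a))

theorem X_not_dvd_head {h : PowerSeries LazardRing} (H : IsHead h) {a b : Fin n} (hab : a ≠ b) :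
    ¬ (X b : Series n) ∣ h.subst (X a : Series n) := by
  rw [X_dvd_iff_subst, omits_head hab]
  exact head_ne_zero H a

/-- Since `t ⊞ t` is a multiple of `t` and not a prime, no argument with primes applies to the
heads. Write `h(x_b) = x_b w` and `c = h(x_a)`; the prime `x_b` can be cancelled. If `c ∣ w g`,
setting `x_b = 0` gives `c ∣ h_1 g(x_b = 0)` with `h_1` the linear coefficient of `h`, so `c ∣ g(x_b
= 0)` by `IsHead`. Hence `g = c y + x_b g'` with again `c ∣ w g'`, and the iteration lemma
concludes. -/
theorem head_dvd_of_dvd_mul {h : PowerSeries LazardRing} (H : IsHead h) {a b : Fin n}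
    (hab : a ≠ b) {g : Series n}
    (hg : h.subst (X a : Series n) ∣ h.subst (X b : Series n) * g) :
    h.subst (X a : Series n) ∣ g := by
  obtain ⟨w, hw, hw0⟩ := exists_head_eq H b
  set c : Series n := h.subst (X a : Series n) with hc
  have hcancel : ∀ y, c ∣ X b * y → c ∣ y := by
    intro y hy
    refine dvd_of_dvd_prod_pow_mul (p := fun _ : Unit => (X b : Series n)) (fun _ => 1)
      Finset.univ (fun _ _ => prime_X b) (fun _ _ => X_not_dvd_head H hab) ?_
    simpa using hy
  have hz := hasSubst_zeroSubst b
  rw [hw, mul_assoc] at hg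
  refine dvd_of_forall_step (b := b) (fun g => c ∣ w * g) (fun g hg => ?_) (hcancel _ hg)
  obtain ⟨y, hy⟩ : c ∣ g.subst (zeroSubst b) := by
    refine H.dvd_of_dvd_mul n a _ ?_
    have := map_dvd (substAlgHom (R := LazardRing) hz) hg
    rw [map_mul, substAlgHom_apply, substAlgHom_apply, substAlgHom_apply, hw0] at this
    have e : c.subst (zeroSubst b) = c := omits_head hab
    rwa [e] at this
  obtain ⟨g', hg'⟩ : X b ∣ g - g.subst (zeroSubst b) := by
    rw [X_dvd_iff_subst]
    change (g - g.subst (zeroSubst b)).subst (zeroSubst b) = 0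
    rw [subst_sub hz, sub_eq_zero, subst_comp_subst_apply hz hz]
    congr 1
    funext k
    rcases eq_or_ne k b with rfl | hk
    · rw [zeroSubst_self, zero_subst hz]
    · rw [zeroSubst_of_ne hk, subst_X hz, zeroSubst_of_ne hk]
  have e : g = c * y + X b * g' := by
    rw [← hy, ← hg']
    ring
  refine ⟨y, g', e, hcancel _ ?_⟩
  have : X b * (w * g') = w * g - c * (w * y) := by
    rw [e]
    ring
  rw [this]
  exact dvd_sub hg (Dvd.intro _ rfl)

theorem prod_head_dvd {h : PowerSeries LazardRing} (H : IsHead h) {g : Series n}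
    (hg : ∀ a : Fin n, h.subst (X a : Series n) ∣ g) (s : Finset (Fin n)) :
    ∏ a ∈ s, h.subst (X a : Series n) ∣ g := by
  induction s using Finset.induction_on with
  | empty => simp
  | insert a s ha ih =>
    obtain ⟨q, hq⟩ := ih
    rw [Finset.prod_insert ha, mul_comm]
    have h1 := hg a
    rw [hq] at h1 ⊢
    refine mul_dvd_mul_left _ ?_
    clear hq hg
    induction s using Finset.induction_on with
    | empty => simpa using h1
    | insert b s hb ih =>
      rw [Finset.prod_insert hb, mul_assoc] at h1
      refine ih (fun h => ha (Finset.mem_insert_of_mem h)) (head_dvd_of_dvd_mul H ?_ h1)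
      rintro rfl
      exact ha (Finset.mem_insert_self _ _)

theorem not_fnum_dvd_fnum {a b c d : Fin n} (h1 : a < b) (h2 : c < d) (h : (a, b) ≠ (c, d)) :
    ¬ fnum a b ∣ fnum c d := by
  have hk : ∃ k, (k = a ∨ k = b) ∧ k ≠ c ∧ k ≠ d := by
    by_cases ha : a ≠ c ∧ a ≠ d
    · exact ⟨a, Or.inl rfl, ha⟩
    · refine ⟨b, Or.inr rfl, ?_, ?_⟩ <;> rintro rfl
      · grind
      · grind
  have hl : ∃ l, (l = c ∨ l = d) ∧ l ≠ a ∧ l ≠ b := by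
    by_cases hc : c ≠ a ∧ c ≠ b
    · exact ⟨c, Or.inl rfl, hc⟩
    · refine ⟨d, Or.inr rfl, ?_, ?_⟩ <;> rintro rfl
      · grind
      · grind
  obtain ⟨k, hk1, hk2, hk3⟩ := hk
  obtain ⟨l, hl1, hl2, hl3⟩ := hl
  have e1 : ∀ {x p q : Fin n}, p < q → (x = p ∨ x = q) → lin x (fnum p q) = 1 := by
    rintro x p q hpq (rfl | rfl)
    · simp [lin_fnum, hpq.ne]
    · simp [lin_fnum, hpq.ne']
  have e2 : ∀ {x p q : Fin n}, x ≠ p → x ≠ q → lin x (fnum p q) = 0 := by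
    intro x p q hp hq
    simp [lin_fnum, hp, hq]
  refine not_dvd_of_lin (constantCoeff_fnum a b) k l ?_
  rw [e1 h1 hk1, e1 h2 hl1, e2 hl2 hl3, e2 hk2 hk3, one_mul, zero_mul]
  exact one_ne_zero

theorem not_fnum_dvd_head {h : PowerSeries LazardRing} (H : IsHead h) {i j : Fin n} (hij : i ≠ j)
    (a : Fin n) : ¬ fnum i j ∣ h.subst (X a : Series n) := by
  obtain ⟨k, hk, hka⟩ : ∃ k, lin k (fnum i j) ≠ 0 ∧ k ≠ a := by
    rcases eq_or_ne i a with rfl | hia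
    · exact ⟨j, by simp [lin_fnum, hij.symm], hij.symm⟩
    · exact ⟨i, by simp [lin_fnum, hij], hia⟩
  refine not_dvd_of_lin (constantCoeff_fnum i j) k a ?_
  rw [lin_head H, lin_head H, if_pos rfl, if_neg hka, mul_zero]
  exact mul_ne_zero hk H.coeff_one

theorem prod_filter_lt {A : Type*} [CommMonoid A] (f : Fin n → Fin n → A) :
    ∏ p ∈ Finset.univ.filter (fun p : Fin n × Fin n => p.1 < p.2), f p.1 p.2 =
      ∏ i, ∏ j ∈ Finset.Ioi i, f i j := by
  rw [Finset.prod_finset_product _ Finset.univ (fun i => Finset.Ioi i)]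
  intro p
  simp

/-- The product of the `x_i ⊞ x_j` for `i < j`. -/
def fnumProd (n : ℕ) : Series n := ∏ i, ∏ j ∈ Finset.Ioi i, fnum i j

/-- Supersymmetry gives `f(t, χ(t), …) = f(0, 0, …) = 0`, so each prime `x_i ⊞ x_j` divides `f`.
None of them divides a head, so the heads divide the quotient by their product, and the heads are
regular modulo one another. -/
theorem Gam_dvd {h : PowerSeries LazardRing} (H : IsHead h) {f : Series n} (hf : f ∈ Gam n)
    (hX : ∀ a : Fin n, X a ∣ f) (hh : ∀ a : Fin n, h.subst (X a : Series n) ∣ f) :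
    (∏ a, h.subst (X a : Series n)) * fnumProd n ∣ f := by
  have hp : ∀ p ∈ Finset.univ.filter (fun p : Fin n × Fin n => p.1 < p.2),
      Prime (fnum p.1 p.2) := fun p hp => prime_fnum (by simpa using hp : p.1 < p.2).ne
  have e : fnumProd n = ∏ p ∈ Finset.univ.filter (fun p : Fin n × Fin n => p.1 < p.2),
      fnum p.1 p.2 ^ 1 := by
    simp only [pow_one]
    exact (prod_filter_lt _).symm
  obtain ⟨g, hg⟩ : fnumProd n ∣ f := by
    rw [e]
    refine prod_pow_dvd_of_prime (fun _ => 1) _ hp (fun p hp q hq hpq => ?_) (fun p hp => ?_)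
    · exact not_fnum_dvd_fnum (by simpa using hp) (by simpa using hq) hpq
    · have hne : p.1 ≠ p.2 := (by simpa using hp : p.1 < p.2).ne
      rw [pow_one, fnum_dvd_iff hne, hf.2 _ _ hne]
      obtain ⟨q, rfl⟩ := hX p.1
      have hz := hasSubst_zeroSubst₂ p.1 p.2
      rw [subst_mul hz, subst_X hz, zeroSubst₂_left, zero_mul]
  rw [hg, mul_comm]
  refine mul_dvd_mul_left _ (prod_head_dvd H (fun a => ?_) _)
  refine dvd_of_dvd_prod_pow_mul (fun _ => 1) _ hp (fun p hp =>
    not_fnum_dvd_head H (by simpa using hp : p.1 < p.2).ne a) ?_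
  rw [← e, ← hg]
  exact hh a

/-! ### The heads `t` and `t ⊞ t` -/

theorem isHead_X : IsHead PowerSeries.X where
  constantCoeff := by simp
  coeff_one := by simp
  dvd_of_dvd_mul n a y := by simp

/-- Reduction of coefficients modulo the prime 2 maps to a power series ring over a domain, and its
kernel consists of the multiples of 2. -/
theorem two_dvd_of_two_dvd_mul {f g : Series n} (hf : ¬ (2 : Series n) ∣ f)
    (h : (2 : Series n) ∣ f * g) : (2 : Series n) ∣ g := by
  set π := Ideal.Quotient.mk (Ideal.span {(2 : LazardRing)})
  have : (Ideal.span {(2 : LazardRing)}).IsPrime :=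
    (Ideal.span_singleton_prime prime_two_lazardRing.ne_zero).mpr prime_two_lazardRing
  have key : ∀ f : Series n, (2 : Series n) ∣ f ↔ map π f = 0 := by
    intro f
    constructor
    · rintro ⟨q, rfl⟩
      rw [map_mul, map_ofNat]
      have : (2 : MvPowerSeries (Fin n) (LazardRing ⧸ Ideal.span {(2 : LazardRing)})) = 0 := by
        have h2 : π 2 = 0 := Ideal.Quotient.eq_zero_iff_mem.mpr (Ideal.mem_span_singleton_self _)
        rw [← map_ofNat (C.comp π), RingHom.comp_apply, h2, map_zero]
      rw [this, zero_mul]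
    · intro h0
      have : ∀ d, ∃ r : LazardRing, coeff d f = 2 * r := by
        intro d
        have := congrArg (coeff d) h0
        rw [coeff_map, map_zero, Ideal.Quotient.eq_zero_iff_mem, Ideal.mem_span_singleton] at this
        exact this
      choose r hr using this
      let q : Series n := r
      refine ⟨q, ?_⟩
      ext d
      rw [two_mul, map_add, hr, two_mul]
      rfl
  rw [key] at *
  rw [map_mul] at h
  exact (mul_eq_zero.mp h).resolve_left hf

theorem three_le_order_universalSeries_sub :
    3 ≤ (universalSeries -
      (X 0 + X 1 + coeff (pair 1 1) universalSeries • (X 0 * X 1))).order := by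
  refine le_order fun d hd => ?_
  have hd' : d.degree < 3 := by exact_mod_cast hd
  rw [← pair_eta d, degree_pair] at hd'
  rw [← pair_eta d]
  have e : (X 0 + X 1 + coeff (pair 1 1) universalSeries • (X 0 * X 1) :
      MvPowerSeries (Fin 2) LazardRing) = X 0 ^ 1 * X 1 ^ 0 + X 0 ^ 0 * X 1 ^ 1 +
        coeff (pair 1 1) universalSeries • (X 0 ^ 1 * X 1 ^ 1) := by
    simp only [pow_one, pow_zero, mul_one, one_mul]
  rw [e, map_sub, map_add, map_add, coeff_smul, coeff_X_zero_pow_mul_X_one_pow,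
    coeff_X_zero_pow_mul_X_one_pow, coeff_X_zero_pow_mul_X_one_pow]
  generalize d 0 = i at *
  generalize d 1 = j at *
  have : (i = 0 ∧ j = 0) ∨ (i = 1 ∧ j = 0) ∨ (i = 0 ∧ j = 1) ∨ (i = 2 ∧ j = 0) ∨
      (i = 1 ∧ j = 1) ∨ (i = 0 ∧ j = 2) := by omega
  rcases this with ⟨rfl, rfl⟩ | ⟨rfl, rfl⟩ | ⟨rfl, rfl⟩ | ⟨rfl, rfl⟩ | ⟨rfl, rfl⟩ | ⟨rfl, rfl⟩ <;>
    simp [coeff_universalSeries]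

theorem coeff_two_double (a : Fin n) :
    coeff (Finsupp.single a 2) (formalSum (X a : Series n) (X a)) =
      coeff (pair 1 1) universalSeries := by
  have ha := constantCoeff_X_eq_zero a
  have hs := hasSubst_pair ha ha
  have h := le_order_subst hs
    (universalSeries - (X 0 + X 1 + coeff (pair 1 1) universalSeries • (X 0 * X 1)))
  have h1 : (1 : ℕ∞) ≤ ⨅ i, (![X a, X a] i : Series n).order := by
    refine le_iInf fun i => one_le_order_iff_constCoeff_eq_zero.mpr ?_
    fin_cases i <;> exact ha
  have h2 := (mul_le_mul' h1 three_le_order_universalSeries_sub).trans h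
  rw [one_mul, subst_sub hs, subst_add hs, subst_add hs, subst_X hs, subst_X hs, subst_smul hs,
    subst_mul hs, subst_X hs, subst_X hs] at h2
  have h3 := coeff_of_lt_order (d := Finsupp.single a 2) (lt_of_lt_of_le (by simp; norm_cast) h2)
  rw [map_sub, sub_eq_zero] at h3
  refine Eq.trans h3 ?_
  change coeff _ (X a + X a + coeff (pair 1 1) universalSeries • (X a * X a : Series n)) = _
  rw [← sq, map_add, map_add, coeff_smul, coeff_X_pow, coeff_X]
  simp [Finsupp.single_eq_single_iff]

/-- The linear coefficient is 2. In `2 y = (x_a ⊞ x_a) q` the prime 2 does not divide `x_a ⊞ x_a`,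
whose coefficient at `x_a^2` is `a_{1,1}`; hence it divides `q` and can be cancelled. -/
theorem isHead_doubleSeries : IsHead doubleSeries := by
  have hX : constantCoeff (PowerSeries.X : PowerSeries LazardRing) = 0 := by simp [PowerSeries.X]
  have h1 : PowerSeries.coeff 1 doubleSeries = 2 := by
    change lin () doubleSeries = 2
    have : lin () (PowerSeries.X : PowerSeries LazardRing) = 1 := lin_X () ()
    rw [doubleSeries, lin_formalSum _ hX hX, this]
    norm_num
  refine ⟨constantCoeff_doubleSeries, by rw [h1]; exact two_ne_zero, fun n a y => ?_⟩
  rw [h1, doubleSeries_subst (constantCoeff_X_eq_zero a)]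
  rintro ⟨q, hq⟩
  have h2 : C (2 : LazardRing) = (2 : Series n) := map_ofNat _ _
  rw [h2] at hq
  obtain ⟨q', rfl⟩ : (2 : Series n) ∣ q := by
    refine two_dvd_of_two_dvd_mul (f := formalSum (X a) (X a)) ?_ ⟨y, hq.symm⟩
    rintro ⟨r, hr⟩
    refine not_two_dvd_coeff ⟨coeff (Finsupp.single a 2) r, ?_⟩
    rw [← coeff_two_double a, hr, two_mul, two_mul, map_add]
  refine ⟨q', mul_left_cancel₀ (two_ne_zero (α := Series n)) ?_⟩
  rw [hq]
  ring

end

/-! ### Antisymmetric series -/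

section

variable {n : ℕ}

theorem coeff_rename_perm (w : Equiv.Perm (Fin n)) (f : Series n) (d : Fin n →₀ ℕ) :
    coeff d (rename w f) = coeff (d.equivMapDomain w.symm) f := by
  have h := coeff_embDomain_rename w.toEmbedding f (d.equivMapDomain w.symm)
  have e : (d.equivMapDomain w.symm).embDomain w.toEmbedding = d := by
    ext i
    obtain ⟨j, rfl⟩ := w.surjective i
    rw [← Equiv.coe_toEmbedding, Finsupp.embDomain_apply_self]
    rfl
  rw [e] at h
  exact h

theorem degree_equivMapDomain (w : Equiv.Perm (Fin n)) (d : Fin n →₀ ℕ) :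
    (d.equivMapDomain w).degree = d.degree := by
  rw [Finsupp.degree_eq_sum, Finsupp.degree_eq_sum]
  exact Equiv.sum_comp w.symm d

/-- Antisymmetric power series. -/
def IsAnti (f : Series n) : Prop :=
  ∀ w : Equiv.Perm (Fin n), rename w f = (Equiv.Perm.sign w : ℤ) • f

/-- The antisymmetrisation of a power series. -/
def alt (f : Series n) : Series n := ∑ w : Equiv.Perm (Fin n), (Equiv.Perm.sign w : ℤ) • rename w f

theorem sign_mul_self (w : Equiv.Perm (Fin n)) :
    (Equiv.Perm.sign w : ℤ) * (Equiv.Perm.sign w : ℤ) = 1 := by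
  rw [← Units.val_mul, Int.units_mul_self, Units.val_one]

theorem isAnti_alt (f : Series n) : IsAnti (alt f) := by
  intro v
  rw [alt, map_sum, Finset.smul_sum]
  refine Fintype.sum_equiv (Equiv.mulLeft v) _ _ fun w => ?_
  rw [Equiv.coe_mulLeft, map_zsmul, rename_rename, Equiv.Perm.sign_mul, smul_smul, Units.val_mul,
    ← mul_assoc, sign_mul_self, one_mul]
  rfl

/-- Sorting an injective exponent changes its coefficient by a sign only. At an exponent with a
repeated entry a transposition gives `2 * coeff d f = 0`, and `𝕃` has no 2-torsion. -/
theorem IsAnti.eq_zero {f : Series n} (hf : IsAnti f)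
    (h : ∀ d : Fin n →₀ ℕ, StrictAnti d → coeff d f = 0) : f = 0 := by
  ext d
  rw [map_zero]
  have key : ∀ w : Equiv.Perm (Fin n), coeff (d.equivMapDomain w.symm) f =
      (Equiv.Perm.sign w : ℤ) • coeff d f := fun w => by
    rw [← coeff_rename_perm, hf w, map_zsmul]
  by_cases hd : Function.Injective d
  · set w : Equiv.Perm (Fin n) := Fin.revPerm.trans (Tuple.sort d) with hw
    have h1 : StrictMono (d ∘ Tuple.sort d) :=
      (Tuple.monotone_sort d).strictMono_of_injective (hd.comp (Equiv.injective _))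
    have h2 := key w
    rw [h] at h2
    · have := congrArg ((Equiv.Perm.sign w : ℤ) • ·) h2
      simpa [smul_smul, sign_mul_self] using this
    · intro i j hij
      rw [Finsupp.equivMapDomain_apply, Finsupp.equivMapDomain_apply]
      exact h1 (Fin.rev_lt_rev.mpr hij)
  · obtain ⟨i, j, hij, hne⟩ : ∃ i j, d i = d j ∧ i ≠ j := by
      simpa [Function.Injective] using hd
    have h1 := key (Equiv.swap i j)
    have h2 : d.equivMapDomain (Equiv.swap i j).symm = d := by
      ext k
      rw [Finsupp.equivMapDomain_apply, Equiv.symm_symm]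
      rcases eq_or_ne k i with rfl | hki
      · rw [Equiv.swap_apply_left, hij]
      rcases eq_or_ne k j with rfl | hkj
      · rw [Equiv.swap_apply_right, hij]
      · rw [Equiv.swap_apply_of_ne_of_ne hki hkj]
    rw [h2, Equiv.Perm.sign_swap hne] at h1
    have h3 : (2 : LazardRing) * coeff d f = 0 := by
      simp at h1
      linear_combination h1
    exact (mul_eq_zero.mp h3).resolve_left two_ne_zero

theorem coeff_alt (f : Series n) (d : Fin n →₀ ℕ) : coeff d (alt f) =
    ∑ w : Equiv.Perm (Fin n), (Equiv.Perm.sign w : ℤ) • coeff (d.equivMapDomain w.symm) f := by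
  rw [alt, map_sum]
  exact Finset.sum_congr rfl fun w _ => by rw [map_zsmul, coeff_rename_perm]

theorem eq_one_of_strictAnti {d : Fin n →₀ ℕ} (hd : StrictAnti d) (w : Equiv.Perm (Fin n))
    (hw : StrictAnti (d.equivMapDomain w.symm)) : w = 1 := by
  have h1 : StrictMono w := fun i j hij => hd.lt_iff_gt.mp (hw hij)
  have : id ∘ (w : Fin n → Fin n) = id ∘ (1 : Equiv.Perm (Fin n)) :=
    Tuple.unique_monotone h1.monotone monotone_id
  exact Equiv.ext fun i => congrFun this i

/-- Every term of `x^e U` other than `x^e` has degree above that of `e`, and a permutation of one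
strictly decreasing exponent is strictly decreasing only if it is the identity. -/
theorem coeff_alt_monomial_mul {U : Series n} (hU : constantCoeff U = 1) {d e : Fin n →₀ ℕ}
    (hd : StrictAnti d) (he : StrictAnti e) (hde : d.degree ≤ e.degree) :
    coeff d (alt (monomial e 1 * U)) = if d = e then 1 else 0 := by
  have key : ∀ w : Equiv.Perm (Fin n), coeff (d.equivMapDomain w.symm) (monomial e 1 * U) =
      if w = 1 ∧ d = e then 1 else 0 := by
    intro w
    rw [coeff_monomial_mul]
    have h1 : d.equivMapDomain w.symm = e ↔ w = 1 ∧ d = e := by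
      constructor
      · intro h
        have hw := eq_one_of_strictAnti hd w (h ▸ he)
        refine ⟨hw, ?_⟩
        rw [← h, hw]
        ext
        rfl
      · rintro ⟨rfl, rfl⟩
        ext
        rfl
    have h2 : e ≤ d.equivMapDomain w.symm ↔ w = 1 ∧ d = e := by
      rw [← h1]
      refine ⟨fun h => ?_, fun h => h.ge⟩
      obtain ⟨t, ht⟩ := le_iff_exists_add.mp h
      have := congrArg Finsupp.degree ht
      rw [degree_equivMapDomain, map_add] at this
      have ht0 : t = 0 := (Finsupp.degree_eq_zero_iff t).mp (by omega)
      rw [ht, ht0, add_zero]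
    refine if_ctx_congr h2 (fun h => ?_) fun _ => rfl
    rw [h1.mpr h, tsub_self, coeff_zero_eq_constantCoeff_apply, hU, mul_one]
  rw [coeff_alt, Finset.sum_eq_single 1]
  · rw [key]
    simp
  · intro w _ hw
    rw [key, if_neg (fun h => hw h.1), smul_zero]
  · simp

theorem le_order_alt_monomial_mul (U : Series n) (e : Fin n →₀ ℕ) :
    (e.degree : ℕ∞) ≤ (alt (monomial e 1 * U)).order := by
  refine le_order fun d hd => ?_
  rw [coeff_alt]
  refine Finset.sum_eq_zero fun w _ => ?_
  rw [coeff_monomial_mul, if_neg, smul_zero]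
  intro h
  have h1 := Finsupp.degree_mono h
  rw [degree_equivMapDomain] at h1
  have : d.degree < e.degree := by exact_mod_cast hd
  omega

/-- The matrix is the identity within each degree and zero towards higher degrees, so the system is
solved by recursion on the degree. -/
theorem exists_triangular {ι R : Type*} [CommRing R] [DecidableEq ι] {deg : ι → ℕ}
    (s : ι → Finset ι) (hs : ∀ i j, j ∈ s i ↔ deg j ≤ deg i) {M : ι → ι → R}
    (hM : ∀ i j, deg i ≤ deg j → M i j = if i = j then 1 else 0) (A : ι → R) :
    ∃ c : ι → R, ∀ i, ∑ j ∈ s i, M i j * c j = A i := by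
  let c : ι → R := (measure deg).wf.fix fun i rec =>
    A i - ∑ j ∈ s i, if h : deg j < deg i then M i j * rec j h else 0
  have hc : ∀ i, c i = A i - ∑ j ∈ s i, if deg j < deg i then M i j * c j else 0 := by
    intro i
    have := (measure deg).wf.fix_eq (C := fun _ => R) (fun i rec =>
      A i - ∑ j ∈ s i, if h : deg j < deg i then M i j * rec j h else 0) i
    refine this.trans ?_
    congr 1
  refine ⟨c, fun i => ?_⟩
  have h1 : ∑ j ∈ s i, M i j * c j =
      ∑ j ∈ s i, ((if deg j < deg i then M i j * c j else 0) + if i = j then c j else 0) := by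
    refine Finset.sum_congr rfl fun j hj => ?_
    split_ifs with h2 h3 h3
    · subst h3
      exact absurd h2 (lt_irrefl _)
    · rw [add_zero]
    · rw [hM i j (not_lt.mp h2), if_pos h3, one_mul, zero_add]
    · rw [hM i j (not_lt.mp h2), if_neg h3, zero_mul, zero_add]
  rw [h1, Finset.sum_add_distrib, Finset.sum_ite_eq, if_pos ((hs i i).mpr le_rfl)]
  conv_lhs => rw [hc i]
  ring

theorem triangular_eq_zero {ι R : Type*} [CommRing R] [DecidableEq ι] {deg : ι → ℕ}
    (s : ι → Finset ι) (hs : ∀ i j, j ∈ s i ↔ deg j ≤ deg i) {M : ι → ι → R}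
    (hM : ∀ i j, deg i ≤ deg j → M i j = if i = j then 1 else 0) {c : ι → R}
    (h : ∀ i, ∑ j ∈ s i, M i j * c j = 0) (i : ι) : c i = 0 := by
  induction hd : deg i using Nat.strong_induction_on generalizing i with
  | _ d ih =>
    rw [← h i, Finset.sum_eq_single i, hM i i le_rfl, if_pos rfl, one_mul]
    · intro j hj hji
      rcases lt_or_ge (deg j) (deg i) with h1 | h1
      · rw [ih _ (hd ▸ h1) j rfl, mul_zero]
      · rw [hM i j h1, if_neg hji.symm, zero_mul]
    · exact fun h1 => absurd ((hs i i).mpr le_rfl) h1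

/-- Strictly decreasing exponents. -/
abbrev StrictExponent (n : ℕ) : Type := {d : Fin n →₀ ℕ // StrictAnti d}

theorem degree_le_finite (N : ℕ) : {d : StrictExponent n | d.1.degree ≤ N}.Finite :=
  Set.Finite.preimage Subtype.val_injective.injOn (Finsupp.finite_of_degree_le N)

theorem summable_alt (U : Series n) (c : StrictExponent n → LazardRing) :
    Summable fun e : StrictExponent n => c e • alt (monomial e.1 1 * U) :=
  summable_of_le_order degree_le_finite (fun e => le_order_alt_monomial_mul U e.1) c

theorem coeff_hasSum_alt (U : Series n) {c : StrictExponent n → LazardRing} {f : Series n}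
    (h : HasSum (fun e : StrictExponent n => c e • alt (monomial e.1 1 * U)) f)
    (d : StrictExponent n) : coeff d.1 f = ∑ e ∈ (degree_le_finite d.1.degree).toFinset,
      coeff d.1 (alt (monomial e.1 1 * U)) * c e := by
  rw [coeff_of_hasSum h d.1 (degree_le_finite d.1.degree).toFinset]
  · exact Finset.sum_congr rfl fun e _ => by rw [coeff_smul, mul_comm]
  · intro e he
    have he' : d.1.degree < e.1.degree := by simpa using he
    refine coeff_of_lt_order ((lt_of_lt_of_le ?_ (le_order_alt_monomial_mul U e.1)).trans_le
      le_order_smul)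
    exact_mod_cast he'

/-- The triangular system matches the coefficients of the sum with those of `f` at strictly
decreasing exponents; both series are antisymmetric, so they agree everywhere. -/
theorem exists_hasSum_alt {U : Series n} (hU : constantCoeff U = 1) {f : Series n}
    (hf : IsAnti f) : ∃ c : StrictExponent n → LazardRing,
      HasSum (fun e : StrictExponent n => c e • alt (monomial e.1 1 * U)) f := by
  classical
  obtain ⟨c, hc⟩ := exists_triangular (deg := fun d : StrictExponent n => d.1.degree)
    (fun d => (degree_le_finite d.1.degree).toFinset) (by simp)
    (M := fun d e => coeff d.1 (alt (monomial e.1 1 * U)))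
    (fun d e hde => by
      rw [coeff_alt_monomial_mul hU d.2 e.2 hde]
      exact if_congr Subtype.ext_iff.symm rfl rfl)
    (fun d => coeff d.1 f)
  obtain ⟨g, hg⟩ := summable_alt U c
  refine ⟨c, ?_⟩
  have hga : IsAnti g := by
    intro w
    have h1 := hasSum_subst hg (hasSubst_X_comp w)
    rw [← rename_eq_subst] at h1
    refine h1.unique ((hg.const_smul (Equiv.Perm.sign w : ℤ)).congr_fun fun e => ?_)
    rw [← rename_eq_subst, map_smul, isAnti_alt _ w, smul_comm]
  have : f - g = 0 := by
    refine IsAnti.eq_zero (fun w => by rw [map_sub, hf w, hga w, smul_sub]) fun d hd => ?_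
    rw [map_sub, coeff_hasSum_alt U hg ⟨d, hd⟩, hc ⟨d, hd⟩, sub_self]
  rwa [sub_eq_zero.mp this]

theorem eq_zero_of_hasSum_alt {U : Series n} (hU : constantCoeff U = 1)
    {c : StrictExponent n → LazardRing}
    (h : HasSum (fun e : StrictExponent n => c e • alt (monomial e.1 1 * U)) 0)
    (d : StrictExponent n) : c d = 0 := by
  classical
  refine triangular_eq_zero (deg := fun d : StrictExponent n => d.1.degree)
    (fun d => (degree_le_finite d.1.degree).toFinset) (by simp)
    (M := fun d e => coeff d.1 (alt (monomial e.1 1 * U)))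
    (fun d e hde => by
      rw [coeff_alt_monomial_mul hU d.2 e.2 hde]
      exact if_congr Subtype.ext_iff.symm rfl rfl) (fun d => ?_) d
  rw [← coeff_hasSum_alt U h d, map_zero]

end

/-! ### Universal Schur functions of maximal length -/

section

variable {n : ℕ}

/-- The Vandermonde product of the `x_i - x_j` for `i < j`. -/
def vandermondeProd (n : ℕ) : Series n := ∏ i, ∏ j ∈ Finset.Ioi i, (X i - X j)

theorem vandermondeProd_ne_zero : vandermondeProd n ≠ 0 :=
  Finset.prod_ne_zero_iff.mpr fun _ _ => Finset.prod_ne_zero_iff.mpr fun _ hj =>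
    (prime_X_sub_X (Finset.mem_Ioi.mp hj).ne).ne_zero

theorem prod_X_sub_X_perm (w : Equiv.Perm (Fin n)) :
    ∏ i, ∏ j ∈ Finset.Ioi i, (X (w i) - X (w j) : Series n) =
      ((Equiv.Perm.sign w : ℤ) : Series n) * vandermondeProd n :=
  w.prod_Ioi_comp_eq_sign_mul_prod (f := fun i j => (X i - X j : Series n)) (by simp)

theorem fnumProd_ne_zero : fnumProd n ≠ 0 :=
  Finset.prod_ne_zero_iff.mpr fun _ _ => Finset.prod_ne_zero_iff.mpr fun _ hj =>
    (prime_fnum (Finset.mem_Ioi.mp hj).ne).ne_zero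

theorem sign_cast_ne_zero (w : Equiv.Perm (Fin n)) :
    ((Equiv.Perm.sign w : ℤ) : Series n) ≠ 0 := by
  intro h
  have := congrArg (Int.cast : ℤ → Series n) (sign_mul_self w)
  rw [Int.cast_mul, h, zero_mul, Int.cast_one] at this
  exact zero_ne_one this

theorem prod_fnum_perm (w : Equiv.Perm (Fin n)) :
    ∏ i, ∏ j ∈ Finset.Ioi i, fnum (w i) (w j) = fnumProd n := by
  -- The sign rule needs an antisymmetric function of `i` and `j`. Multiplying the symmetric `x_i ⊞
  -- x_j` by `x_i - x_j` provides one; the signed Vandermonde product is cancelled afterwards.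
  have h := w.prod_Ioi_comp_eq_sign_mul_prod
    (f := fun i j => (X i - X j : Series n) * fnum i j)
    (fun i j => by rw [fnum_comm i j]; ring)
  simp only [Finset.prod_mul_distrib] at h
  rw [prod_X_sub_X_perm, ← vandermondeProd, ← fnumProd, ← mul_assoc] at h
  exact mul_left_cancel₀ (mul_ne_zero (sign_cast_ne_zero w) vandermondeProd_ne_zero) h

theorem rename_fnum (w : Equiv.Perm (Fin n)) (i j : Fin n) :
    rename w (fnum i j) = fnum (w i) (w j) := by
  rw [rename_eq_subst, fnum_subst (hasSubst_X_comp w)]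
  rfl

theorem rename_fden (w : Equiv.Perm (Fin n)) (i j : Fin n) :
    rename w (fden i j) = fden (w i) (w j) := by
  rw [rename_eq_subst, fden_subst (hasSubst_X_comp w)]
  rfl

theorem rename_fnumProd (w : Equiv.Perm (Fin n)) : rename w (fnumProd n) = fnumProd n := by
  rw [fnumProd, map_prod, ← fnumProd, ← prod_fnum_perm w]
  refine Finset.prod_congr rfl fun i _ => ?_
  rw [map_prod]
  exact Finset.prod_congr rfl fun j _ => rename_fnum w i j

theorem rename_vandermondeProd (w : Equiv.Perm (Fin n)) :
    rename w (vandermondeProd n) = (Equiv.Perm.sign w : ℤ) • vandermondeProd n := by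
  rw [zsmul_eq_mul, ← prod_X_sub_X_perm, vandermondeProd, map_prod]
  refine Finset.prod_congr rfl fun i _ => ?_
  rw [map_prod]
  exact Finset.prod_congr rfl fun j _ => by rw [map_sub, rename_X, rename_X]

theorem rename_prod_head (h : PowerSeries LazardRing) (w : Equiv.Perm (Fin n)) :
    rename w (∏ a, h.subst (X a : Series n)) = ∏ a, h.subst (X a : Series n) := by
  rw [map_prod]
  refine Eq.trans (Finset.prod_congr rfl fun a _ => ?_)
    (Equiv.prod_comp w fun a => h.subst (X a : Series n))
  rw [rename_eq_subst, powerSeries_subst_subst h (hasSubst_X_comp w), Function.comp_apply]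

/-- The ratio `(x_i - x_j) / (x_i ⊞ χ(x_j))` is a series; comparing the coefficients of `x_i` shows
that its constant term is 1. -/
theorem exists_ratio (n : ℕ) : ∃ u : Fin n → Fin n → Series n, ∀ i j, i ≠ j →
    fden i j * u i j = X i - X j ∧ constantCoeff (u i j) = 1 := by
  have key : ∀ i j : Fin n, ∃ u : Series n, i ≠ j →
      fden i j * u = X i - X j ∧ constantCoeff u = 1 := by
    intro i j
    by_cases hij : i = j
    · exact ⟨0, fun h => absurd hij h⟩
    obtain ⟨u, hu⟩ := (associated_fden hij).symm.dvd
    refine ⟨u, fun _ => ⟨hu.symm, ?_⟩⟩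
    have := congrArg (lin i) hu
    rw [lin_mul _ (constantCoeff_fden i j), lin_fden, map_sub, lin_X, lin_X, if_pos rfl,
      if_neg hij, sub_zero, one_mul] at this
    exact this.symm
  choose u hu using key
  exact ⟨u, hu⟩

/-- The strict partition `(d_1 + 1, …, d_n + 1)` of a strictly decreasing exponent `d`. -/
def StrictExponent.toPartition (d : StrictExponent n) : StrictPartition where
  parts := List.ofFn fun i => d.1 i + 1
  strict := List.pairwise_ofFn.mpr fun _ _ hij => Nat.add_lt_add_right (d.2 hij) 1
  pos a ha := by
    obtain ⟨i, rfl⟩ := List.mem_ofFn.mp ha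
    exact Nat.succ_pos _

theorem StrictExponent.length_toPartition (d : StrictExponent n) : d.toPartition.length = n :=
  List.length_ofFn

theorem StrictExponent.toPartition_injective :
    Function.Injective (toPartition : StrictExponent n → StrictPartition) := by
  intro d e h
  have h1 := List.ofFn_injective (congrArg StrictPartition.parts h)
  refine Subtype.ext (Finsupp.ext fun i => ?_)
  exact Nat.succ_injective (congrFun h1 i)

theorem StrictExponent.range_toPartition (l : StrictPartition) (hl : l.length = n) :
    l ∈ Set.range (toPartition : StrictExponent n → StrictPartition) := by
  subst hl
  have hp : ∀ i : Fin l.length, 0 < l.parts.get i := fun i => l.pos _ (List.get_mem _ _)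
  refine ⟨⟨Finsupp.equivFunOnFinite.symm fun i : Fin l.length => l.parts.get i - 1, ?_⟩, ?_⟩
  · intro i j hij
    have h1 := List.pairwise_iff_get.mp l.strict i j hij
    have h2 := hp j
    simp only [Finsupp.equivFunOnFinite_symm_apply_apply]
    omega
  · obtain ⟨parts, h1, h2⟩ := l
    simp only [toPartition, StrictPartition.mk.injEq]
    refine (congrArg List.ofFn (funext fun i => ?_)).trans (List.ofFn_get parts)
    simp only [Finsupp.equivFunOnFinite_symm_apply_apply]
    have := hp i
    exact Nat.sub_add_cancel this

/-- For `n` parts in `n` variables there is no factorial, and `E = ∏ h(x_a) ∏_{i<j} (x_i ⊞ x_j)` is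
symmetric, so it comes out of the sum over permutations. What is left is `x^d ∏_{i<j} 1 / (x_i ⊞
χ(x_j))`, which the Vandermonde product turns into the signed sum of the permuted `x^d U`. The
exponents are `d i = λ_i - 1`, since the head takes the place of one power. -/
theorem vandermondeProd_mul_schurSeries (h : PowerSeries LazardRing) (n : ℕ) :
    ∃ U : Series n, constantCoeff U = 1 ∧ ∀ d : StrictExponent n,
      vandermondeProd n * schurSeries h n d.toPartition.parts =
        ((∏ a, h.subst (X a : Series n)) * fnumProd n) * alt (monomial d.1 1 * U) := by
  obtain ⟨u, hu⟩ := exists_ratio n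
  refine ⟨∏ i, ∏ j ∈ Finset.Ioi i, u i j, ?_, fun d => ?_⟩
  · rw [map_prod]
    refine Finset.prod_eq_one fun i _ => ?_
    rw [map_prod]
    exact Finset.prod_eq_one fun j hj => (hu i j (Finset.mem_Ioi.mp hj).ne).2
  have hinj := IsFractionRing.injective (Series n) (Fractions n)
  set al := algebraMap (Series n) (Fractions n) with hal
  refine hinj ?_
  have hlen : d.toPartition.parts.length = n := d.length_toPartition
  have e := factorial_mul_algebraMap_schurSeries h hlen.le
  rw [hlen, Nat.sub_self, Nat.factorial_zero, Nat.cast_one, one_mul, ← hal] at e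
  rw [map_mul, e, alt, Finset.mul_sum, Finset.mul_sum, map_sum]
  refine Finset.sum_congr rfl fun w _ => ?_
  have hne : ∀ i j, j ∈ Finset.Ioi i → w i ≠ w j := fun i j hj =>
    w.injective.ne (Finset.mem_Ioi.mp hj).ne
  set Dw : Series n := ∏ i, ∏ j ∈ Finset.Ioi i, fden (w i) (w j) with hDw
  have hDw0 : Dw ≠ 0 := Finset.prod_ne_zero_iff.mpr fun i _ => Finset.prod_ne_zero_iff.mpr
    fun j hj => fden_ne_zero (hne i j hj)
  have hDw0' : al Dw ≠ 0 := (map_ne_zero_iff _ hinj).mpr hDw0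
  have hruu : ∀ i j, j ∈ Finset.Ioi i → rename w (u i j) = u (w i) (w j) := by
    intro i j hj
    have h1 := congrArg (rename w) (hu i j (Finset.mem_Ioi.mp hj).ne).1
    rw [map_mul, rename_fden, map_sub, rename_X, rename_X, ← (hu _ _ (hne i j hj)).1] at h1
    exact mul_left_cancel₀ (fden_ne_zero (hne i j hj)) h1
  -- This is where the sign in `alt` comes from: the Vandermonde product divided by the permuted
  -- denominator is `sign w` times the permuted `U`.
  have hU : Dw * rename w (∏ i, ∏ j ∈ Finset.Ioi i, u i j) =
      ((Equiv.Perm.sign w : ℤ) : Series n) * vandermondeProd n := by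
    rw [← prod_X_sub_X_perm, hDw, map_prod, ← Finset.prod_mul_distrib]
    refine Finset.prod_congr rfl fun i _ => ?_
    rw [map_prod, ← Finset.prod_mul_distrib]
    refine Finset.prod_congr rfl fun j hj => ?_
    rw [hruu i j hj, (hu _ _ (hne i j hj)).1]
  have hm : rename w (monomial d.1 1 : Series n) = ∏ i, X (w i) ^ d.1 i := by
    rw [monomial_one_eq, Finsupp.prod_fintype _ _ (by simp), map_prod]
    exact Finset.prod_congr rfl fun i _ => by rw [map_pow, rename_X]
  have hT : (∏ i : Fin n, if (i : ℕ) < n then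
      al (headPow h (X (w i)) (d.toPartition.parts.getD i 0)) * ∏ j : Fin n,
        if i < j then al (fnum (w i) (w j)) * (al (fden (w i) (w j)))⁻¹ else 1 else 1) * al Dw =
      al ((∏ a, h.subst (X a : Series n)) * rename w (monomial d.1 1 : Series n) * fnumProd n) := by
    have hH : ∏ a, h.subst (X a : Series n) = ∏ i, h.subst (X (w i) : Series n) :=
      (Equiv.prod_comp w fun a => h.subst (X a : Series n)).symm
    rw [hDw, hm, hH, ← prod_fnum_perm w, ← Finset.prod_mul_distrib,
      ← Finset.prod_mul_distrib, map_prod, map_prod, ← Finset.prod_mul_distrib]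
    refine Finset.prod_congr rfl fun i _ => ?_
    rw [if_pos i.2, map_mul, mul_assoc]
    congr 1
    · congr 1
      have : d.toPartition.parts.getD i 0 = d.1 i + 1 := by
        rw [List.getD_eq_getElem _ _ (by rw [hlen]; exact i.2)]
        simp [StrictExponent.toPartition]
      rw [this, headPow, if_neg (Nat.succ_ne_zero _), Nat.add_sub_cancel]
    · rw [← Finset.prod_filter, map_prod, map_prod, Finset.filter_lt_eq_Ioi,
        ← Finset.prod_mul_distrib]
      refine Finset.prod_congr rfl fun j hj => ?_
      rw [mul_assoc, inv_mul_cancel₀, mul_one]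
      exact (map_ne_zero_iff _ hinj).mpr (fden_ne_zero (hne i j hj))
  refine mul_right_cancel₀ hDw0' ?_
  rw [mul_assoc, hT, ← map_mul, ← map_mul]
  congr 1
  have hs := congrArg (Int.cast : ℤ → Series n) (sign_mul_self w)
  rw [Int.cast_mul, Int.cast_one] at hs
  rw [zsmul_eq_mul, map_mul]
  linear_combination (-(∏ a, h.subst (X a : Series n)) * rename w (monomial d.1 1 : Series n) *
    fnumProd n * vandermondeProd n) * hs - ((∏ a, h.subst (X a : Series n)) *
      rename w (monomial d.1 1 : Series n) * fnumProd n *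
      ((Equiv.Perm.sign w : ℤ) : Series n)) * hU

/-- With `f = E g`, the product of `g` and the Vandermonde product is antisymmetric. Its expansion
in the series `alt (x^d U)`, multiplied by `E`, is the Vandermonde product times an expansion of
`f`; the coefficients are the same. -/
theorem exists_hasSum_of_vanish {h : PowerSeries LazardRing} (H : IsHead h) {f : Series n}
    (hf : f ∈ Gam n) (hX : ∀ a : Fin n, X a ∣ f) (hh : ∀ a : Fin n, h.subst (X a : Series n) ∣ f) :
    ∃ c : StrictPartition → LazardRing, HasSum (fun l => c l • schurSeries h n l.parts) f := by
  obtain ⟨U, hU, hsch⟩ := vandermondeProd_mul_schurSeries h n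
  obtain ⟨g, hg⟩ := Gam_dvd H hf hX hh
  set E : Series n := (∏ a, h.subst (X a : Series n)) * fnumProd n with hE
  have hE0 : E ≠ 0 := mul_ne_zero (Finset.prod_ne_zero_iff.mpr fun a _ => head_ne_zero H a)
    fnumProd_ne_zero
  have hgs : ∀ w : Equiv.Perm (Fin n), rename w g = g := by
    intro w
    have h1 := hf.1 w
    rw [hg, map_mul, hE, map_mul, rename_prod_head, rename_fnumProd, ← hE] at h1
    exact mul_left_cancel₀ hE0 h1
  obtain ⟨c, hc⟩ := exists_hasSum_alt hU (f := vandermondeProd n * g) fun w => by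
    rw [map_mul, rename_vandermondeProd, hgs, smul_mul_assoc]
  -- Only partitions of length exactly `n` are needed; the coefficient is 0 at all others.
  refine ⟨Function.extend StrictExponent.toPartition c 0, ?_⟩
  rw [← StrictExponent.toPartition_injective.hasSum_iff]
  · obtain ⟨f', hf'⟩ := summable_of_le_order (deg := fun d : StrictExponent n =>
      d.toPartition.parts.sum) (b := fun d => schurSeries h n d.toPartition.parts)
      (fun N => (sum_le_finite N).preimage StrictExponent.toPartition_injective.injOn)
      (fun d => le_order_schurSeries H.constantCoeff n _) c
    have h1 := hf'.mul_left (vandermondeProd n)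
    have h2 := hc.mul_left E
    have h3 : vandermondeProd n * f' = E * (vandermondeProd n * g) :=
      h1.unique (h2.congr_fun fun d => by
        rw [mul_smul_comm, mul_smul_comm, hsch])
    have h4 : f' = f := by
      rw [hg]
      refine mul_left_cancel₀ vandermondeProd_ne_zero (h3.trans ?_)
      ring
    rw [← h4]
    refine hf'.congr_fun fun d => ?_
    rw [Function.comp_apply, StrictExponent.toPartition_injective.extend_apply]
  · intro l hl
    rw [Function.extend_apply' _ _ _ (fun h => hl h), Pi.zero_apply, zero_smul]

/-- Shorter partitions have coefficient zero and longer ones have zero Schur function, so only the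
partitions of length `n` remain, where uniqueness of the antisymmetric expansion applies. -/
theorem eq_zero_of_hasSum_schurSeries {h : PowerSeries LazardRing} (H : IsHead h)
    {c : StrictPartition → LazardRing} (hc : ∀ l, l.length < n → c l = 0)
    (hs : HasSum (fun l => c l • schurSeries h n l.parts) 0) (l : StrictPartition)
    (hl : l.length = n) : c l = 0 := by
  obtain ⟨U, hU, hsch⟩ := vandermondeProd_mul_schurSeries h n
  set E : Series n := (∏ a, h.subst (X a : Series n)) * fnumProd n with hE
  have hE0 : E ≠ 0 := mul_ne_zero (Finset.prod_ne_zero_iff.mpr fun a _ => head_ne_zero H a)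
    fnumProd_ne_zero
  rw [← StrictExponent.toPartition_injective.hasSum_iff (γ := StrictExponent n)] at hs
  · obtain ⟨g, hg⟩ := summable_alt U fun d : StrictExponent n => c d.toPartition
    have h1 := hs.mul_left (vandermondeProd n)
    have h2 := hg.mul_left E
    have h3 : vandermondeProd n * 0 = E * g := h1.unique (h2.congr_fun fun d => by
      rw [Function.comp_apply, mul_smul_comm, mul_smul_comm, hsch])
    have h4 : g = 0 := by
      rw [mul_zero] at h3
      exact (mul_eq_zero.mp h3.symm).resolve_left hE0
    rw [h4] at hg
    obtain ⟨d, rfl⟩ := StrictExponent.range_toPartition l hl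
    exact eq_zero_of_hasSum_alt hU hg d
  · intro l hl
    rcases lt_trichotomy l.length n with h1 | h1 | h1
    · rw [hc l h1, zero_smul]
    · exact absurd (StrictExponent.range_toPartition l h1) hl
    · rw [schurSeries_eq_zero h h1, smul_zero]

end

/-! ### The basis theorem -/

/-- The properties of the rings `G n ⊆ Γ^𝕃(x_1, …, x_n)` under which the functions
`schurSeries h n l` form a formal basis of `G n`. -/
structure IsSchurRing (h : PowerSeries LazardRing) (G : ∀ n, Subalgebra LazardRing (Series n)) :
    Prop where
  isHead : IsHead h
  le_Gam : ∀ n, G n ≤ Gam n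
  mem : ∀ n (l : StrictPartition), schurSeries h n l.parts ∈ G n
  closed : ∀ n (c : StrictPartition → LazardRing) f,
    HasSum (fun l => c l • schurSeries h n l.parts) f → f ∈ G n
  restrict : ∀ n, ∀ f ∈ G (n + 1), killCompl (Fin.castSuccEmb : Fin n ↪ Fin (n + 1)) f ∈ G n
  head_dvd : ∀ n, ∀ f ∈ G n, (∀ a, X a ∣ f) → ∀ a : Fin n, h.subst (X a : Series n) ∣ f

theorem X_dvd_of_killCompl_eq_zero {n : ℕ} {f : Series (n + 1)} (hf : f ∈ Gam (n + 1))
    (h0 : killCompl (Fin.castSuccEmb : Fin n ↪ Fin (n + 1)) f = 0) (a : Fin (n + 1)) : X a ∣ f := by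
  have h1 : X (Fin.last n) ∣ f := by
    rw [X_dvd_iff_subst]
    exact (rename_killCompl_castSuccEmb f).symm.trans (by rw [h0, map_zero])
  have h2 := map_dvd (rename (R := LazardRing) (Equiv.swap (Fin.last n) a)) h1
  rwa [hf.1, rename_X, Equiv.swap_apply_left] at h2

theorem hasSum_strictPartitionLE_iff {h : PowerSeries LazardRing} {n : ℕ} {c : StrictPartition → LazardRing} {f : Series n} :
    HasSum (fun l : StrictPartitionLE n => c l.1 • schurSeries h n l.1.parts) f ↔
      HasSum (fun l => c l • schurSeries h n l.parts) f := by
  refine Subtype.val_injective.hasSum_iff (f := fun l => c l • schurSeries h n l.parts) ?_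
  intro l hl
  rw [Subtype.range_coe_subtype] at hl
  rw [schurSeries_eq_zero h (not_le.mp hl), smul_zero]

namespace IsSchurRing

variable {h : PowerSeries LazardRing} {G : ∀ n, Subalgebra LazardRing (Series n)}

theorem summable (S : IsSchurRing h G) (n : ℕ) (c : StrictPartition → LazardRing) :
    Summable fun l : StrictPartition => c l • schurSeries h n l.parts :=
  summable_of_le_order sum_le_finite
    (fun l => le_order_schurSeries S.isHead.constantCoeff n l.parts) c

theorem hasSum_restrict (S : IsSchurRing h G) {n : ℕ} {c : StrictPartition → LazardRing} {f : Series (n + 1)}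
    (hf : HasSum (fun l => c l • schurSeries h (n + 1) l.parts) f) :
    HasSum (fun l => c l • schurSeries h n l.parts)
      (killCompl (Fin.castSuccEmb : Fin n ↪ Fin (n + 1)) f) :=
  (hasSum_killCompl hf).congr_fun fun l => by
    rw [map_smul, killCompl_schurSeries S.isHead.constantCoeff l.pos]

/-- Expand `f(x_1, …, x_n, 0)` by induction and use the same coefficients in `n + 1` variables. By
stability the difference vanishes at `x_{n+1} = 0`, hence by symmetry is divisible by every
variable, and it is an expansion in partitions of length `n + 1`. -/
theorem exists_hasSum (S : IsSchurRing h G) : ∀ (n : ℕ), ∀ f ∈ G n, ∃ c : StrictPartition → LazardRing,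
    HasSum (fun l => c l • schurSeries h n l.parts) f := by
  intro n
  induction n with
  | zero =>
    exact fun f hf => exists_hasSum_of_vanish S.isHead (S.le_Gam 0 hf) (fun a => a.elim0)
      (fun a => a.elim0)
  | succ n ih =>
    intro f hf
    obtain ⟨c, hc⟩ := ih _ (S.restrict n f hf)
    obtain ⟨g, hg⟩ := S.summable (n + 1) c
    have hfg : f - g ∈ G (n + 1) := sub_mem hf (S.closed _ c g hg)
    have h0 : killCompl (Fin.castSuccEmb : Fin n ↪ Fin (n + 1)) (f - g) = 0 := by
      rw [map_sub, sub_eq_zero]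
      exact hc.unique (S.hasSum_restrict hg)
    have hX := X_dvd_of_killCompl_eq_zero (S.le_Gam _ hfg) h0
    obtain ⟨c', hc'⟩ := exists_hasSum_of_vanish S.isHead (S.le_Gam _ hfg) hX
      (S.head_dvd _ _ hfg hX)
    refine ⟨c' + c, ?_⟩
    rw [← sub_add_cancel f g]
    exact (hc'.add hg).congr_fun fun l => by rw [Pi.add_apply, add_smul]

/-- Setting the last variable to zero kills the coefficients of the shorter partitions by induction,
which leaves those of maximal length. -/
theorem eq_zero (S : IsSchurRing h G) : ∀ (n : ℕ) {c : StrictPartition → LazardRing},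
    HasSum (fun l => c l • schurSeries h n l.parts) 0 → ∀ l, l.length ≤ n → c l = 0 := by
  intro n
  induction n with
  | zero =>
    exact fun hc l hl => eq_zero_of_hasSum_schurSeries S.isHead
      (fun _ hl => absurd hl (Nat.not_lt_zero _)) hc l (Nat.le_zero.mp hl)
  | succ n ih =>
    intro c hc l hl
    have h1 : ∀ l, l.length ≤ n → c l = 0 := by
      have := S.hasSum_restrict hc
      rw [map_zero] at this
      exact ih this
    rcases Nat.le_succ_iff.mp hl with h2 | h2
    · exact h1 l h2
    · exact eq_zero_of_hasSum_schurSeries S.isHead (fun l hl => h1 l (Nat.le_of_lt_succ hl)) hc l h2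

theorem eq_of_hasSum (S : IsSchurRing h G) {n : ℕ} {c c' : StrictPartition → LazardRing} {f : Series n}
    (hc : HasSum (fun l => c l • schurSeries h n l.parts) f)
    (hc' : HasSum (fun l => c' l • schurSeries h n l.parts) f) (l : StrictPartition)
    (hl : l.length ≤ n) : c l = c' l := by
  have h0 := hc.sub hc'
  rw [sub_self] at h0
  rw [← sub_eq_zero]
  exact S.eq_zero n (c := c - c') (h0.congr_fun fun l => by rw [Pi.sub_apply, sub_smul]) l hl

theorem isSeriesBasis (S : IsSchurRing h G) (n : ℕ) : IsSeriesBasis n (G n)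
    (fun l : StrictPartitionLE n => schurSeries h n l.1.parts) := by
  have hext : ∀ c : StrictPartitionLE n → LazardRing,
      ∃ c' : StrictPartition → LazardRing, ∀ l : StrictPartitionLE n, c' l.1 = c l :=
    fun c => ⟨Function.extend Subtype.val c 0, Subtype.val_injective.extend_apply c 0⟩
  refine ⟨fun l => S.mem n l.1, fun c => ?_, fun f hf => ?_⟩
  · obtain ⟨c, rfl⟩ : ∃ c' : StrictPartition → LazardRing, c = fun l => c' l.1 :=
      (hext c).imp fun _ h => funext fun l => (h l).symm
    obtain ⟨f, hf⟩ := S.summable n c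
    exact ⟨f, S.closed n c f hf, hasSum_strictPartitionLE_iff.mpr hf⟩
  · obtain ⟨c, hc⟩ := S.exists_hasSum n f hf
    refine ⟨fun l => c l.1, hasSum_strictPartitionLE_iff.mpr hc, fun d hd => ?_⟩
    obtain ⟨d, rfl⟩ : ∃ d' : StrictPartition → LazardRing, d = fun l => d' l.1 :=
      (hext d).imp fun _ h => funext fun l => (h l).symm
    exact funext fun l => S.eq_of_hasSum (hasSum_strictPartitionLE_iff.mp hd) hc l.1 l.2

theorem isLimitBasis (S : IsSchurRing h G) : IsLimitBasis (invLimit G) (fun (l : StrictPartition) n => schurSeries h n l.parts) := by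
  refine ⟨fun l => ⟨fun n => S.mem n l, fun n =>
    killCompl_schurSeries S.isHead.constantCoeff l.pos⟩, fun c => ?_, fun f hf => ?_⟩
  · choose f hf using fun n => S.summable n c
    exact ⟨f, ⟨fun n => S.closed n c _ (hf n), fun n => (S.hasSum_restrict (hf (n + 1))).unique
      (hf n)⟩, Pi.hasSum.mpr hf⟩
  · choose c hc using fun n => S.exists_hasSum n (f n) (hf.1 n)
    -- The coefficient at `l` is already determined in `l.length` variables and does not change
    -- afterwards. With fewer variables the Schur function is zero, so the coefficient chosen there
    -- is irrelevant.
    have hstep : ∀ n l, l.length ≤ n → c n l = c l.length l := by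
      intro n l hl
      induction n, hl using Nat.le_induction with
      | base => rfl
      | succ n hn ih =>
        have h1 := S.hasSum_restrict (hc (n + 1))
        rw [hf.2] at h1
        rw [S.eq_of_hasSum h1 (hc n) l hn, ih]
    refine ⟨fun l => c l.length l, Pi.hasSum.mpr fun n => (hc n).congr_fun fun l => ?_,
      fun d hd => funext fun l => S.eq_of_hasSum (Pi.hasSum.mp hd l.length) (hc l.length) l le_rfl⟩
    rcases le_or_gt l.length n with hl | hl
    · rw [hstep n l hl]
      rfl
    · change c l.length l • schurSeries h n l.parts = c n l • schurSeries h n l.parts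
      rw [schurSeries_eq_zero h hl, smul_zero, smul_zero]

end IsSchurRing

/-! ### The two rings of supersymmetric series -/

theorem isSchurRing_Gam : IsSchurRing PowerSeries.X Gam := by
  refine ⟨isHead_X, fun _ => le_rfl, fun n l => schurSeries_mem_Gam PowerSeries.X l.parts, ?_, ?_, ?_⟩
  · intro n c f hf
    have hm : ∀ l : StrictPartition, c l • schurSeries PowerSeries.X n l.parts ∈ Gam n :=
      fun l => (Gam n).smul_mem (schurSeries_mem_Gam PowerSeries.X l.parts) (c l)
    exact Gam_closed hm hf
  · intro n f hf
    exact killCompl_mem_Gam hf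
  · intro n f _ hX a
    rw [PowerSeries.subst_X (hasSubst_of_constCoeff (constantCoeff_X_eq_zero a))]
    exact hX a

theorem isSchurRing_GamPlus : IsSchurRing doubleSeries GamPlus where
  isHead := isHead_doubleSeries
  le_Gam _ _ hf := hf.1
  mem n l := schurSeries_mem_GamPlus l.pos
  closed n c f hf := GamPlus_closed sum_le_finite
    (fun l => le_order_schurSeries constantCoeff_doubleSeries n l.parts)
    (fun l => schurSeries_mem_GamPlus l.pos) hf
  restrict n f hf := killCompl_mem_GamPlus hf
  -- Since `x_a ∣ f`, the term `f(x_a = 0)` is zero, and the defining condition of `GamPlus` says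
  -- that `x_a ⊞ x_a` divides `f` itself.
  head_dvd n f hf hX a := by
    have h1 := hf.2 a
    have h2 : f.subst (zeroSubst a) = 0 := X_dvd_iff_subst.mp (hX a)
    rw [doubleSeries_subst (constantCoeff_X_eq_zero a)]
    rwa [h2, sub_zero] at h1

end UniversalSchur

end

/-! ### The theorem -/

theorem mainTheorem6 :
    -- the fractions defining the universal Schur functions are power series
    (∀ (n : ℕ) (l : UniversalSchur.StrictPartition), l.length ≤ n →
      algebraMap (UniversalSchur.Series n) (UniversalSchur.Fractions n)
          (UniversalSchur.schurP n l) = UniversalSchur.fractionP n l ∧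
        algebraMap (UniversalSchur.Series n) (UniversalSchur.Fractions n)
          (UniversalSchur.schurQ n l) = UniversalSchur.fractionQ n l) ∧
    -- the basis theorem in finitely many variables
    (∀ n : ℕ,
      UniversalSchur.IsSeriesBasis n (UniversalSchur.Gam n)
        (fun l : UniversalSchur.StrictPartitionLE n => UniversalSchur.schurP n l.1) ∧
      UniversalSchur.IsSeriesBasis n (UniversalSchur.GamPlus n)
        (fun l : UniversalSchur.StrictPartitionLE n => UniversalSchur.schurQ n l.1)) ∧
    -- the basis theorem in the limit
    UniversalSchur.IsLimitBasis UniversalSchur.GamLimit UniversalSchur.schurPLimit ∧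
    UniversalSchur.IsLimitBasis UniversalSchur.GamPlusLimit UniversalSchur.schurQLimit := by
  refine ⟨fun n l hl => ?_, fun n => ?_, ?_, ?_⟩
  · rw [UniversalSchur.schurP_eq, UniversalSchur.schurQ_eq]
    exact ⟨UniversalSchur.algebraMap_schurSeries _ (fun i k => (UniversalSchur.headPow_X
        (UniversalSchur.constantCoeff_X_eq_zero i) k).symm) l hl,
      UniversalSchur.algebraMap_schurSeries _ (fun i k => (UniversalSchur.headPow_doubleSeries
        (UniversalSchur.constantCoeff_X_eq_zero i) k).symm) l hl⟩
  · simp only [UniversalSchur.schurP_eq, UniversalSchur.schurQ_eq]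
    exact ⟨UniversalSchur.isSchurRing_Gam.isSeriesBasis n,
      UniversalSchur.isSchurRing_GamPlus.isSeriesBasis n⟩
  · have : UniversalSchur.schurPLimit =
        fun l n => UniversalSchur.schurSeries PowerSeries.X n l.parts :=
      funext fun l => funext fun n => UniversalSchur.schurP_eq n l
    rw [this]
    exact UniversalSchur.isSchurRing_Gam.isLimitBasis
  · have : UniversalSchur.schurQLimit =
        fun l n => UniversalSchur.schurSeries UniversalSchur.doubleSeries n l.parts :=
      funext fun l => funext fun n => UniversalSchur.schurQ_eq n l
    rw [this]
    exact UniversalSchur.isSchurRing_GamPlus.isLimitBasis
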